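/- **Setting.** Let $n,m\ge 1$; functions are complex valued, $B(z,r)$ is an open ball of $\mathbb R^n$ ($r>0$), and $2B=B(z,2r)$ for $B=B(z,r)$. *Growth functions.* Let $\varphi:\mathbb R^n\times(0,\infty)\to(0,\infty)$ be measurable. We write $\varphi\in\mathcal G^{dec}$ if there is $C>0$ with $\varphi(x,s)\le C\varphi(x,r)$ and $\varphi(x,r)r^n\le C\varphi(x,s)s^n$ for all $x$ and all $0<r<s$. For $p\in[1,\infty)$, $$\|f\|_{L^{(p,\varphi)}}=\sup_{B}\Big(\frac1{\varphi(B)}\,\frac1{|B|}\int_B|f|^p\,dy\Big)^{1/p},\qquad \varphi(B(z,r)):=\varphi(z,r),$$ the supremum being over all balls; $L^{(p,\varphi)}(\mathbb R^n)$ is the space of measurable $f$ with finite norm. *Operators.* Let $\omega:[0,\infty)\to[0,\infty)$ be nondecreasing with $\int_0^1\omega(t)\frac{dt}t<\infty$. A kernel of type $\omega$ is a function $K(x,y_1,\dots,y_m)$, locally integrable off the diagonal $x=y_1=\dots=y_m$ of $(\mathbb R^n)^{m+1}$, such that for some $A>0$, with $\sigma:=\sum_i|x-y_i|$ and off the diagonal,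 $|K(x,\vec y)|\le A\sigma^{-mn}$; $|K(x,\vec y)-K(x',\vec y)|\le A\sigma^{-mn}\omega(|x-x'|/\sigma)$ if $|x-x'|\le\frac12\max_j|x-y_j|$; and, for each $i$, if $\vec y\,'$ is $\vec y$ with $y_i$ replaced by $y_i'$, $|K(x,\vec y)-K(x,\vec y\,')|\le A\sigma^{-mn}\omega(|y_i-y_i'|/\sigma)$ if $|y_i-y_i'|\le\frac12\max_j|x-y_j|$. An $m$-linear Calderón–Zygmund operator of type $\omega$ is an $m$-linear $T:\mathcal S(\mathbb R^n)^m\to\mathcal S'(\mathbb R^n)$ such that, for some kernel $K$ of type $\omega$ and all $f_i\in C_c^\infty$, the distribution $T(f_1,\dots,f_m)$ agrees on the complement of $\bigcap_i\operatorname{supp}f_i$ with $x\mapsto\int_{(\mathbb R^n)^m}K(x,\vec y)\prod_if_i(y_i)\,d\vec y$, and such that $T$ extends to a bounded $m$-linear operator $L^{s_1}\times\dots\times L^{s_m}\to L^{s,\infty}$ for some $s_i,s\in(1,\infty)$ with $\sum_i1/s_i=1/s$, or $L^{s_1}\times\dots\times L^{s_m}\to L^1$ for some $s_i\in(1,\infty)$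 with $\sum_i1/s_i=1$. **Lemma 3.1.** Let $T$ be an $m$-linear Calderón–Zygmund operator of type $\omega$ with kernel $K$, where also $\int_0^1\omega(t)\log\frac1t\,\frac{dt}t<\infty$. Let $1<p,p_1,\dots,p_m<\infty$ with $\sum_i1/p_i=1/p$. Let $\varphi,\varphi_1,\dots,\varphi_m\in\mathcal G^{dec}$ each tend to $\infty$ as $r\to0$ and to $0$ as $r\to\infty$, for every $x$; assume $\prod_i\varphi_i^{1/p_i}=\varphi^{1/p}$, and that for some constant $C_1$, $\int_r^\infty\varphi(x,t)\frac{dt}t\le C_1\varphi(x,r)$ for all $x\in\mathbb R^n$, $r>0$. Then $T$ has a unique extension to a bounded $m$-linear operator $L^{p_1}\times\dots\times L^{p_m}\to L^p$, again denoted by $T$, and there is a constant $C$ such that the following holds for all $f_i\in L^{(p_i,\varphi_i)}(\mathbb R^n)$, $i=1,\dots,m$. For a ball $B$ put $f_i^0=f_i\chi_{2B}$ and $f_i^\infty=f_i\chi_{\mathbb R^n\setminus2B}$. 1. For every ball $B=B(z,r)$: $f_i^0\in L^{p_i}$ for all $i$; $\int_{2r}^\infty\varphi(z,t)^{1/p}\frac{dt}t<\infty$;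 and for every $x\in B$ the integral $\int_{(\mathbb R^n)^m}K(x,\vec y)\prod_if_i^{\alpha_i}(y_i)\,d\vec y$ converges absolutely for each $\alpha\in\{0,\infty\}^m$ with $\alpha\ne(0,\dots,0)$, with $$\int_{(\mathbb R^n)^m}\Big|K(x,\vec y)\prod_{i=1}^mf_i^\infty(y_i)\Big|d\vec y\le C\int_{2r}^\infty\frac{\varphi(z,t)^{1/p}}t\,dt\,\prod_{i=1}^m\|f_i\|_{L^{(p_i,\varphi_i)}},$$ $$\int_{(\mathbb R^n)^m}\Big|K(x,\vec y)\widetilde\sum_\alpha\prod_{i=1}^mf_i^{\alpha_i}(y_i)\Big|d\vec y\le C\int_{2r}^\infty\frac{\varphi(z,t)^{1/p}}t\,dt\,\prod_{i=1}^m\|f_i\|_{L^{(p_i,\varphi_i)}},$$ where $\widetilde\sum_\alpha$ is the sum over all $\alpha\in\{0,\infty\}^m$ other than $(0,\dots,0)$ and $(\infty,\dots,\infty)$. 2. For a ball $B$ and almost every $x\in B$ put $$T(\vec f)(x):=T(f_1^0,\dots,f_m^0)(x)+\sum_{\alpha\ne(0,\dots,0)}\int_{(\mathbb R^n)^m}K(x,\vec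 y)\prod_{i=1}^mf_i^{\alpha_i}(y_i)\,d\vec y .$$ This is independent of $B$: for any two balls $B_1,B_2$ the two expressions agree for almost every $x\in B_1\cap B_2$. Hence $T(\vec f)$ is well defined almost everywhere on $\mathbb R^n$. 3. $T(\vec f)\in L^{(p,\varphi)}(\mathbb R^n)$ and $\|T(\vec f)\|_{L^{(p,\varphi)}}\le C\prod_{i=1}^m\|f_i\|_{L^{(p_i,\varphi_i)}}$. -/

import Mathlib

open MeasureTheory Filter Topology Set
open scoped ENNReal NNReal SchwartzMap

/-- `ℝⁿ` with its Euclidean norm. -/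
abbrev Rn (n : ℕ) : Type := EuclideanSpace ℝ (Fin n)

/-! ### Growth functions and generalized Morrey spaces -/

/-- A measurable function `φ : ℝⁿ × (0,∞) → (0,∞)`; values `φ x r` with `r ≤ 0` play no role. -/
def IsGrowthFunction {n : ℕ} (φ : Rn n → ℝ → ℝ) : Prop :=
  (∀ x r, 0 < r → 0 < φ x r) ∧ Measurable (fun a : Rn n × Ioi (0 : ℝ) => φ a.1 a.2)

/-- The class `𝒢^dec`: `φ` is almost decreasing in `r` and `φ(x,r) rⁿ` is almost increasing in `r`,
uniformly in `x`. -/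
def GDec {n : ℕ} (φ : Rn n → ℝ → ℝ) : Prop :=
  IsGrowthFunction φ ∧ ∃ C : ℝ, 0 < C ∧ ∀ x r s, 0 < r → r < s →
    φ x s ≤ C * φ x r ∧ φ x r * r ^ n ≤ C * (φ x s * s ^ n)

/-- `φ(x,r) → ∞` as `r → 0+` and `φ(x,r) → 0` as `r → ∞`, for every `x`. -/
def HasFullRange {n : ℕ} (φ : Rn n → ℝ → ℝ) : Prop :=
  ∀ x, Tendsto (φ x) (𝓝[>] 0) atTop ∧ Tendsto (φ x) atTop (𝓝 0)

/-- `∫_r^∞ φ(x,t)/t dt ≤ C φ(x,r)` with a constant `C` independent of `x` and `r`. -/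
def HasTailBound {n : ℕ} (φ : Rn n → ℝ → ℝ) : Prop :=
  ∃ C : ℝ, 0 < C ∧ ∀ x r, 0 < r →
    ∫⁻ t in Ioi r, ENNReal.ofReal (φ x t / t) ≤ ENNReal.ofReal (C * φ x r)

/-- The generalized Morrey norm: the supremum over all open balls `B = B(z,r)` of
`(φ(B)⁻¹ ⨍_B |f|^p)^(1/p)`, with values in `[0,∞]`. -/
noncomputable def morreyNorm {n : ℕ} (p : ℝ) (φ : Rn n → ℝ → ℝ) (f : Rn n → ℂ) : ℝ≥0∞ :=
  ⨆ (z : Rn n) (r : ℝ) (_ : 0 < r),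
    ((ENNReal.ofReal (φ z r))⁻¹ *
      ⨍⁻ y in Metric.ball z r, ‖f y‖ₑ ^ p ∂volume) ^ (1 / p)

/-- Membership in the generalized Morrey space `L^{(p,φ)}(ℝⁿ)`. -/
def MemMorrey {n : ℕ} (p : ℝ) (φ : Rn n → ℝ → ℝ) (f : Rn n → ℂ) : Prop :=
  AEStronglyMeasurable f volume ∧ morreyNorm p φ f < ∞

/-! ### Multilinear Calderón-Zygmund operators of type `ω` -/

/-- A modulus `ω : [0,∞) → [0,∞)`, nondecreasing, with `∫_0^1 ω(t)/t dt < ∞`. -/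
structure IsDiniModulus (ω : ℝ → ℝ) : Prop where
  nonneg : ∀ t, 0 ≤ t → 0 ≤ ω t
  mono : MonotoneOn ω (Ici 0)
  dini : IntegrableOn (fun t => ω t / t) (Ioo 0 1)

/-- An `m`-linear Calderón-Zygmund kernel of type `ω`. In `smooth_x` and `smooth_y` the condition
`∃ j, d ≤ |x - y_j| / 2` says `d ≤ (1/2) max_j |x - y_j|`. -/
structure IsCZKernel {n m : ℕ} (ω : ℝ → ℝ) (K : Rn n → (Fin m → Rn n) → ℂ) : Prop where
  locallyIntegrable : LocallyIntegrableOn (fun a : Rn n × (Fin m → Rn n) => K a.1 a.2)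
    {a | ∃ i, a.1 ≠ a.2 i} volume
  bounds : ∃ A : ℝ, 0 < A ∧
    (∀ x y, (∃ i, x ≠ y i) → ‖K x y‖ ≤ A / (∑ i, ‖x - y i‖) ^ (m * n)) ∧
    (∀ x x' y, (∃ i, x ≠ y i) → (∃ j, ‖x - x'‖ ≤ 1 / 2 * ‖x - y j‖) →
      ‖K x y - K x' y‖ ≤
        A / (∑ i, ‖x - y i‖) ^ (m * n) * ω (‖x - x'‖ / ∑ i, ‖x - y i‖)) ∧
    (∀ x y i y', (∃ i, x ≠ y i) → (∃ j, ‖y i - y'‖ ≤ 1 / 2 * ‖x - y j‖) →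
      ‖K x y - K x (Function.update y i y')‖ ≤
        A / (∑ i, ‖x - y i‖) ^ (m * n) * ω (‖y i - y'‖ / ∑ i, ‖x - y i‖))

/-- The `m`-linear operator `T : 𝒮 × ⋯ × 𝒮 → 𝒮'` has kernel `K`: for `f_i ∈ C_c^∞`, the
distribution `T(f_1,…,f_m)` is, off `⋂ supp f_i`, the function
`x ↦ ∫ K(x,y_1,…,y_m) f_1(y_1) ⋯ f_m(y_m) dy`. -/
def HasKernel {n m : ℕ}
    (T : MultilinearMap ℂ (fun _ : Fin m => 𝓢(Rn n, ℂ)) 𝓢'(Rn n, ℂ))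
    (K : Rn n → (Fin m → Rn n) → ℂ) : Prop :=
  ∀ f : Fin m → 𝓢(Rn n, ℂ), (∀ i, HasCompactSupport (f i)) →
    ∀ g : 𝓢(Rn n, ℂ), HasCompactSupport g → Disjoint (tsupport g) (⋂ i, tsupport (f i)) →
      T f g = ∫ x, (∫ y : Fin m → Rn n, K x y * ∏ i, f i (y i)) * g x

/-- The quasi-norm of weak `L^q`: `sup_{l > 0} l |{|g| > l}|^{1/q}`. -/
noncomputable def weakNorm {n : ℕ} (q : ℝ) (g : Rn n → ℂ) : ℝ≥0∞ :=
  ⨆ l : ℝ≥0, (l : ℝ≥0∞) * volume {x | (l : ℝ≥0∞) < ‖g x‖ₑ} ^ (1 / q)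

/-- `S` is an extension of `T` to an `m`-linear operator on `L^{q_1} × ⋯ × L^{q_m}` which is bounded
into the space with (quasi-)norm `N`. Functions are identified with the distributions that they
induce by integration. -/
def IsBoundedExtension {n m : ℕ}
    (T : MultilinearMap ℂ (fun _ : Fin m => 𝓢(Rn n, ℂ)) 𝓢'(Rn n, ℂ))
    (q : Fin m → ℝ) (N : (Rn n → ℂ) → ℝ≥0∞)
    (S : MultilinearMap ℂ
      (fun i : Fin m => Lp ℂ (ENNReal.ofReal (q i)) (volume : Measure (Rn n)))
      (Rn n →ₘ[volume] ℂ)) : Prop :=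
  (∃ C : ℝ≥0, ∀ f, N (S f) ≤ C * ∏ i, eLpNorm (f i) (ENNReal.ofReal (q i)) volume) ∧
  ∀ (f : Fin m → 𝓢(Rn n, ℂ)) (g : 𝓢(Rn n, ℂ)),
    T f g = ∫ x, S (fun i => (f i).toLp (ENNReal.ofReal (q i)) volume) x * g x

/-- `T` is an `m`-linear Calderón-Zygmund operator of type `ω` with kernel `K`. The boundedness is
required for some exponents only: into weak `L^{q₀}` with `1 < q₀ < ∞`, or into `L¹`. -/
structure IsCZOperator {n m : ℕ} (ω : ℝ → ℝ) (K : Rn n → (Fin m → Rn n) → ℂ)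
    (T : MultilinearMap ℂ (fun _ : Fin m => 𝓢(Rn n, ℂ)) 𝓢'(Rn n, ℂ)) : Prop where
  modulus : IsDiniModulus ω
  kernel : IsCZKernel ω K
  hasKernel : HasKernel T K
  bounded : ∃ q : Fin m → ℝ, (∀ i, 1 < q i) ∧
    ((∃ q₀ : ℝ, 1 < q₀ ∧ ∑ i, 1 / q i = 1 / q₀ ∧ ∃ S, IsBoundedExtension T q (weakNorm q₀) S) ∨
      (∑ i, 1 / q i = 1 ∧ ∃ S, IsBoundedExtension T q (fun g => eLpNorm g 1 volume) S))

/-! ### The splitting of `T(f₁,…,f_m)` along a ball -/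

/-- For `B = B(z,r)` and a set `S` of "far" indices: `f_i χ_{(2B)ᶜ}` if `i ∈ S` and `f_i χ_{2B}` if
`i ∉ S`. -/
noncomputable def piece {n m : ℕ} (f : Fin m → Rn n → ℂ) (z : Rn n) (r : ℝ) (S : Finset (Fin m))
    (i : Fin m) : Rn n → ℂ :=
  if i ∈ S then (Metric.ball z (2 * r))ᶜ.indicator (f i)
  else (Metric.ball z (2 * r)).indicator (f i)

/-- The tensor product `(y_1,…,y_m) ↦ ∏ f_i^{α_i}(y_i)` of the pieces; `S` is the set of those `i`
with `α_i = ∞`. -/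
noncomputable def pieceProd {n m : ℕ} (f : Fin m → Rn n → ℂ) (z : Rn n) (r : ℝ)
    (S : Finset (Fin m)) (y : Fin m → Rn n) : ℂ :=
  ∏ i, piece f z r S i (y i)

open Classical in
/-- The element of `L^q` given by `f` (and `0` if `f` is not in `L^q`). -/
noncomputable def classLp {n : ℕ} (q : ℝ) (f : Rn n → ℂ) :
    Lp ℂ (ENNReal.ofReal q) (volume : Measure (Rn n)) :=
  if h : MemLp f (ENNReal.ofReal q) volume then h.toLp f else 0

/-- `T(f)(x)` for `x ∈ B = B(z,r)`, split along `B`: the bounded extension `S` of `T` acts on the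
local parts `f_i χ_{2B}`, and all the other terms (those with at least one far index) are given by
the kernel. -/
noncomputable def splitValue {n m : ℕ} (K : Rn n → (Fin m → Rn n) → ℂ) (q : Fin m → ℝ)
    (S : MultilinearMap ℂ
      (fun i : Fin m => Lp ℂ (ENNReal.ofReal (q i)) (volume : Measure (Rn n)))
      (Rn n →ₘ[volume] ℂ))
    (f : Fin m → Rn n → ℂ) (z : Rn n) (r : ℝ) (x : Rn n) : ℂ :=
  S (fun i => classLp (q i) (piece f z r ∅ i)) x +
    ∑ J : Finset (Fin m) with J.Nonempty, ∫ y : Fin m → Rn n, K x y * pieceProd f z r J y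

/-- `g` is (a representative of) `T(f)`: on every ball it agrees almost everywhere with the
expression for `T(f)` obtained by splitting along that ball. -/
def IsValue {n m : ℕ} (K : Rn n → (Fin m → Rn n) → ℂ) (q : Fin m → ℝ)
    (S : MultilinearMap ℂ
      (fun i : Fin m => Lp ℂ (ENNReal.ofReal (q i)) (volume : Measure (Rn n)))
      (Rn n →ₘ[volume] ℂ))
    (f : Fin m → Rn n → ℂ) (g : Rn n → ℂ) : Prop :=
  ∀ z r, 0 < r → ∀ᵐ x ∂volume, x ∈ Metric.ball z r → g x = splitValue K q S f z r x

/-!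
The extension of `T` to `L^{p_1} × ⋯ × L^{p_m} → L^p` is obtained from the single weak bound in the
definition of a Calderón-Zygmund operator, and the Morrey estimate from that extension together with
the decay of the kernel.

**The kernel off the support.** Both kinds of given bound yield an `IsWeakExtension`. Testing
`T(f)` against `C_c^∞` functions and approximating shows that on every open set on which one of the
functions vanishes, `T(f)` is the integral against the kernel (`IsWeakExtension.ae_eq_integral`);
the approximation passes to the limit because weakly bounded operators are continuous in measure.

**The endpoint.** Vitali stopping balls give a Calderón-Zygmund decomposition with finitely many bad
parts of mean zero (`exists_calderonZygmund_decomposition`). The all-good term is controlled by the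
given bound. In every other term one bad factor is enough: subtracting the kernel at the centre of
its ball gains `ω`, whose Dini integral is the sum over dyadic shells. This is the weak bound
`L¹ × ⋯ × L¹ → L^{1/m,∞}` (`IsWeakExtension.exists_endpoint`).

**All exponents.** The endpoint bound for the local parts and the Dini bound for the oscillation of
the far parts give a good-`λ` inequality between `T(f)` and the maximal functions of the `f_i`
(`IsWeakExtension.exists_good_lambda`). Integrated over all levels it gives the strong bound
on bounded functions with bounded support (`IsWeakExtension.exists_eLpNorm_le`). Truncation and
Fatou's lemma carry it to Schwartz functions, and density to `L^{p_1} × ⋯ × L^{p_m}`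
(`exists_multilinear_extension`). The extension is unique (`IsBoundedExtension.unique`) since it is
determined by `T` on Schwartz functions and is continuous in measure.

**Morrey spaces.** Over the dyadic shells around `(2B)^m`, Hölder's inequality bounds the kernel
integral by `∑ φ(z, 2^k r)^{1/p} ∏ ‖f_i‖`, hence by `∫ φ^{1/p} dt/t`
(`KernelBounds.exists_lintegral_far_le_morreyNorm`). The tail condition on `φ` implies power decay
of `φ` along dyadic radii (`HasTailBound.exists_decay`), so this integral is at most
`C φ(z, r)^{1/p}`, which together with the `L^p` bound for the local part is the Morrey estimate.
Independence of the ball follows by comparing both balls with a larger one: the functions cut off to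
the larger ball may be split along the smaller one, where the kernel representation applies
(`IsWeakExtension.splitValue_ae_eq_of_subset`).
-/



/-! ### Integrals over products, balls and dyadic shells -/

theorem lintegral_pi_prod {n m : ℕ} {μ : Fin m → Measure (Rn n)} [∀ i, SigmaFinite (μ i)]
    {h : Fin m → Rn n → ℝ≥0∞} (hh : ∀ i, AEMeasurable (h i) (μ i)) :
    ∫⁻ y : Fin m → Rn n, ∏ i, h i (y i) ∂(Measure.pi μ) = ∏ i, ∫⁻ y, h i y ∂(μ i) := by
  induction m with
  | zero => simp
  | succ m ih =>
    rw [← ((measurePreserving_piFinSuccAbove μ 0).symm).lintegral_comp_emb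
      (MeasurableEquiv.measurableEmbedding _)]
    simp_rw [MeasurableEquiv.piFinSuccAbove_symm_apply, Fin.insertNthEquiv,
      Fin.prod_univ_succ, Fin.insertNth_zero, Equiv.coe_fn_mk, Fin.cons_succ,
      Fin.zero_succAbove, Fin.cons_zero]
    have := ih (μ := fun i => μ i.succ) (h := fun i => h i.succ) (fun i => hh i.succ)
    rw [← this]
    refine lintegral_prod_mul (μ := μ 0) (ν := Measure.pi fun i => μ i.succ) (f := h 0)
      (g := fun y => ∏ i : Fin m, h i.succ (y i)) (hh 0) ?_
    exact Finset.aemeasurable_fun_prod _ fun i _ =>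
      (hh i.succ).comp_quasiMeasurePreserving (Measure.quasiMeasurePreserving_eval _ i)

theorem setLIntegral_pi_prod {n m : ℕ} {h : Fin m → Rn n → ℝ≥0∞}
    (hh : ∀ i, AEMeasurable (h i)) (s : Fin m → Set (Rn n)) :
    ∫⁻ y in Set.univ.pi s, ∏ i, h i (y i) = ∏ i, ∫⁻ y in s i, h i y := by
  rw [volume_pi, Measure.restrict_pi_pi]
  exact lintegral_pi_prod fun i => (hh i).restrict

/-- Dyadic decomposition of the complement of a ball into shells. -/
theorem lintegral_compl_ball_le_tsum {X : Type*} [PseudoMetricSpace X] [MeasurableSpace X]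
    {μ : Measure X} (z : X) {ρ : ℝ} (hρ : 0 < ρ) (H : X → ℝ≥0∞) :
    ∫⁻ y in (Metric.ball z ρ)ᶜ, H y ∂μ ≤
      ∑' k : ℕ, ∫⁻ y in Metric.ball z (2 ^ (k + 1) * ρ) \ Metric.ball z (2 ^ k * ρ), H y ∂μ := by
  refine le_trans (lintegral_mono_set ?_) (lintegral_iUnion_le _ _)
  intro y hy
  have hy' : ρ ≤ dist y z := by simpa using hy
  obtain ⟨k, hk1, hk2⟩ := exists_nat_pow_near (x := dist y z / ρ) (y := 2)
    (by rwa [le_div_iff₀ hρ, one_mul]) (by norm_num)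
  rw [le_div_iff₀ hρ] at hk1
  rw [div_lt_iff₀ hρ] at hk2
  exact mem_iUnion.2 ⟨k, by simpa using hk2, by simpa using hk1⟩

/-- A weighted integral of a tensor product away from the diagonal is at most a sum over dyadic
shells of products of integrals over balls. -/
theorem lintegral_compl_ball_prod_le {n m : ℕ} (z : Rn n) {ρ : ℝ} (hρ : 0 < ρ)
    {h : Fin m → Rn n → ℝ≥0∞} (hh : ∀ i, AEMeasurable (h i))
    (W : (Fin m → Rn n) → ℝ≥0∞) (w : ℕ → ℝ≥0∞) (hw : ∀ k, w k ≠ ∞)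
    (hW : ∀ k y, 2 ^ k * ρ ≤ dist y (fun _ => z) → dist y (fun _ => z) < 2 ^ (k + 1) * ρ →
      W y ≤ w k) :
    ∫⁻ y in (Metric.ball (fun _ : Fin m => z) ρ)ᶜ, W y * ∏ i, h i (y i) ≤
      ∑' k : ℕ, w k * ∏ i, ∫⁻ y in Metric.ball z (2 ^ (k + 1) * ρ), h i y := by
  refine (lintegral_compl_ball_le_tsum _ hρ _).trans (ENNReal.tsum_le_tsum fun k => ?_)
  have hpos : (0 : ℝ) < 2 ^ (k + 1) * ρ := by positivity
  calc ∫⁻ y in Metric.ball (fun _ : Fin m => z) (2 ^ (k + 1) * ρ) \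
          Metric.ball (fun _ : Fin m => z) (2 ^ k * ρ), W y * ∏ i, h i (y i)
      ≤ ∫⁻ y in Metric.ball (fun _ : Fin m => z) (2 ^ (k + 1) * ρ) \
          Metric.ball (fun _ : Fin m => z) (2 ^ k * ρ), w k * ∏ i, h i (y i) := by
        refine setLIntegral_mono' (Metric.isOpen_ball.measurableSet.diff
          Metric.isOpen_ball.measurableSet) fun y hy => ?_
        gcongr
        exact hW k y (by simpa using hy.2) (by simpa using hy.1)
    _ ≤ ∫⁻ y in Metric.ball (fun _ : Fin m => z) (2 ^ (k + 1) * ρ), w k * ∏ i, h i (y i) :=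
        lintegral_mono_set sdiff_subset
    _ = w k * ∏ i, ∫⁻ y in Metric.ball z (2 ^ (k + 1) * ρ), h i y := by
        rw [lintegral_const_mul' _ _ (hw k), ball_pi _ hpos, setLIntegral_pi_prod hh]

/-- The volume of the unit ball of `ℝⁿ`. -/
noncomputable def unitVol (n : ℕ) : ℝ := (volume (Metric.ball (0 : Rn n) 1)).toReal

theorem unitVol_pos (n : ℕ) : 0 < unitVol n :=
  ENNReal.toReal_pos (Metric.measure_ball_pos _ _ one_pos).ne' measure_ball_lt_top.ne

theorem volume_closedBall {n : ℕ} (x : Rn n) {r : ℝ} (hr : 0 ≤ r) :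
    volume (Metric.closedBall x r) = ENNReal.ofReal (unitVol n * r ^ n) := by
  rw [Measure.addHaar_closedBall _ _ hr, finrank_euclideanSpace_fin, mul_comm,
    ENNReal.ofReal_mul (unitVol_pos n).le, unitVol, ENNReal.ofReal_toReal measure_ball_lt_top.ne]

theorem volume_ball {n : ℕ} (x : Rn n) {r : ℝ} (hr : 0 < r) :
    volume (Metric.ball x r) = ENNReal.ofReal (unitVol n * r ^ n) := by
  rw [Measure.addHaar_ball_of_pos _ _ hr, finrank_euclideanSpace_fin, mul_comm,
    ENNReal.ofReal_mul (unitVol_pos n).le, unitVol, ENNReal.ofReal_toReal measure_ball_lt_top.ne]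

/-! ### Stopping balls and the maximal function -/

/-- The set where the centred Hardy-Littlewood maximal function of `f` exceeds `a`. -/
def highAvg {n : ℕ} (f : Rn n → ℝ≥0∞) (a : ℝ) : Set (Rn n) :=
  {x | ∃ r, 0 < r ∧
    ENNReal.ofReal a * volume (Metric.closedBall x r) < ∫⁻ y in Metric.closedBall x r, f y}

theorem setLIntegral_closedBall_le_of_notMem_highAvg {n : ℕ} {f : Rn n → ℝ≥0∞} {a : ℝ} {x : Rn n}
    (hx : x ∉ highAvg f a) {r : ℝ} (hr : 0 < r) :
    ∫⁻ y in Metric.closedBall x r, f y ≤ ENNReal.ofReal a * volume (Metric.closedBall x r) := by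
  by_contra! h
  exact hx ⟨r, hr, h⟩

/-- Vitali's covering lemma applied to balls whose radius is nearly the largest one for which the
mean of `f` exceeds `a`. -/
theorem exists_stopping_balls {n : ℕ} (hn : 1 ≤ n) {f : Rn n → ℝ≥0∞} (hfin : ∫⁻ y, f y ≠ ∞)
    {a : ℝ} (ha : 0 < a) :
    ∃ (u : Set (Rn n)) (r : Rn n → ℝ), u.Countable ∧ (∀ x ∈ u, 0 < r x) ∧
      (∀ x ∈ u, ENNReal.ofReal a * volume (Metric.closedBall x (r x)) ≤
        ∫⁻ y in Metric.closedBall x (r x), f y) ∧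
      (∀ x ∈ u, ∀ ρ, 2 * r x ≤ ρ → ∫⁻ y in Metric.closedBall x ρ, f y ≤
        ENNReal.ofReal a * volume (Metric.closedBall x ρ)) ∧
      u.PairwiseDisjoint (fun x => Metric.closedBall x (r x)) ∧
      highAvg f a ⊆ ⋃ x ∈ u, Metric.closedBall x (5 * r x) := by
  have hv := unitVol_pos n
  let rad : Rn n → Set ℝ := fun x => {r | 0 < r ∧
    ENNReal.ofReal a * volume (Metric.closedBall x r) < ∫⁻ y in Metric.closedBall x r, f y}
  -- `R` bounds the radii of balls with mean above `a`: the volume of such a ball is at most `‖f‖₁ / a`,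
  -- and `r ≤ r ^ n` for `r ≥ 1` as `n ≥ 1`.
  set R : ℝ := max 1 ((∫⁻ y, f y).toReal / (a * unitVol n)) with hR
  have hbd : ∀ x, ∀ r ∈ rad x, r ≤ R := by
    rintro x r ⟨hr, hlt⟩
    by_contra! hRr
    have h1 : (1 : ℝ) < r := lt_of_le_of_lt (le_max_left _ _) hRr
    have h2 : (∫⁻ y, f y).toReal / (a * unitVol n) < r := lt_of_le_of_lt (le_max_right _ _) hRr
    rw [div_lt_iff₀ (by positivity)] at h2
    have h3 : r ≤ r ^ n := le_self_pow₀ h1.le (by omega)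
    have h4 : (∫⁻ y, f y) ≤ ENNReal.ofReal (a * (unitVol n * r ^ n)) := by
      rw [← ENNReal.ofReal_toReal hfin]
      apply ENNReal.ofReal_le_ofReal
      calc _ ≤ r * (a * unitVol n) := h2.le
        _ ≤ r ^ n * (a * unitVol n) := by gcongr
        _ = _ := by ring
    rw [volume_closedBall _ hr.le, ← ENNReal.ofReal_mul ha.le] at hlt
    exact absurd (hlt.trans_le ((setLIntegral_le_lintegral _ _).trans h4)) (lt_irrefl _)
  -- more than half of the supremum of the admissible radii, so that doubling leaves the set
  have hch : ∀ x : Rn n, ∃ r : ℝ, x ∈ highAvg f a → r ∈ rad x ∧ ∀ ρ ∈ rad x, ρ < 2 * r := by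
    intro x
    by_cases hx : x ∈ highAvg f a
    · have hne : (rad x).Nonempty := hx
      have hBdd : BddAbove (rad x) := ⟨R, fun r hr => hbd x r hr⟩
      obtain ⟨r₀, hr₀⟩ := hne
      have hs : 0 < sSup (rad x) := hr₀.1.trans_le (le_csSup hBdd hr₀)
      obtain ⟨r, hr, hlt⟩ := exists_lt_of_lt_csSup ⟨r₀, hr₀⟩ (half_lt_self hs)
      exact ⟨r, fun _ => ⟨hr, fun ρ hρ => by have := le_csSup hBdd hρ; linarith⟩⟩
    · exact ⟨0, fun h => absurd h hx⟩
  choose r hr using hch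
  obtain ⟨u, hu, hdisj, hcov⟩ := Vitali.exists_disjoint_subfamily_covering_enlargement_closedBall
    (highAvg f a) id r R (fun x hx => hbd x _ (hr x hx).1) 5 (by norm_num)
  refine ⟨u, r, ?_, fun x hx => (hr x (hu hx)).1.1, fun x hx => (hr x (hu hx)).1.2.le, ?_, hdisj, ?_⟩
  · refine Set.PairwiseDisjoint.countable_of_nonempty_interior hdisj fun x hx => ?_
    refine ⟨x, Metric.ball_subset_interior_closedBall ?_⟩
    simpa using (hr x (hu hx)).1.1
  · intro x hx ρ hρ
    by_contra! h
    have h0 := (hr x (hu hx)).1.1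
    exact absurd ((hr x (hu hx)).2 ρ ⟨by linarith, h⟩) (not_lt.2 hρ)
  · intro x hx
    obtain ⟨b, hb, hsub⟩ := hcov x hx
    exact mem_iUnion₂.2 ⟨b, hb, hsub (Metric.mem_closedBall_self (hr x hx).1.1.le)⟩

/-- Disjoint balls over which the mean of `f` is at least `a` have total volume at most `‖f‖₁ / a`. -/
theorem tsum_volume_le_of_disjoint {n : ℕ} {f : Rn n → ℝ≥0∞} {a : ℝ} {u : Set (Rn n)}
    {r : Rn n → ℝ} (hu : u.Countable)
    (hlow : ∀ x ∈ u, ENNReal.ofReal a * volume (Metric.closedBall x (r x)) ≤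
      ∫⁻ y in Metric.closedBall x (r x), f y)
    (hdisj : u.PairwiseDisjoint (fun x => Metric.closedBall x (r x))) :
    ENNReal.ofReal a * ∑' x : u, volume (Metric.closedBall (x : Rn n) (r x)) ≤ ∫⁻ y, f y := by
  have := hu.to_subtype
  rw [← ENNReal.tsum_mul_left]
  calc _ ≤ ∑' x : u, ∫⁻ y in Metric.closedBall (x : Rn n) (r x), f y :=
        ENNReal.tsum_le_tsum fun x => hlow x x.2
    _ = ∫⁻ y in ⋃ x : u, Metric.closedBall (x : Rn n) (r x), f y := by
        rw [lintegral_iUnion (fun x => Metric.isClosed_closedBall.measurableSet)]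
        exact fun x y hxy => hdisj x.2 y.2 (fun h => hxy (Subtype.ext h))
    _ ≤ _ := setLIntegral_le_lintegral _ _

theorem tsum_volume_enlarged {n : ℕ} {u : Set (Rn n)} {r : Rn n → ℝ} (hr : ∀ x ∈ u, 0 < r x)
    {t : ℝ} (ht : 0 ≤ t) :
    ∑' x : u, volume (Metric.closedBall (x : Rn n) (t * r x)) =
      ENNReal.ofReal (t ^ n) * ∑' x : u, volume (Metric.closedBall (x : Rn n) (r x)) := by
  rw [← ENNReal.tsum_mul_left]
  congr 1 with x
  have := hr x x.2
  rw [volume_closedBall _ (by positivity), volume_closedBall _ this.le,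
    ← ENNReal.ofReal_mul (by positivity)]
  congr 1
  ring

/-- The weak type `(1,1)` bound for the maximal function. -/
theorem volume_highAvg_le {n : ℕ} (hn : 1 ≤ n) {f : Rn n → ℝ≥0∞} {a : ℝ} (ha : 0 < a) :
    ENNReal.ofReal a * volume (highAvg f a) ≤ ENNReal.ofReal (5 ^ n) * ∫⁻ y, f y := by
  by_cases hfin : ∫⁻ y, f y = ∞
  · rw [hfin, ENNReal.mul_top (by simp)]; exact le_top
  obtain ⟨u, r, hu, hr, hlow, -, hdisj, hcov⟩ := exists_stopping_balls hn hfin ha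
  have := hu.to_subtype
  calc ENNReal.ofReal a * volume (highAvg f a)
      ≤ ENNReal.ofReal a * ∑' x : u, volume (Metric.closedBall (x : Rn n) (5 * r x)) := by
        gcongr
        refine (measure_mono hcov).trans ?_
        rw [biUnion_eq_iUnion]
        exact measure_iUnion_le _
    _ = ENNReal.ofReal (5 ^ n) *
          (ENNReal.ofReal a * ∑' x : u, volume (Metric.closedBall (x : Rn n) (r x))) := by
        rw [tsum_volume_enlarged hr (by norm_num)]; ring
    _ ≤ _ := by gcongr; exact tsum_volume_le_of_disjoint hu hlow hdisj

/-- Lebesgue differentiation: `f ≤ a` almost everywhere where the maximal function is at most `a`. -/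
theorem ae_le_of_notMem_highAvg {n : ℕ} {f : Rn n → ℝ≥0∞} (hf : AEMeasurable f)
    (hfin : ∫⁻ y, f y ≠ ∞) (a : ℝ) :
    ∀ᵐ x, x ∉ highAvg f a → f x ≤ ENNReal.ofReal a := by
  filter_upwards [VitaliFamily.ae_tendsto_lintegral_div
    (IsUnifLocDoublingMeasure.vitaliFamily (volume : Measure (Rn n)) 1) hf hfin] with x hx hxa
  have hlim : Tendsto (fun k : ℕ => ((k : ℝ) + 1)⁻¹) atTop (𝓝[>] 0) := by
    refine tendsto_nhdsWithin_iff.2 ⟨?_, Eventually.of_forall fun k => ?_⟩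
    · simpa using tendsto_one_div_add_atTop_nhds_zero_nat (𝕜 := ℝ)
    · simp only [mem_Ioi]; positivity
  have h1 := hx.comp (IsUnifLocDoublingMeasure.tendsto_closedBall_filterAt
    (volume : Measure (Rn n)) (K := 1) (fun _ => x) _ hlim
    (Eventually.of_forall fun k => Metric.mem_closedBall_self (by positivity)))
  refine le_of_tendsto h1 (Eventually.of_forall fun k => ?_)
  refine ENNReal.div_le_of_le_mul ?_
  exact setLIntegral_closedBall_le_of_notMem_highAvg hxa (by positivity)


theorem highAvg_congr {n : ℕ} {f g : Rn n → ℝ≥0∞} (h : f =ᵐ[volume] g) (a : ℝ) :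
    highAvg f a = highAvg g a := by
  ext x
  simp only [highAvg, mem_ofPred_eq]
  refine exists_congr fun r => and_congr_right fun _ => ?_
  rw [lintegral_congr_ae (ae_restrict_of_ae h)]

/-- In the weak type bound only the part of `f` above `a / 2` counts: the rest contributes at most
`a / 2` to every mean. -/
theorem volume_highAvg_le_truncated {n : ℕ} (hn : 1 ≤ n) {f : Rn n → ℝ≥0∞} (hf : Measurable f)
    {a : ℝ} (ha : 0 < a) :
    volume (highAvg f a) ≤ ENNReal.ofReal (2 * 5 ^ n * a⁻¹) *
      ∫⁻ y, {y | ENNReal.ofReal (a / 2) < f y}.indicator f y := by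
  set f₁ := {y | ENNReal.ofReal (a / 2) < f y}.indicator f
  have hms : MeasurableSet {y | ENNReal.ofReal (a / 2) < f y} := measurableSet_lt measurable_const hf
  have hsub : highAvg f a ⊆ highAvg f₁ (a / 2) := by
    rintro x ⟨r, hr, hlt⟩
    refine ⟨r, hr, ?_⟩
    by_contra! hle
    refine absurd hlt (not_lt.2 ?_)
    calc ∫⁻ y in Metric.closedBall x r, f y
        ≤ ∫⁻ y in Metric.closedBall x r, (f₁ y + ENNReal.ofReal (a / 2)) := by
          refine lintegral_mono fun y => ?_
          by_cases hy : ENNReal.ofReal (a / 2) < f y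
          · simp [f₁, hy]
          · simpa [f₁, hy] using not_lt.1 hy
      _ = (∫⁻ y in Metric.closedBall x r, f₁ y) +
            ENNReal.ofReal (a / 2) * volume (Metric.closedBall x r) := by
          rw [lintegral_add_right _ measurable_const, setLIntegral_const]
      _ ≤ ENNReal.ofReal (a / 2) * volume (Metric.closedBall x r) +
            ENNReal.ofReal (a / 2) * volume (Metric.closedBall x r) := by gcongr
      _ = _ := by
          rw [← add_mul, ← ENNReal.ofReal_add (by positivity) (by positivity)]; congr; ring
  have h2 := volume_highAvg_le hn (f := f₁) (half_pos ha)
  calc volume (highAvg f a) ≤ volume (highAvg f₁ (a / 2)) := measure_mono hsub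
    _ = ENNReal.ofReal (2 * a⁻¹) * (ENNReal.ofReal (a / 2) * volume (highAvg f₁ (a / 2))) := by
        rw [← mul_assoc, ← ENNReal.ofReal_mul (by positivity)]
        have : 2 * a⁻¹ * (a / 2) = 1 := by field_simp
        simp [this]
    _ ≤ ENNReal.ofReal (2 * a⁻¹) * (ENNReal.ofReal (5 ^ n) * ∫⁻ y, f₁ y) := by gcongr
    _ = _ := by
        rw [← mul_assoc, ← ENNReal.ofReal_mul (by positivity)]; congr 2; ring

theorem lintegral_Ioo_rpow {s : ℝ} (hs : 0 < s) {L : ℝ} (hL : 0 ≤ L) :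
    ∫⁻ t in Ioo 0 L, ENNReal.ofReal (t ^ (s - 1)) = ENNReal.ofReal (L ^ s / s) := by
  have hint : IntegrableOn (fun t : ℝ => t ^ (s - 1)) (Ioc 0 L) :=
    (intervalIntegrable_iff_integrableOn_Ioc_of_le hL).1
      (intervalIntegral.intervalIntegrable_rpow' (by linarith))
  rw [setLIntegral_congr Ioo_ae_eq_Ioc, ← ofReal_integral_eq_lintegral_ofReal hint,
    ← intervalIntegral.integral_of_le hL, integral_rpow (Or.inl (by linarith))]
  · congr 1
    simp [Real.zero_rpow hs.ne']
  · filter_upwards [ae_restrict_mem measurableSet_Ioc] with t ht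
    have := ht.1
    positivity

/-- The strong type bound for the maximal function, in distributional form and with the levels
`(γ t)^(p/q)`. -/
theorem lintegral_volume_highAvg_le {n : ℕ} (hn : 1 ≤ n) {p q γ : ℝ} (hp : 0 < p) (hq : 1 < q)
    (hγ : 0 < γ) :
    ∃ C : ℝ≥0, ∀ f : Rn n → ℝ≥0∞, AEMeasurable f →
      ∫⁻ t in Ioi (0 : ℝ), ENNReal.ofReal (t ^ (p - 1)) * volume (highAvg f ((γ * t) ^ (p / q))) ≤
        C * ∫⁻ x, f x ^ q := by
  have hq0 : 0 < q := by linarith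
  have hs : 0 < p - p / q := by
    rw [sub_pos]; exact div_lt_self hp hq
  set s := p - p / q with hsdef
  set c : ℝ := 2 * 5 ^ n * (γ ^ (-p) * 2 ^ (q - 1) / s) with hc
  have hcpos : 0 < c := by positivity
  refine ⟨c.toNNReal, fun f hf => ?_⟩
  wlog hfm : Measurable f generalizing f
  · have := this hf.mk hf.measurable_mk.aemeasurable hf.measurable_mk
    calc _ = ∫⁻ t in Ioi (0 : ℝ), ENNReal.ofReal (t ^ (p - 1)) *
          volume (highAvg (hf.mk f) ((γ * t) ^ (p / q))) := by
          simp_rw [highAvg_congr hf.ae_eq_mk]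
      _ ≤ _ := this
      _ = _ := by
          congr 1
          refine lintegral_congr_ae ?_
          filter_upwards [hf.ae_eq_mk] with x hx
          rw [hx]
  -- the truncated weak type bound, as an integrand to which Fubini applies
  let F : ℝ → Rn n → ℝ≥0∞ := fun t y =>
    ENNReal.ofReal (t ^ (p - 1)) * (ENNReal.ofReal (2 * 5 ^ n * ((γ * t) ^ (p / q))⁻¹) *
      {y | ENNReal.ofReal ((γ * t) ^ (p / q) / 2) < f y}.indicator f y)
  have hFm : Measurable (Function.uncurry F) := by
    have h1 : MeasurableSet {a : ℝ × Rn n | ENNReal.ofReal ((γ * a.1) ^ (p / q) / 2) < f a.2} :=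
      measurableSet_lt (by fun_prop) (by fun_prop)
    have h2 := (hfm.comp (measurable_snd (α := ℝ))).indicator h1
    have h3 : Measurable fun a : ℝ × Rn n => ENNReal.ofReal (a.1 ^ (p - 1)) := by fun_prop
    have h4 : Measurable fun a : ℝ × Rn n =>
      ENNReal.ofReal (2 * 5 ^ n * ((γ * a.1) ^ (p / q))⁻¹) := by fun_prop
    exact h3.mul (h4.mul h2)
  calc ∫⁻ t in Ioi (0 : ℝ), ENNReal.ofReal (t ^ (p - 1)) * volume (highAvg f ((γ * t) ^ (p / q)))
      ≤ ∫⁻ t in Ioi (0 : ℝ), ∫⁻ y, F t y := by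
        refine setLIntegral_mono' measurableSet_Ioi fun t ht => ?_
        have ht : 0 < t := ht
        have hpos : 0 < (γ * t) ^ (p / q) := by positivity
        have := volume_highAvg_le_truncated hn hfm hpos
        simp only [F]
        rw [lintegral_const_mul' _ _ ENNReal.ofReal_ne_top,
          lintegral_const_mul' _ _ ENNReal.ofReal_ne_top]
        gcongr
    _ = ∫⁻ y, ∫⁻ t in Ioi (0 : ℝ), F t y := lintegral_lintegral_swap hFm.aemeasurable
    _ ≤ ∫⁻ y, ENNReal.ofReal c * f y ^ q := by
        refine lintegral_mono fun y => ?_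
        by_cases hy : f y = ∞
        · simp [hy, ENNReal.top_rpow_of_pos hq0, ENNReal.mul_top, hcpos]
        lift f y to ℝ≥0 using hy with v hv
        -- `L` is the value of `t` at which the level `(γ t)^(p/q)` reaches `2 * f y`; larger `t` do not count.
        set L : ℝ := (2 * v) ^ (q / p) / γ with hL
        have hL0 : 0 ≤ L := by positivity
        have key : ∀ t ∈ Ioi (0 : ℝ), F t y ≤ (Ioo 0 L).indicator (fun t =>
            ENNReal.ofReal (2 * 5 ^ n * γ ^ (-(p / q)) * v) * ENNReal.ofReal (t ^ (s - 1))) t := by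
          intro t ht
          have ht : 0 < t := ht
          by_cases hlt : ENNReal.ofReal ((γ * t) ^ (p / q) / 2) < f y
          · have hlt' := hlt
            rw [← hv, ← ENNReal.ofReal_coe_nnreal, ENNReal.ofReal_lt_ofReal_iff_of_nonneg
              (by positivity)] at hlt'
            have htL : t ∈ Ioo 0 L := by
              refine ⟨ht, ?_⟩
              rw [hL, lt_div_iff₀ hγ]
              have : (γ * t) ^ (p / q) < 2 * v := by linarith
              have h5 := Real.rpow_lt_rpow (by positivity) this (show 0 < q / p by positivity)
              rw [← Real.rpow_mul (by positivity)] at h5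
              have : p / q * (q / p) = 1 := by field_simp
              rw [this, Real.rpow_one] at h5
              linarith
            rw [indicator_of_mem htL]
            simp only [F]
            rw [indicator_of_mem (show y ∈ {y | _ < f y} from hlt), ← hv,
              ← ENNReal.ofReal_coe_nnreal, ← ENNReal.ofReal_mul (by positivity),
              ← ENNReal.ofReal_mul (by positivity), ← ENNReal.ofReal_mul (by positivity)]
            refine le_of_eq (congrArg _ ?_)
            have e1 : t ^ (s - 1) = t ^ (p - 1) * t ^ (-(p / q)) := by
              rw [← Real.rpow_add ht, hsdef]; congr 1; ring
            rw [e1, Real.mul_rpow hγ.le ht.le, Real.rpow_neg hγ.le, Real.rpow_neg ht.le, mul_inv]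
            ring
          · simp only [F]
            rw [indicator_of_notMem (show y ∉ {y | _ < f y} from hlt)]
            simp
        calc ∫⁻ t in Ioi (0 : ℝ), F t y ≤ _ := setLIntegral_mono' measurableSet_Ioi key
          _ ≤ ∫⁻ t, (Ioo 0 L).indicator (fun t =>
              ENNReal.ofReal (2 * 5 ^ n * γ ^ (-(p / q)) * v) * ENNReal.ofReal (t ^ (s - 1))) t :=
            setLIntegral_le_lintegral _ _
          _ = ENNReal.ofReal (2 * 5 ^ n * γ ^ (-(p / q)) * v) * ENNReal.ofReal (L ^ s / s) := by
            rw [lintegral_indicator measurableSet_Ioo,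
              lintegral_const_mul' _ _ ENNReal.ofReal_ne_top, lintegral_Ioo_rpow hs hL0]
          _ = _ := by
            rw [← ENNReal.ofReal_coe_nnreal, ENNReal.ofReal_rpow_of_nonneg v.coe_nonneg hq0.le,
              ← ENNReal.ofReal_mul (by positivity), ← ENNReal.ofReal_mul (by positivity)]
            congr 1
            have hv0 : (0 : ℝ) ≤ v := v.coe_nonneg
            have e2 : L ^ s = 2 ^ (q - 1) * (v : ℝ) ^ (q - 1) * γ ^ (-s) := by
              rw [hL, Real.div_rpow (by positivity) hγ.le, ← Real.rpow_mul (by positivity),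
                Real.rpow_neg hγ.le, div_eq_mul_inv, ← Real.mul_rpow (by norm_num) hv0]
              congr 2
              rw [hsdef]; field_simp
            have e3 : (v : ℝ) ^ q = v * (v : ℝ) ^ (q - 1) := by
              rcases eq_or_lt_of_le hv0 with h | h
              · rw [← h, Real.zero_rpow hq0.ne']; simp
              · rw [← Real.rpow_one_add' hv0 (by linarith)]; congr 1; ring
            have e4 : γ ^ (-p) = γ ^ (-(p / q)) * γ ^ (-s) := by
              rw [← Real.rpow_add hγ, hsdef]; congr 1; ring
            rw [hc, e2, e3, e4]
            ring
    _ = _ := by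
        rw [lintegral_const_mul' _ _ ENNReal.ofReal_ne_top]; rfl

/-- Integration of a good-`λ` inequality. The truncated integrals have to be finite a priori. -/
theorem lintegral_le_of_good_lambda {p : ℝ} {D H : ℝ → ℝ≥0∞} (hD : Antitone D)
    (hfin : ∀ N : ℝ, 0 < N → ∫⁻ t in Ioo 0 N, ENNReal.ofReal (t ^ (p - 1)) * D t ≠ ∞)
    (hgood : ∀ t, 0 < t → D (2 * t) ≤ H t + ENNReal.ofReal (2 ^ (-p) / 2) * D t) :
    ∫⁻ t in Ioi (0 : ℝ), ENNReal.ofReal (t ^ (p - 1)) * D t ≤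
      ENNReal.ofReal (2 * 2 ^ p) * ∫⁻ t in Ioi (0 : ℝ), ENNReal.ofReal (t ^ (p - 1)) * H t := by
  set X := ∫⁻ t in Ioi (0 : ℝ), ENNReal.ofReal (t ^ (p - 1)) * H t
  have hDm : Measurable D := hD.measurable
  have hm : Measurable fun t => ENNReal.ofReal (t ^ (p - 1)) * D t := by fun_prop
  have hstep : ∀ N : ℝ, 0 < N → ∫⁻ t in Ioo 0 (2 * N), ENNReal.ofReal (t ^ (p - 1)) * D t ≤
      ENNReal.ofReal (2 * 2 ^ p) * X := by
    intro N hN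
    set Φ := ∫⁻ t in Ioo 0 (2 * N), ENNReal.ofReal (t ^ (p - 1)) * D t with hΦ
    -- the substitution `t ↦ 2 t` turns the good-`λ` inequality into a bound of `Φ` by itself
    have himg : (fun t : ℝ => 2 * t) '' Ioo 0 N = Ioo 0 (2 * N) := by
      rw [image_mul_left_Ioo (by norm_num)]; simp
    have h1 : Φ = ENNReal.ofReal (2 ^ p) *
        ∫⁻ t in Ioo 0 N, ENNReal.ofReal (t ^ (p - 1)) * D (2 * t) := by
      rw [hΦ, ← himg, lintegral_image_eq_lintegral_abs_deriv_mul measurableSet_Ioo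
        (f' := fun _ => 2) (fun t _ => by
          simpa using ((hasDerivAt_id t).const_mul 2).hasDerivWithinAt)
        (fun x _ y _ h => by simpa using h), ← lintegral_const_mul' _ _ ENNReal.ofReal_ne_top]
      refine setLIntegral_congr_fun measurableSet_Ioo fun t ht => ?_
      have ht0 := ht.1
      rw [← mul_assoc, ← mul_assoc, ← ENNReal.ofReal_mul (by positivity),
        ← ENNReal.ofReal_mul (by positivity)]
      congr 2
      rw [Real.mul_rpow (by norm_num) ht0.le, Real.rpow_sub_one (by norm_num)]
      norm_num
      ring
    have h2 : ∫⁻ t in Ioo 0 N, ENNReal.ofReal (t ^ (p - 1)) * D (2 * t) ≤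
        X + ENNReal.ofReal (2 ^ (-p) / 2) * Φ := by
      calc _ ≤ ∫⁻ t in Ioo 0 N, (ENNReal.ofReal (t ^ (p - 1)) * H t +
            ENNReal.ofReal (2 ^ (-p) / 2) * (ENNReal.ofReal (t ^ (p - 1)) * D t)) := by
            refine setLIntegral_mono' measurableSet_Ioo fun t ht => ?_
            calc _ ≤ ENNReal.ofReal (t ^ (p - 1)) *
                  (H t + ENNReal.ofReal (2 ^ (-p) / 2) * D t) := by
                  gcongr; exact hgood t ht.1
              _ = _ := by ring
        _ = (∫⁻ t in Ioo 0 N, ENNReal.ofReal (t ^ (p - 1)) * H t) +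
            ENNReal.ofReal (2 ^ (-p) / 2) *
              ∫⁻ t in Ioo 0 N, ENNReal.ofReal (t ^ (p - 1)) * D t := by
            rw [lintegral_add_right _ (hm.const_mul _),
              lintegral_const_mul' _ _ ENNReal.ofReal_ne_top]
        _ ≤ _ := by
            gcongr
            · exact lintegral_mono_set fun t ht => ht.1
            · rw [hΦ]
              exact lintegral_mono_set fun t ht => ⟨ht.1, by linarith [ht.2, ht.1]⟩
    have h3 : Φ ≤ ENNReal.ofReal (2 ^ p) * X + Φ / 2 := by
      calc Φ ≤ ENNReal.ofReal (2 ^ p) * (X + ENNReal.ofReal (2 ^ (-p) / 2) * Φ) := by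
            rw [h1]; gcongr; rw [← h1]; exact h2
        _ = ENNReal.ofReal (2 ^ p) * X + ENNReal.ofReal (1 / 2) * Φ := by
            rw [mul_add, ← mul_assoc (ENNReal.ofReal (2 ^ p)) (ENNReal.ofReal (2 ^ (-p) / 2)),
              ← ENNReal.ofReal_mul (by positivity)]
            congr 3
            rw [Real.rpow_neg (by norm_num)]
            field_simp
        _ = _ := by
            congr 1
            rw [ENNReal.div_eq_inv_mul, one_div, ENNReal.ofReal_inv_of_pos (by norm_num)]
            simp
    -- `Φ / 2` can only be absorbed because `Φ` is finite
    have hΦfin : Φ ≠ ∞ := hfin _ (by positivity)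
    have h4 : Φ / 2 ≤ ENNReal.ofReal (2 ^ p) * X := by
      have h5 : Φ / 2 + Φ / 2 ≤ ENNReal.ofReal (2 ^ p) * X + Φ / 2 := by
        rwa [ENNReal.add_halves]
      exact (ENNReal.add_le_add_iff_right (ENNReal.div_ne_top hΦfin (by norm_num))).1 h5
    calc Φ = 2 * (Φ / 2) := (ENNReal.mul_div_cancel (by norm_num) (by norm_num)).symm
      _ ≤ 2 * (ENNReal.ofReal (2 ^ p) * X) := by gcongr
      _ = _ := by rw [ENNReal.ofReal_mul (by norm_num), ← mul_assoc]; simp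
  have hU : Ioi (0 : ℝ) = ⋃ k : ℕ, Ioo 0 (2 * ((k : ℝ) + 1)) := by
    ext t
    simp only [mem_Ioi, mem_iUnion, mem_Ioo]
    refine ⟨fun h => ?_, fun ⟨_, h, _⟩ => h⟩
    obtain ⟨k, hk⟩ := exists_nat_gt t
    exact ⟨k, h, by linarith⟩
  have hmono : Monotone fun k : ℕ => Ioo (0 : ℝ) (2 * ((k : ℝ) + 1)) := by
    intro k l hkl
    have : (k : ℝ) ≤ l := by exact_mod_cast hkl
    exact Ioo_subset_Ioo_right (by linarith)
  rw [hU, setLIntegral_iUnion_of_directed _ hmono.directed_le]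
  exact iSup_le fun k => hstep _ (by positivity)


/-! ### Dini moduli and kernel estimates -/

/-- The Dini integral of a nondecreasing `ω` dominates the sum of its values at the powers of
`1 / 2`, which is the form in which the condition is used. -/
theorem IsDiniModulus.tsum_ne_top {ω : ℝ → ℝ} (hω : IsDiniModulus ω) :
    ∑' k : ℕ, ENNReal.ofReal (ω ((1 / 2) ^ (k + 1))) ≠ ∞ := by
  have hfin : ∫⁻ t in Ioo (0 : ℝ) 1, ENNReal.ofReal (ω t / t) ≠ ∞ := by
    have := hω.dini.lintegral_lt_top
    exact this.ne
  have hanti : Antitone fun k : ℕ => ((1 : ℝ) / 2) ^ k := fun a b hab =>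
    pow_le_pow_of_le_one (by norm_num) (by norm_num) hab
  have hstep : ∀ k : ℕ, ENNReal.ofReal (ω ((1 / 2) ^ (k + 1))) ≤
      2 * ∫⁻ t in Ioo (((1 : ℝ) / 2) ^ (k + 1)) ((1 / 2) ^ k), ENNReal.ofReal (ω t / t) := by
    intro k
    set b : ℝ := (1 / 2) ^ (k + 1) with hb
    have hb0 : 0 < b := by positivity
    have hk : ((1 : ℝ) / 2) ^ k = 2 * b := by rw [hb]; ring
    have hωb := hω.nonneg b hb0.le
    rw [hk]
    calc ENNReal.ofReal (ω b) = 2 * (ENNReal.ofReal (ω b / (2 * b)) * volume (Ioo b (2 * b))) := by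
          rw [Real.volume_Ioo, ← ENNReal.ofReal_mul (by positivity),
            ← ENNReal.ofReal_ofNat, ← ENNReal.ofReal_mul (by norm_num)]
          congr 1
          field_simp
          ring
      _ = 2 * ∫⁻ t in Ioo b (2 * b), ENNReal.ofReal (ω b / (2 * b)) := by
          rw [setLIntegral_const]
      _ ≤ _ := by
          gcongr 2 * ?_
          refine setLIntegral_mono' measurableSet_Ioo fun t ht => ?_
          apply ENNReal.ofReal_le_ofReal
          have ht0 : 0 < t := hb0.trans ht.1
          have h1 : ω b ≤ ω t := hω.mono hb0.le ht0.le ht.1.le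
          have h2 : t ≤ 2 * b := ht.2.le
          gcongr
          exact hω.nonneg t ht0.le
  refine ne_top_of_le_ne_top (ENNReal.mul_ne_top (by norm_num : (2 : ℝ≥0∞) ≠ ∞) hfin) ?_
  calc _ ≤ ∑' k : ℕ, 2 * ∫⁻ t in Ioo (((1 : ℝ) / 2) ^ (k + 1)) ((1 / 2) ^ k),
        ENNReal.ofReal (ω t / t) := ENNReal.tsum_le_tsum hstep
    _ = 2 * ∫⁻ t in ⋃ k : ℕ, Ioo (((1 : ℝ) / 2) ^ (k + 1)) ((1 / 2) ^ k),
        ENNReal.ofReal (ω t / t) := by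
        rw [ENNReal.tsum_mul_left, lintegral_iUnion (fun _ => measurableSet_Ioo)]
        exact hanti.pairwise_disjoint_on_Ioo_succ
    _ ≤ _ := by
        gcongr
        refine iUnion_subset fun k t ht => ⟨?_, ?_⟩
        · exact lt_trans (by positivity) ht.1
        · exact ht.2.trans_le (pow_le_one₀ (by norm_num) (by norm_num))

/-- The Dini condition forces `ω` to vanish at `0`. -/
theorem IsDiniModulus.tendsto_zero {ω : ℝ → ℝ} (hω : IsDiniModulus ω) :
    Tendsto ω (𝓝[≥] 0) (𝓝 0) := by
  rw [Metric.tendsto_nhdsWithin_nhds]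
  intro ε hε
  have h := ENNReal.tendsto_atTop_zero_of_tsum_ne_top hω.tsum_ne_top
  obtain ⟨k, hk⟩ := (h.eventually_lt_const (show (0 : ℝ≥0∞) < ENNReal.ofReal ε by simpa)).exists
  rw [ENNReal.ofReal_lt_ofReal_iff hε] at hk
  refine ⟨(1 / 2) ^ (k + 1), by positivity, fun t ht htk => ?_⟩
  have ht : 0 ≤ t := ht
  rw [Real.dist_eq, sub_zero, abs_of_nonneg ht] at htk
  rw [Real.dist_eq, sub_zero, abs_of_nonneg (hω.nonneg t ht)]
  exact (hω.mono ht (show (0 : ℝ) ≤ (1 / 2) ^ (k + 1) by positivity) htk.le).trans_lt hk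

theorem IsDiniModulus.mono_of_nonneg {ω : ℝ → ℝ} (hω : IsDiniModulus ω) {s t : ℝ} (hs : 0 ≤ s)
    (hst : s ≤ t) : ω s ≤ ω t :=
  hω.mono (mem_Ici.2 hs) (mem_Ici.2 (hs.trans hst)) hst

/-- The distance of `y` from the diagonal point `(x,…,x)` in the sup metric is `max_j |x - y_j|`. -/
theorem exists_dist_const_eq {n m : ℕ} (hm : 1 ≤ m) (y : Fin m → Rn n) (x : Rn n) :
    ∃ j, dist y (fun _ => x) = ‖x - y j‖ := by
  have : Nonempty (Fin m) := ⟨⟨0, hm⟩⟩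
  obtain ⟨j, hj⟩ := Finite.exists_max fun j => ‖x - y j‖
  refine ⟨j, le_antisymm ((dist_pi_le_iff (norm_nonneg _)).2 fun i => ?_) ?_⟩
  · rw [dist_comm, dist_eq_norm]; exact hj i
  · rw [← dist_eq_norm, dist_comm]; exact dist_le_pi_dist y (fun _ => x) j

theorem dist_const_le_sum {n m : ℕ} (y : Fin m → Rn n) (x : Rn n) :
    dist y (fun _ => x) ≤ ∑ i, ‖x - y i‖ := by
  refine (dist_pi_le_iff (by positivity)).2 fun i => ?_
  rw [dist_comm, dist_eq_norm]
  exact Finset.single_le_sum (f := fun i => ‖x - y i‖) (fun _ _ => norm_nonneg _)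
    (Finset.mem_univ i)

theorem exists_ne_of_dist_const_pos {n m : ℕ} {y : Fin m → Rn n} {x : Rn n}
    (h : 0 < dist y (fun _ => x)) : ∃ i, x ≠ y i := by
  by_contra! hc
  have : y = fun _ => x := funext fun i => (hc i).symm
  simp [this] at h

/-- The kernel is continuous in `(y_1,…,y_m)` away from the diagonal: one variable is moved at a
time, and `ω(t) → 0` as `t → 0`. -/
theorem IsCZKernel.continuousOn {n m : ℕ} (hm : 1 ≤ m) {ω : ℝ → ℝ} (hω : IsDiniModulus ω)
    {K : Rn n → (Fin m → Rn n) → ℂ} (hK : IsCZKernel ω K) (x : Rn n) :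
    ContinuousOn (K x) {fun _ => x}ᶜ := by
  obtain ⟨A, hA, -, -, hy⟩ := hK.bounds
  intro y₀ hy₀
  refine ContinuousAt.continuousWithinAt ?_
  have hd : 0 < dist y₀ (fun _ => x) := dist_pos.2 hy₀
  obtain ⟨j, hj⟩ := exists_dist_const_eq hm y₀ x
  -- The coordinates in `s` have been moved from `y₀` to the new point. The hypothesis on the displacement in
  -- `smooth_y` is checked with the coordinate `j` farthest from `x`.
  have key : ∀ s : Finset (Fin m),
      Tendsto (fun y' : Fin m → Rn n => K x (s.piecewise y' y₀)) (𝓝 y₀) (𝓝 (K x y₀)) := by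
    intro s
    induction s using Finset.induction_on with
    | empty => simp
    | insert i s his ih =>
      have hwc : Continuous fun y' : Fin m → Rn n => s.piecewise y' y₀ := by
        refine continuous_pi fun l => ?_
        by_cases hl : l ∈ s
        · simpa [hl] using continuous_apply l
        · simpa [hl] using continuous_const
      have hw : Tendsto (fun y' : Fin m → Rn n => s.piecewise y' y₀) (𝓝 y₀) (𝓝 y₀) := by
        have h := hwc.tendsto y₀
        have e : s.piecewise y₀ y₀ = y₀ := funext fun l => by by_cases hl : l ∈ s <;> simp [hl]
        rwa [e] at h
      have hσ : Tendsto (fun y' : Fin m → Rn n => ∑ l, ‖x - s.piecewise y' y₀ l‖) (𝓝 y₀)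
          (𝓝 (∑ l, ‖x - y₀ l‖)) := by
        have hc : Continuous fun w : Fin m → Rn n => ∑ l, ‖x - w l‖ := by fun_prop
        exact (hc.tendsto y₀).comp hw
      have hσ0 : 0 < ∑ l, ‖x - y₀ l‖ := hd.trans_le (dist_const_le_sum _ _)
      have hi : Tendsto (fun y' : Fin m → Rn n => ‖y₀ i - y' i‖) (𝓝 y₀) (𝓝 0) := by
        have hc : Continuous fun y' : Fin m → Rn n => ‖y₀ i - y' i‖ := by fun_prop
        simpa using hc.tendsto y₀
      have hdiff : Tendsto (fun y' : Fin m → Rn n =>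
          K x (s.piecewise y' y₀) - K x ((insert i s).piecewise y' y₀)) (𝓝 y₀) (𝓝 0) := by
        have hbd : Tendsto (fun y' : Fin m → Rn n =>
            A / (∑ l, ‖x - s.piecewise y' y₀ l‖) ^ (m * n) *
              ω (‖y₀ i - y' i‖ / ∑ l, ‖x - s.piecewise y' y₀ l‖)) (𝓝 y₀) (𝓝 0) := by
          have h1 : Tendsto (fun y' : Fin m → Rn n =>
              A / (∑ l, ‖x - s.piecewise y' y₀ l‖) ^ (m * n)) (𝓝 y₀)
              (𝓝 (A / (∑ l, ‖x - y₀ l‖) ^ (m * n))) :=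
            tendsto_const_nhds.div (hσ.pow _) (pow_pos hσ0 _).ne'
          have h2 : Tendsto (fun y' : Fin m → Rn n =>
              ‖y₀ i - y' i‖ / ∑ l, ‖x - s.piecewise y' y₀ l‖) (𝓝 y₀) (𝓝[≥] 0) := by
            refine tendsto_nhdsWithin_iff.2 ⟨?_, Eventually.of_forall fun y' => ?_⟩
            · have h3 := hi.div hσ hσ0.ne'
              rwa [zero_div] at h3
            · exact mem_Ici.2 (div_nonneg (norm_nonneg _)
                (Finset.sum_nonneg fun _ _ => norm_nonneg _))
          simpa using h1.mul (hω.tendsto_zero.comp h2)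
        refine squeeze_zero_norm' ?_ hbd
        have hwj : Tendsto (fun y' : Fin m → Rn n => 1 / 2 * ‖x - s.piecewise y' y₀ j‖) (𝓝 y₀)
            (𝓝 (1 / 2 * ‖x - y₀ j‖)) := by
          have hc : Continuous fun w : Fin m → Rn n => 1 / 2 * ‖x - w j‖ := by fun_prop
          exact (hc.tendsto y₀).comp hw
        have hpos : (0 : ℝ) < 1 / 2 * ‖x - y₀ j‖ := by rw [← hj]; exact mul_pos (by norm_num) hd
        filter_upwards [hi.eventually_lt hwj hpos] with y' hy'
        have hwi : s.piecewise y' y₀ i = y₀ i := Finset.piecewise_eq_of_notMem _ _ _ his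
        have := hy x (s.piecewise y' y₀) i (y' i) ⟨j, fun h => by
          rw [← h] at hy'
          simp only [sub_self, norm_zero, mul_zero] at hy'
          exact absurd hy' (not_lt.2 (norm_nonneg _))⟩ ⟨j, by rw [hwi]; exact hy'.le⟩
        rw [Finset.piecewise_insert]
        rwa [hwi] at this
      simpa using ih.sub hdiff
  have := key Finset.univ
  simpa [ContinuousAt] using this

theorem IsCZKernel.aestronglyMeasurable {n m : ℕ} (hn : 1 ≤ n) (hm : 1 ≤ m) {ω : ℝ → ℝ}
    (hω : IsDiniModulus ω) {K : Rn n → (Fin m → Rn n) → ℂ} (hK : IsCZKernel ω K) (x : Rn n) :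
    AEStronglyMeasurable (K x) := by
  have : Nonempty (Fin m) := ⟨⟨0, hm⟩⟩
  have : Nonempty (Fin n) := ⟨⟨0, hn⟩⟩
  have h := (hK.continuousOn hm hω x).aestronglyMeasurable (μ := volume)
    (measurableSet_singleton _).compl
  rwa [Measure.restrict_eq_self_of_ae_mem] at h
  have : Nontrivial (Rn n) := inferInstance
  have : NullSingletonClass (volume : Measure (Rn n)) := inferInstance
  exact measure_eq_zero_iff_ae_notMem.1 (measure_singleton _)

/-- The size and smoothness bounds of a kernel of type `ω`, with an explicit constant `A`. -/
structure KernelBounds {n m : ℕ} (A : ℝ) (ω : ℝ → ℝ) (K : Rn n → (Fin m → Rn n) → ℂ) : Prop where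
  pos : 0 < A
  size : ∀ x y, (∃ i, x ≠ y i) → ‖K x y‖ ≤ A / (∑ i, ‖x - y i‖) ^ (m * n)
  smooth_x : ∀ x x' y, (∃ i, x ≠ y i) → (∃ j, ‖x - x'‖ ≤ 1 / 2 * ‖x - y j‖) →
    ‖K x y - K x' y‖ ≤ A / (∑ i, ‖x - y i‖) ^ (m * n) * ω (‖x - x'‖ / ∑ i, ‖x - y i‖)
  smooth_y : ∀ x y i y', (∃ i, x ≠ y i) → (∃ j, ‖y i - y'‖ ≤ 1 / 2 * ‖x - y j‖) →
    ‖K x y - K x (Function.update y i y')‖ ≤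
      A / (∑ i, ‖x - y i‖) ^ (m * n) * ω (‖y i - y'‖ / ∑ i, ‖x - y i‖)

theorem IsCZKernel.exists_kernelBounds {n m : ℕ} {ω : ℝ → ℝ} {K : Rn n → (Fin m → Rn n) → ℂ}
    (hK : IsCZKernel ω K) : ∃ A, KernelBounds A ω K := by
  obtain ⟨A, hA, h1, h2, h3⟩ := hK.bounds
  exact ⟨A, hA, h1, h2, h3⟩

section Bounds

variable {n m : ℕ} {A : ℝ} {ω : ℝ → ℝ} {K : Rn n → (Fin m → Rn n) → ℂ}

/-- The size bound with `∑ |x - y_i|` replaced by a lower bound for the sup distance of `y` from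
`(x,…,x)`, on which the decomposition into shells is based. -/
theorem KernelBounds.norm_le (hK : KernelBounds A ω K) {x : Rn n} {y : Fin m → Rn n} {d : ℝ}
    (hd : 0 < d) (h : d ≤ dist y (fun _ => x)) : ‖K x y‖ ≤ A / d ^ (m * n) := by
  have hA := hK.pos
  refine (hK.size x y (exists_ne_of_dist_const_pos (hd.trans_le h))).trans ?_
  gcongr
  exact h.trans (dist_const_le_sum _ _)

/-- The smoothness in `x` in terms of a lower bound for the sup distance of `y` from `(x,…,x)`. -/
theorem KernelBounds.norm_sub_le_x (hK : KernelBounds A ω K) (hω : IsDiniModulus ω) (hm : 1 ≤ m)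
    {x x' : Rn n} {y : Fin m → Rn n} {d : ℝ} (hd : 0 < d) (h : d ≤ dist y (fun _ => x))
    (hx : ‖x - x'‖ ≤ 1 / 2 * d) :
    ‖K x y - K x' y‖ ≤ A / d ^ (m * n) * ω (‖x - x'‖ / d) := by
  have hA := hK.pos
  obtain ⟨j, hj⟩ := exists_dist_const_eq hm y x
  have hσ := h.trans (dist_const_le_sum _ _)
  refine (hK.smooth_x x x' y (exists_ne_of_dist_const_pos (hd.trans_le h))
    ⟨j, by rw [← hj]; linarith⟩).trans ?_
  generalize ∑ i, ‖x - y i‖ = σ at hσ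
  have hσ0 : 0 < σ := hd.trans_le hσ
  have h1 : ω (‖x - x'‖ / σ) ≤ ω (‖x - x'‖ / d) := hω.mono_of_nonneg (by positivity) (by gcongr)
  have h0 := hω.nonneg (‖x - x'‖ / σ) (by positivity)
  gcongr

/-- The smoothness in `y_k` in terms of two lower bounds for the sup distance of `y` from `(x,…,x)`:
`d` enters the decay and `e` the argument of `ω`. -/
theorem KernelBounds.norm_sub_le_y (hK : KernelBounds A ω K) (hω : IsDiniModulus ω) (hm : 1 ≤ m)
    {x c : Rn n} {y : Fin m → Rn n} {k : Fin m} {d t e : ℝ} (hd : 0 < d) (he : 0 < e)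
    (h : d ≤ dist y (fun _ => x)) (he' : e ≤ dist y (fun _ => x))
    (hc : ‖y k - c‖ ≤ t) (ht : t ≤ 1 / 2 * e) :
    ‖K x y - K x (Function.update y k c)‖ ≤ A / d ^ (m * n) * ω (t / e) := by
  have hA := hK.pos
  obtain ⟨j, hj⟩ := exists_dist_const_eq hm y x
  have hσ := h.trans (dist_const_le_sum _ _)
  have hσ' := he'.trans (dist_const_le_sum _ _)
  have ht0 : 0 ≤ t := (norm_nonneg _).trans hc
  refine (hK.smooth_y x y k c (exists_ne_of_dist_const_pos (hd.trans_le h))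
    ⟨j, by rw [← hj]; linarith⟩).trans ?_
  generalize ∑ i, ‖x - y i‖ = σ at hσ hσ'
  have hσ0 : 0 < σ := hd.trans_le hσ
  have h1 : ω (‖y k - c‖ / σ) ≤ ω (t / e) := hω.mono_of_nonneg (by positivity) (by gcongr)
  have h0 := hω.nonneg (‖y k - c‖ / σ) (by positivity)
  gcongr

/-- Integrability of the kernel against a tensor product with a far factor, as a sum over shells. -/
theorem KernelBounds.lintegral_far_le (hK : KernelBounds A ω K) {x z : Rn n} {r : ℝ} (hr : 0 < r)
    (hx : x ∈ Metric.ball z r) {h : Fin m → Rn n → ℝ≥0∞} (hh : ∀ i, AEMeasurable (h i)) :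
    ∫⁻ y in (Metric.ball (fun _ : Fin m => z) (2 * r))ᶜ, ‖K x y‖ₑ * ∏ i, h i (y i) ≤
      ∑' k : ℕ, ENNReal.ofReal (A / (2 ^ k * r) ^ (m * n)) *
        ∏ i, ∫⁻ y in Metric.ball z (2 ^ (k + 1) * (2 * r)), h i y := by
  refine lintegral_compl_ball_prod_le z (by positivity) hh _ _ (fun k => ENNReal.ofReal_ne_top) ?_
  intro k y hy _
  rw [← ofReal_norm]
  apply ENNReal.ofReal_le_ofReal
  have hxz : dist (fun _ : Fin m => z) (fun _ : Fin m => x) ≤ r := by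
    refine (dist_pi_le_iff hr.le).2 fun i => ?_
    rw [dist_comm]; exact (Metric.mem_ball.1 hx).le
  have h1 := dist_triangle y (fun _ : Fin m => x) (fun _ : Fin m => z)
  rw [dist_comm (fun _ : Fin m => x)] at h1
  have h2 : (1 : ℝ) ≤ 2 ^ k := one_le_pow₀ (by norm_num)
  refine hK.norm_le (by positivity) ?_
  nlinarith

/-- The oscillation in `x` of the kernel against a tensor product with a far factor. -/
theorem KernelBounds.lintegral_far_sub_le (hK : KernelBounds A ω K) (hω : IsDiniModulus ω)
    (hm : 1 ≤ m) {x z : Rn n} {r : ℝ} (hr : 0 < r) (hx : x ∈ Metric.ball z r)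
    {h : Fin m → Rn n → ℝ≥0∞} (hh : ∀ i, AEMeasurable (h i)) {a : Fin m → ℝ} (ha : ∀ i, 0 ≤ a i)
    (hav : ∀ i s, 2 * r ≤ s → ∫⁻ y in Metric.ball z s, h i y ≤ ENNReal.ofReal (a i * s ^ n)) :
    ∫⁻ y in (Metric.ball (fun _ : Fin m => z) (2 * r))ᶜ, ‖K z y - K x y‖ₑ * ∏ i, h i (y i) ≤
      ENNReal.ofReal (A * 2 ^ (m * n) * ∏ i, a i) *
        ∑' k : ℕ, ENNReal.ofReal (ω ((1 / 2) ^ (k + 1))) := by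
  have hA := hK.pos
  have hω0 : ∀ k : ℕ, 0 ≤ ω ((1 / 2) ^ (k + 1)) := fun k => hω.nonneg _ (by positivity)
  have hxz : ‖z - x‖ ≤ r := by rw [← dist_eq_norm, dist_comm]; exact (Metric.mem_ball.1 hx).le
  refine (lintegral_compl_ball_prod_le z (by positivity) hh _
    (fun k => ENNReal.ofReal (A / (2 ^ k * (2 * r)) ^ (m * n) * ω ((1 / 2) ^ (k + 1))))
    (fun k => ENNReal.ofReal_ne_top) ?_).trans ?_
  · intro k y hy _
    rw [← ofReal_norm]
    apply ENNReal.ofReal_le_ofReal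
    have h2 : (1 : ℝ) ≤ 2 ^ k := one_le_pow₀ (by norm_num)
    refine (hK.norm_sub_le_x hω hm (by positivity) hy (by nlinarith)).trans ?_
    gcongr
    refine hω.mono_of_nonneg (by positivity) ?_
    rw [div_le_iff₀ (by positivity)]
    have : ((1 : ℝ) / 2) ^ (k + 1) * (2 ^ k * (2 * r)) = r := by
      rw [one_div, inv_pow]; field_simp; ring
    linarith
  · rw [← ENNReal.tsum_mul_left]
    refine ENNReal.tsum_le_tsum fun k => ?_
    have h2 : (1 : ℝ) ≤ 2 ^ (k + 1) := one_le_pow₀ (by norm_num)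
    calc _ ≤ ENNReal.ofReal (A / (2 ^ k * (2 * r)) ^ (m * n) * ω ((1 / 2) ^ (k + 1))) *
          ∏ i, ENNReal.ofReal (a i * (2 ^ (k + 1) * (2 * r)) ^ n) := by
          gcongr with i
          exact hav i _ (by nlinarith)
      _ = _ := by
          have := hω0 k
          rw [← ENNReal.ofReal_prod_of_nonneg (fun i _ => by have := ha i; positivity),
            ← ENNReal.ofReal_mul (by positivity),
            ← ENNReal.ofReal_mul (by have := Finset.prod_nonneg fun i (_ : i ∈ Finset.univ) => ha i; positivity)]
          congr 1
          rw [Finset.prod_mul_distrib, Finset.prod_const, Finset.card_univ, Fintype.card_fin,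
            ← pow_mul, mul_comm n m, pow_succ (2 : ℝ) k,
            mul_right_comm _ 2 (2 * r), mul_pow _ (2 : ℝ)]
          field_simp

/-- The oscillation in `y_k` of the kernel against a tensor product whose `k`-th factor lives in a
small ball, at a point far from that ball. -/
theorem KernelBounds.lintegral_sub_update_le (hK : KernelBounds A ω K) (hω : IsDiniModulus ω)
    (hn : 1 ≤ n) (hm : 1 ≤ m) {x c : Rn n} {t : ℝ} (ht : 0 < t) (hx : 4 * t ≤ dist x c)
    {h : Fin m → Rn n → ℝ≥0∞} (hh : ∀ i, AEMeasurable (h i)) {k : Fin m}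
    (hk : ∀ y, y ∉ Metric.closedBall c t → h k y = 0) {a : Fin m → ℝ} (ha : ∀ i, 0 ≤ a i)
    (hav : ∀ i, i ≠ k → ∀ s, 0 < s →
      ∫⁻ y in Metric.ball x s, h i y ≤ ENNReal.ofReal (a i * s ^ n)) :
    ∫⁻ y, ‖K x y - K x (Function.update y k c)‖ₑ * ∏ i, h i (y i) ≤
      ENNReal.ofReal (A * 2 ^ (m * n) * 2 * (∏ i ∈ Finset.univ.erase k, a i) *
        (ω (2 * t / dist x c) / dist x c ^ n)) * ∫⁻ y, h k y := by
  have hA := hK.pos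
  set ρ := dist x c with hρ
  have hρ0 : 0 < ρ := by linarith
  have hP : 0 ≤ ∏ i ∈ Finset.univ.erase k, a i := Finset.prod_nonneg fun i _ => ha i
  have hω0 : 0 ≤ ω (2 * t / ρ) := hω.nonneg _ (by positivity)
  have hfar : ∀ y : Fin m → Rn n, y k ∈ Metric.closedBall c t →
      ρ / 2 ≤ dist y (fun _ => x) := by
    intro y hy
    have h1 := dist_le_pi_dist y (fun _ => x) k
    have h2 := dist_triangle x (y k) c
    rw [Metric.mem_closedBall] at hy
    rw [dist_comm x (y k)] at h2
    linarith
  -- As `h k` is supported far from `x`, the shells start at radius `ρ / 2`. On the `j`-th one, `h k` is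
  -- integrated as a whole, which leaves a surplus factor `2^{-jn}` to sum over.
  calc ∫⁻ y, ‖K x y - K x (Function.update y k c)‖ₑ * ∏ i, h i (y i)
      ≤ ∫⁻ y in (Metric.ball (fun _ : Fin m => x) (ρ / 2))ᶜ,
          ((fun y => y k) ⁻¹' Metric.closedBall c t).indicator
            (fun y => ‖K x y - K x (Function.update y k c)‖ₑ) y * ∏ i, h i (y i) := by
        rw [← lintegral_indicator Metric.isOpen_ball.measurableSet.compl]
        refine lintegral_mono fun y => ?_
        by_cases hy : y k ∈ Metric.closedBall c t
        · rw [indicator_of_mem (by simpa using hfar y hy), indicator_of_mem (by exact hy)]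
        · have : ∏ i, h i (y i) = 0 := Finset.prod_eq_zero (Finset.mem_univ k) (hk _ hy)
          simp [this]
    _ ≤ ∑' j : ℕ, ENNReal.ofReal (A / (2 ^ j * (ρ / 2)) ^ (m * n) * ω (2 * t / ρ)) *
          ∏ i, ∫⁻ y in Metric.ball x (2 ^ (j + 1) * (ρ / 2)), h i y := by
        refine lintegral_compl_ball_prod_le x (by positivity) hh _ _
          (fun k => ENNReal.ofReal_ne_top) ?_
        intro j y hy _
        by_cases hyk : y k ∈ Metric.closedBall c t
        · rw [indicator_of_mem (by exact hyk), ← ofReal_norm]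
          apply ENNReal.ofReal_le_ofReal
          rw [show 2 * t / ρ = t / (ρ / 2) by field_simp]
          refine hK.norm_sub_le_y hω hm (by positivity) (by positivity) hy (hfar y hyk) ?_
            (by linarith)
          rw [← dist_eq_norm]; exact hyk
        · rw [indicator_of_notMem (by exact hyk)]; exact zero_le
    _ ≤ ∑' j : ℕ, ENNReal.ofReal (A * 2 ^ (m * n) * (∏ i ∈ Finset.univ.erase k, a i) *
          (ω (2 * t / ρ) / ρ ^ n)) * (∫⁻ y, h k y) * ENNReal.ofReal ((1 / 2) ^ j) := by
        refine ENNReal.tsum_le_tsum fun j => ?_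
        rw [← Finset.mul_prod_erase _ _ (Finset.mem_univ k)]
        calc _ ≤ ENNReal.ofReal (A / (2 ^ j * (ρ / 2)) ^ (m * n) * ω (2 * t / ρ)) *
              ((∫⁻ y, h k y) * ∏ i ∈ Finset.univ.erase k,
                ENNReal.ofReal (a i * (2 ^ (j + 1) * (ρ / 2)) ^ n)) := by
              refine mul_le_mul_right ?_ _
              refine mul_le_mul' (setLIntegral_le_lintegral _ _) ?_
              exact Finset.prod_le_prod' fun i hi =>
                hav i (Finset.ne_of_mem_erase hi) _ (by positivity)
          _ = ENNReal.ofReal (A / (2 ^ j * (ρ / 2)) ^ (m * n) * ω (2 * t / ρ) *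
                ∏ i ∈ Finset.univ.erase k, (a i * (2 ^ (j + 1) * (ρ / 2)) ^ n)) *
                (∫⁻ y, h k y) := by
              rw [← ENNReal.ofReal_prod_of_nonneg (fun i _ => by have := ha i; positivity),
                ENNReal.ofReal_mul (q := ∏ i ∈ Finset.univ.erase k, _) (by positivity)]
              ring
          _ ≤ _ := by
              rw [mul_right_comm (ENNReal.ofReal _), ← ENNReal.ofReal_mul (by positivity)]
              refine mul_le_mul_left (ENNReal.ofReal_le_ofReal ?_) _
              rw [Finset.prod_mul_distrib, Finset.prod_const,
                Finset.card_erase_of_mem (Finset.mem_univ k), Finset.card_univ, Fintype.card_fin]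
              obtain ⟨m', rfl⟩ : ∃ m', m = m' + 1 := ⟨m - 1, by omega⟩
              rw [Nat.add_sub_cancel]
              have e1 : (2 : ℝ) ^ (j + 1) * (ρ / 2) = 2 ^ j * ρ := by rw [pow_succ]; ring
              have e2 : (2 : ℝ) ^ j * (ρ / 2) = 2 ^ j * ρ / 2 := by ring
              have e3 : (((2 : ℝ) ^ j * ρ) ^ n) ^ m' = (2 ^ j * ρ) ^ (m' * n) := by
                rw [← pow_mul, mul_comm n m']
              rw [e1, e2, e3, div_pow, add_mul, one_mul, pow_add (2 ^ j * ρ)]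
              have h3 : ((2 : ℝ) ^ j) ≤ (2 ^ j) ^ n :=
                le_self_pow₀ (one_le_pow₀ (by norm_num)) (by omega)
              have e4 : A / ((2 ^ j * ρ) ^ (m' * n) * (2 ^ j * ρ) ^ n / 2 ^ (m' * n + n)) *
                    ω (2 * t / ρ) *
                  ((∏ i ∈ Finset.univ.erase k, a i) * (2 ^ j * ρ) ^ (m' * n)) =
                  A * 2 ^ (m' * n + n) * (∏ i ∈ Finset.univ.erase k, a i) *
                    (ω (2 * t / ρ) / ρ ^ n) * (1 / (2 ^ j) ^ n) := by
                rw [mul_pow _ _ n]; field_simp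
              rw [e4]
              gcongr
              rw [one_div, one_div, inv_pow]
              gcongr
    _ = _ := by
        rw [ENNReal.tsum_mul_left]
        have hs : ∑' j : ℕ, ENNReal.ofReal ((1 / 2) ^ j) = ENNReal.ofReal 2 := by
          rw [← ENNReal.ofReal_tsum_of_nonneg (fun _ => by positivity) summable_geometric_two,
            tsum_geometric_two]
        rw [hs, mul_right_comm, ← ENNReal.ofReal_mul (by positivity)]
        congr 2
        ring

/-- The integral over the complement of a ball of the bound of `lintegral_sub_update_le`. -/
theorem lintegral_modulus_le (hω : IsDiniModulus ω) {c : Rn n} {t : ℝ} (ht : 0 < t) :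
    ∫⁻ x in (Metric.ball c (4 * t))ᶜ, ENNReal.ofReal (ω (2 * t / dist x c) / dist x c ^ n) ≤
      ENNReal.ofReal (unitVol n * 2 ^ n) * ∑' k : ℕ, ENNReal.ofReal (ω ((1 / 2) ^ (k + 1))) := by
  refine (lintegral_compl_ball_le_tsum c (by positivity) _).trans ?_
  rw [← ENNReal.tsum_mul_left]
  refine ENNReal.tsum_le_tsum fun k => ?_
  have hω0 : 0 ≤ ω ((1 / 2) ^ (k + 1)) := hω.nonneg _ (by positivity)
  calc _ ≤ ∫⁻ x in Metric.ball c (2 ^ (k + 1) * (4 * t)) \ Metric.ball c (2 ^ k * (4 * t)),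
        ENNReal.ofReal (ω ((1 / 2) ^ (k + 1)) / (2 ^ k * (4 * t)) ^ n) := by
        refine setLIntegral_mono' (Metric.isOpen_ball.measurableSet.diff
          Metric.isOpen_ball.measurableSet) fun x hx => ?_
        apply ENNReal.ofReal_le_ofReal
        have hx2 : 2 ^ k * (4 * t) ≤ dist x c := by simpa using hx.2
        have hd : 0 < dist x c := lt_of_lt_of_le (by positivity) hx2
        have h1 : ω (2 * t / dist x c) ≤ ω ((1 / 2) ^ (k + 1)) := by
          refine hω.mono_of_nonneg (by positivity) ?_
          rw [div_le_iff₀ hd]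
          calc 2 * t = (1 / 2) ^ (k + 1) * (2 ^ k * (4 * t)) := by
                rw [one_div, inv_pow]; field_simp; ring
            _ ≤ _ := by gcongr
        gcongr
    _ ≤ ENNReal.ofReal (ω ((1 / 2) ^ (k + 1)) / (2 ^ k * (4 * t)) ^ n) *
          volume (Metric.ball c (2 ^ (k + 1) * (4 * t))) := by
        rw [setLIntegral_const]; gcongr; exact sdiff_subset
    _ = _ := by
        have := unitVol_pos n
        rw [volume_ball _ (by positivity), ← ENNReal.ofReal_mul (by positivity),
          ← ENNReal.ofReal_mul (by positivity)]
        congr 1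
        rw [pow_succ (2 : ℝ) k, mul_right_comm _ 2 (4 * t), mul_pow _ (2 : ℝ)]
        field_simp

end Bounds


/-! ### Weakly bounded extensions -/

/-- Chebyshev's inequality for the weak norm. -/
theorem volume_lt_enorm_le {n : ℕ} {q : ℝ} (hq : 0 < q) (g : Rn n → ℂ) {l : ℝ≥0} (hl : 0 < l) :
    volume {x | (l : ℝ≥0∞) < ‖g x‖ₑ} ≤ (weakNorm q g / l) ^ q := by
  have h : (l : ℝ≥0∞) * volume {x | (l : ℝ≥0∞) < ‖g x‖ₑ} ^ (1 / q) ≤ weakNorm q g :=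
    le_iSup (fun l : ℝ≥0 => (l : ℝ≥0∞) * volume {x | (l : ℝ≥0∞) < ‖g x‖ₑ} ^ (1 / q)) l
  have h2 : volume {x | (l : ℝ≥0∞) < ‖g x‖ₑ} ^ (1 / q) ≤ weakNorm q g / l := by
    rw [ENNReal.le_div_iff_mul_le (Or.inl (by exact_mod_cast hl.ne')) (Or.inl ENNReal.coe_ne_top),
      mul_comm]
    exact h
  have h3 := ENNReal.rpow_le_rpow h2 hq.le
  rwa [← ENNReal.rpow_mul, one_div, inv_mul_cancel₀ hq.ne', ENNReal.rpow_one] at h3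

theorem weakNorm_le_eLpNorm {n : ℕ} {q : ℝ} (hq : 0 < q) {g : Rn n → ℂ}
    (hg : AEStronglyMeasurable g) : weakNorm q g ≤ eLpNorm g (ENNReal.ofReal q) volume := by
  refine iSup_le fun l => ?_
  have h := mul_meas_ge_le_pow_eLpNorm' (p := ENNReal.ofReal q) volume (by simpa using hq)
    ENNReal.ofReal_ne_top hg l
  rw [ENNReal.toReal_ofReal hq.le] at h
  have h2 := ENNReal.rpow_le_rpow h (show 0 ≤ 1 / q by positivity)
  rw [ENNReal.mul_rpow_of_nonneg _ _ (by positivity), ← ENNReal.rpow_mul, ← ENNReal.rpow_mul,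
    mul_one_div_cancel hq.ne', ENNReal.rpow_one, ENNReal.rpow_one] at h2
  refine le_trans (mul_le_mul_right (ENNReal.rpow_le_rpow (measure_mono fun x hx => ?_)
    (by positivity)) _) h2
  exact le_of_lt (show (l : ℝ≥0∞) < ‖g x‖ₑ from hx)

/-- A function in weak `L^q`, `q > 1`, is locally integrable. -/
theorem locallyIntegrable_of_weakNorm {n : ℕ} {q : ℝ} (hq : 1 < q) {g : Rn n → ℂ}
    (hg : AEStronglyMeasurable g) (hfin : weakNorm q g ≠ ∞) : LocallyIntegrable g := by
  have hq0 : 0 < q := by linarith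
  intro x
  refine ⟨Metric.ball x 1, Metric.ball_mem_nhds x one_pos, hg.restrict, ?_⟩
  rw [hasFiniteIntegral_iff_norm,
    lintegral_eq_lintegral_meas_lt _ (Eventually.of_forall fun _ => norm_nonneg _)
      hg.restrict.norm.aemeasurable]
  -- levels up to `1` cost the volume of the ball, those above `1` decay like `t^{-q}`
  have hsplit : Ioi (0 : ℝ) = Ioc 0 1 ∪ Ioi 1 := (Ioc_union_Ioi_eq_Ioi zero_le_one).symm
  rw [hsplit]
  refine (lintegral_union_le _ _ _).trans_lt (ENNReal.add_lt_top.2 ⟨?_, ?_⟩)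
  · calc _ ≤ ∫⁻ t in Ioc (0 : ℝ) 1, volume (Metric.ball x 1) :=
          lintegral_mono fun t => (measure_mono (subset_univ _)).trans (by simp)
      _ < ∞ := by
        rw [setLIntegral_const]
        exact ENNReal.mul_lt_top measure_ball_lt_top (by simp)
  · calc _ ≤ ∫⁻ t in Ioi (1 : ℝ), weakNorm q g ^ q * ENNReal.ofReal (t ^ (-q)) := by
          refine setLIntegral_mono' measurableSet_Ioi fun t ht => ?_
          have ht0 : 0 < t := zero_lt_one.trans ht
          have h := volume_lt_enorm_le hq0 g (l := t.toNNReal) (by simpa using ht0)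
          have e : {a | t < ‖g a‖} = {x | (t.toNNReal : ℝ≥0∞) < ‖g x‖ₑ} := by
            ext a
            simp only [mem_ofPred_eq]
            rw [← ofReal_norm, ← ENNReal.ofReal.eq_1, ENNReal.ofReal_lt_ofReal_iff_of_nonneg ht0.le]
          refine (Measure.restrict_apply_le _ _).trans ?_
          rw [e]
          refine h.trans (le_of_eq ?_)
          rw [← ENNReal.ofReal.eq_1, ENNReal.div_rpow_of_nonneg _ _ hq0.le, div_eq_mul_inv,
            ENNReal.ofReal_rpow_of_pos ht0, Real.rpow_neg ht0.le,
            ENNReal.ofReal_inv_of_pos (by positivity)]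
      _ < ∞ := by
          have hne : weakNorm q g ^ q ≠ ∞ := ENNReal.rpow_ne_top_of_nonneg hq0.le hfin
          rw [lintegral_const_mul' _ _ hne]
          refine ENNReal.mul_lt_top hne.lt_top ?_
          exact (integrableOn_Ioi_rpow_of_lt (by linarith) one_pos).lintegral_lt_top

/-- A multilinear extension of `T` to `L^{q_1} × ⋯ × L^{q_m}` which is bounded into weak `L^{q₀}`
and has locally integrable values. This is what the bounded extensions of
`IsBoundedExtension` for the three target norms used in the theorem have in common. -/
structure IsWeakExtension {n m : ℕ}
    (T : MultilinearMap ℂ (fun _ : Fin m => 𝓢(Rn n, ℂ)) 𝓢'(Rn n, ℂ))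
    (q : Fin m → ℝ) (q₀ : ℝ)
    (S : MultilinearMap ℂ
      (fun i : Fin m => Lp ℂ (ENNReal.ofReal (q i)) (volume : Measure (Rn n)))
      (Rn n →ₘ[volume] ℂ)) : Prop where
  one_lt : ∀ i, 1 < q i
  pos : 0 < q₀
  sum_eq : ∑ i, 1 / q i = 1 / q₀
  bound : ∃ C : ℝ≥0, ∀ f,
    weakNorm q₀ (S f) ≤ C * ∏ i, eLpNorm (f i) (ENNReal.ofReal (q i)) volume
  locallyIntegrable : ∀ f, LocallyIntegrable (S f)
  pairing : ∀ (f : Fin m → 𝓢(Rn n, ℂ)) (g : 𝓢(Rn n, ℂ)),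
    T f g = ∫ x, S (fun i => (f i).toLp (ENNReal.ofReal (q i)) volume) x * g x

section WeakExtension

variable {n m : ℕ} {T : MultilinearMap ℂ (fun _ : Fin m => 𝓢(Rn n, ℂ)) 𝓢'(Rn n, ℂ)}
  {q : Fin m → ℝ} {q₀ : ℝ}
  {S : MultilinearMap ℂ
      (fun i : Fin m => Lp ℂ (ENNReal.ofReal (q i)) (volume : Measure (Rn n)))
      (Rn n →ₘ[volume] ℂ)}

theorem prod_eLpNorm_ne_top
    (f : ∀ i : Fin m, Lp ℂ (ENNReal.ofReal (q i)) (volume : Measure (Rn n))) :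
    ∏ i, eLpNorm (f i) (ENNReal.ofReal (q i)) volume ≠ ∞ :=
  ENNReal.prod_ne_top fun i _ => (Lp.memLp (f i)).eLpNorm_ne_top

theorem IsBoundedExtension.isWeakExtension_of_weakNorm
    (hS : IsBoundedExtension T q (weakNorm q₀) S) (hq : ∀ i, 1 < q i) (hq₀ : 1 < q₀)
    (hsum : ∑ i, 1 / q i = 1 / q₀) : IsWeakExtension T q q₀ S := by
  obtain ⟨⟨C, hC⟩, hp⟩ := hS
  refine ⟨hq, by linarith, hsum, ⟨C, hC⟩, fun f => ?_, hp⟩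
  refine locallyIntegrable_of_weakNorm hq₀ (S f).aestronglyMeasurable ?_
  exact ne_top_of_le_ne_top (ENNReal.mul_ne_top ENNReal.coe_ne_top (prod_eLpNorm_ne_top f)) (hC f)

theorem IsBoundedExtension.isWeakExtension_of_eLpNorm
    (hS : IsBoundedExtension T q (fun g => eLpNorm g (ENNReal.ofReal q₀) volume) S)
    (hq : ∀ i, 1 < q i) (hq₀ : 1 ≤ q₀)
    (hsum : ∑ i, 1 / q i = 1 / q₀) : IsWeakExtension T q q₀ S := by
  obtain ⟨⟨C, hC⟩, hp⟩ := hS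
  refine ⟨hq, by linarith, hsum, ⟨C, fun f => ?_⟩, fun f => ?_, hp⟩
  · exact (weakNorm_le_eLpNorm (by linarith) (S f).aestronglyMeasurable).trans (hC f)
  · have : MemLp (S f) (ENNReal.ofReal q₀) := ⟨(S f).aestronglyMeasurable,
      (hC f).trans_lt (ENNReal.mul_lt_top ENNReal.coe_lt_top (prod_eLpNorm_ne_top f).lt_top)⟩
    exact this.locallyIntegrable (by simpa using ENNReal.ofReal_le_ofReal hq₀)

/-- A weakly bounded multilinear operator is continuous in measure. -/
theorem IsWeakExtension.tendstoInMeasure (hS : IsWeakExtension T q q₀ S)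
    {u : ℕ → ∀ i : Fin m, Lp ℂ (ENNReal.ofReal (q i)) (volume : Measure (Rn n))}
    {v : ∀ i : Fin m, Lp ℂ (ENNReal.ofReal (q i)) (volume : Measure (Rn n))}
    (h : ∀ i, Tendsto (fun N => eLpNorm (u N i - v i : Lp ℂ (ENNReal.ofReal (q i)) volume)
      (ENNReal.ofReal (q i)) volume) atTop (𝓝 0)) :
    TendstoInMeasure volume (fun N => (S (u N) : Rn n → ℂ)) atTop (S v) := by
  classical
  obtain ⟨C, hC⟩ := hS.bound
  intro ε hε
  set ε' : ℝ≥0 := (min ε 1).toNNReal / (2 ^ m + 1) with hε'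
  have hmin0 : min ε 1 ≠ 0 := (lt_min hε one_pos).ne'
  have hmin1 : min ε 1 ≠ ∞ := ne_top_of_le_ne_top ENNReal.one_ne_top (min_le_right _ _)
  have hε'0 : 0 < ε' := div_pos (ENNReal.toNNReal_pos hmin0 hmin1) (by positivity)
  -- Expanding `S (d + v)`, every term other than `S v` has an entry of `d`, which tends to `0`.
  set d : ℕ → ∀ i : Fin m, Lp ℂ (ENNReal.ofReal (q i)) (volume : Measure (Rn n)) :=
    fun N => u N - v
  have hsub : ∀ N, S (u N) = S v + ∑ J ∈ Finset.univ.erase (∅ : Finset (Fin m)),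
      S (J.piecewise (d N) v) := by
    intro N
    have h1 : u N = d N + v := by simp [d]
    rw [h1, MultilinearMap.map_add_univ, ← Finset.add_sum_erase _ _ (Finset.mem_univ ∅)]
    simp
  have hle : ∀ N, volume {x | ε ≤ edist (S (u N) x) (S v x)} ≤
      ∑ J ∈ Finset.univ.erase (∅ : Finset (Fin m)),
        (weakNorm q₀ (S (J.piecewise (d N) v)) / ε') ^ q₀ := by
    intro N
    have hae : ∀ᵐ x, S (u N) x = S v x + ∑ J ∈ Finset.univ.erase (∅ : Finset (Fin m)),
        S (J.piecewise (d N) v) x := by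
      rw [hsub]
      filter_upwards [AEEqFun.coeFn_add (S v) (∑ J ∈ Finset.univ.erase (∅ : Finset (Fin m)),
        S (J.piecewise (d N) v)), AEEqFun.coeFn_finsetSum (Finset.univ.erase (∅ : Finset (Fin m)))
        (fun J => S (J.piecewise (d N) v))] with x h1 h2
      rw [h1, Pi.add_apply, h2, Finset.sum_apply]
    calc volume {x | ε ≤ edist (S (u N) x) (S v x)}
        ≤ volume (⋃ J ∈ Finset.univ.erase (∅ : Finset (Fin m)),
          {x | (ε' : ℝ≥0∞) < ‖S (J.piecewise (d N) v) x‖ₑ}) := by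
          refine measure_mono_ae ?_
          filter_upwards [hae] with x hx hxε
          change ε ≤ edist (S (u N) x) (S v x) at hxε
          change x ∈ ⋃ J ∈ Finset.univ.erase (∅ : Finset (Fin m)),
            {x | (ε' : ℝ≥0∞) < ‖S (J.piecewise (d N) v) x‖ₑ}
          by_contra hno
          simp only [mem_iUnion, mem_ofPred_eq, not_exists, not_lt] at hno
          rw [hx, edist_comm, edist_eq_enorm_sub, enorm_sub_rev, add_sub_cancel_left] at hxε
          have h1 : min ε 1 ≤ (2 ^ m : ℝ≥0) * ε' := by
            calc min ε 1 ≤ ε := min_le_left _ _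
              _ ≤ _ := hxε
              _ ≤ ∑ J ∈ Finset.univ.erase (∅ : Finset (Fin m)),
                  ‖S (J.piecewise (d N) v) x‖ₑ := enorm_sum_le _ _
              _ ≤ ∑ J ∈ Finset.univ.erase (∅ : Finset (Fin m)), (ε' : ℝ≥0∞) :=
                  Finset.sum_le_sum fun J hJ => hno J hJ
              _ ≤ ∑ J : Finset (Fin m), (ε' : ℝ≥0∞) :=
                  Finset.sum_le_sum_of_subset (Finset.erase_subset _ _)
              _ = _ := by simp
          rw [← ENNReal.coe_toNNReal hmin1, ← ENNReal.coe_mul, ENNReal.coe_le_coe] at h1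
          have h2 : (min ε 1).toNNReal = (2 ^ m + 1) * ε' := by
            rw [hε', mul_div_cancel₀]; positivity
          rw [h2] at h1
          have h3 : (2 ^ m : ℝ≥0) * ε' < (2 ^ m + 1) * ε' := by gcongr; simp
          exact absurd h1 (not_le.2 h3)
      _ ≤ _ := (measure_biUnion_finset_le _ _).trans
          (Finset.sum_le_sum fun J _ => volume_lt_enorm_le hS.pos _ hε'0)
  refine tendsto_of_tendsto_of_tendsto_of_le_of_le tendsto_const_nhds ?_ (fun _ => zero_le) hle
  rw [← Finset.sum_const_zero (s := Finset.univ.erase (∅ : Finset (Fin m)))]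
  refine tendsto_finsetSum _ fun J hJ => ?_
  obtain ⟨k, hk⟩ := Finset.nonempty_iff_ne_empty.2 (Finset.ne_of_mem_erase hJ)
  have hprod : Tendsto (fun N => ∏ i, eLpNorm (J.piecewise (d N) v i) (ENNReal.ofReal (q i)) volume)
      atTop (𝓝 0) := by
    have hlim : Tendsto (fun N => ∏ i, eLpNorm (J.piecewise (d N) v i) (ENNReal.ofReal (q i)) volume)
        atTop (𝓝 (∏ i, if i ∈ J then 0 else eLpNorm (v i) (ENNReal.ofReal (q i)) volume)) := by
      refine ENNReal.tendsto_finsetProd_of_ne_top _ (fun i _ => ?_) (fun i _ => ?_)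
      · by_cases hi : i ∈ J
        · simpa [hi, d] using h i
        · simp [hi]
      · by_cases hi : i ∈ J
        · simp [hi]
        · simpa [hi] using (Lp.memLp (v i)).eLpNorm_ne_top
    rwa [Finset.prod_eq_zero (Finset.mem_univ k) (by simp [hk])] at hlim
  have hweak : Tendsto (fun N => weakNorm q₀ (S (J.piecewise (d N) v))) atTop (𝓝 0) := by
    have h1 : Tendsto (fun N => (C : ℝ≥0∞) * ∏ i, eLpNorm (J.piecewise (d N) v i)
        (ENNReal.ofReal (q i)) volume) atTop (𝓝 0) := by
      simpa using ENNReal.Tendsto.const_mul hprod (Or.inr ENNReal.coe_ne_top)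
    exact tendsto_of_tendsto_of_tendsto_of_le_of_le tendsto_const_nhds h1 (fun _ => zero_le)
      fun N => hC _
  have h2 : Tendsto (fun N => (weakNorm q₀ (S (J.piecewise (d N) v)) / ε')) atTop (𝓝 0) := by
    simpa using ENNReal.Tendsto.div_const hweak (Or.inr (by exact_mod_cast hε'0.ne'))
  simpa [ENNReal.zero_rpow_of_pos hS.pos] using h2.ennrpow_const q₀

end WeakExtension


/-! ### The kernel representation off the support -/

theorem classLp_of_memLp {n : ℕ} {q : ℝ} {f : Rn n → ℂ} (h : MemLp f (ENNReal.ofReal q) volume) :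
    classLp q f = h.toLp f := by
  rw [classLp, dif_pos h]

theorem classLp_congr {n : ℕ} {q : ℝ} {f g : Rn n → ℂ} (h : f =ᵐ[volume] g) :
    classLp q f = classLp q g := by
  by_cases hf : MemLp f (ENNReal.ofReal q) volume
  · have hg : MemLp g (ENNReal.ofReal q) volume := (memLp_congr_ae h).1 hf
    rw [classLp_of_memLp hf, classLp_of_memLp hg]
    exact MemLp.toLp_congr _ _ h
  · have hg : ¬ MemLp g (ENNReal.ofReal q) volume := fun hg => hf ((memLp_congr_ae h).2 hg)
    rw [classLp, classLp, dif_neg hf, dif_neg hg]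

theorem eLpNorm_classLp {n : ℕ} {q : ℝ} {f : Rn n → ℂ}
    (h : MemLp f (ENNReal.ofReal q) volume) :
    eLpNorm (classLp q f) (ENNReal.ofReal q) volume = eLpNorm f (ENNReal.ofReal q) volume := by
  rw [classLp_of_memLp h]
  exact eLpNorm_congr_ae h.coeFn_toLp

theorem classLp_schwartz {n : ℕ} (q : ℝ) (f : 𝓢(Rn n, ℂ)) :
    classLp q f = f.toLp (ENNReal.ofReal q) volume :=
  classLp_of_memLp (f.memLp _ _)

theorem classLp_add {n : ℕ} {q : ℝ} {f g : Rn n → ℂ} (hf : MemLp f (ENNReal.ofReal q) volume)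
    (hg : MemLp g (ENNReal.ofReal q) volume) :
    classLp q (f + g) = classLp q f + classLp q g := by
  rw [classLp_of_memLp hf, classLp_of_memLp hg, classLp_of_memLp (hf.add hg), MemLp.toLp_add]

theorem classLp_sub {n : ℕ} {q : ℝ} {f g : Rn n → ℂ} (hf : MemLp f (ENNReal.ofReal q) volume)
    (hg : MemLp g (ENNReal.ofReal q) volume) :
    classLp q (f - g) = classLp q f - classLp q g := by
  rw [classLp_of_memLp hf, classLp_of_memLp hg, classLp_of_memLp (hf.sub hg), MemLp.toLp_sub]

theorem classLp_const_smul {n : ℕ} {q : ℝ} {f : Rn n → ℂ} (c : ℂ)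
    (hf : MemLp f (ENNReal.ofReal q) volume) :
    classLp q (c • f) = c • classLp q f := by
  rw [classLp_of_memLp hf, classLp_of_memLp (hf.const_smul c), MemLp.toLp_const_smul]

/-- Approximation in `L^q` by test functions which vanish wherever a given cutoff does. -/
theorem exists_schwartz_approx {n : ℕ} {q : ℝ} (hq : 1 ≤ q) {f : Rn n → ℂ}
    (hf : MemLp f (ENNReal.ofReal q) volume) {χ : Rn n → ℝ} (hχ : ContDiff ℝ ((⊤ : ℕ∞) : WithTop ℕ∞) χ)
    (hχc : HasCompactSupport χ) (hχ1 : ∀ x, ‖χ x‖ ≤ 1) (hfχ : ∀ x, f x ≠ 0 → χ x = 1)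
    {ε : ℝ} (hε : 0 < ε) :
    ∃ φ : 𝓢(Rn n, ℂ), HasCompactSupport φ ∧ (∀ x, χ x = 0 → φ x = 0) ∧
      eLpNorm (⇑φ - f) (ENNReal.ofReal q) volume ≤ ENNReal.ofReal ε := by
  obtain ⟨g, -, hg2, hg3⟩ := hf.exist_eLpNorm_sub_le ENNReal.ofReal_ne_top
    (by simpa using ENNReal.ofReal_le_ofReal hq) hε
  have hc : HasCompactSupport fun x => χ x • g x := hχc.smul_right
  refine ⟨hc.toSchwartzMap (hχ.smul hg2), hc, fun x hx => ?_, le_trans ?_ hg3⟩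
  · change χ x • g x = 0
    rw [hx, zero_smul]
  · refine eLpNorm_mono fun x => ?_
    have e : χ x • f x = f x := by
      by_cases h : f x = 0
      · simp [h]
      · simp [hfχ x h]
    change ‖χ x • g x - f x‖ ≤ ‖f x - g x‖
    calc ‖χ x • g x - f x‖ = ‖χ x‖ * ‖f x - g x‖ := by
          rw [← norm_smul, smul_sub, e, norm_sub_rev]
      _ ≤ 1 * ‖f x - g x‖ := by gcongr; exact hχ1 x
      _ = _ := one_mul _

theorem enorm_prod_eq {m : ℕ} (c : Fin m → ℂ) : ‖∏ i, c i‖ₑ = ∏ i, ‖c i‖ₑ := by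
  simp [enorm, nnnorm_prod]

/-- Convergence of tensor products in `L¹`. -/
theorem tendsto_lintegral_prod_sub {n m : ℕ} {F : ℕ → Fin m → Rn n → ℂ} {f : Fin m → Rn n → ℂ}
    (hF : ∀ N i, Integrable (F N i)) (hf : ∀ i, Integrable (f i))
    (h : ∀ i, Tendsto (fun N => ∫⁻ y, ‖F N i y - f i y‖ₑ) atTop (𝓝 0)) :
    Tendsto (fun N => ∫⁻ y : Fin m → Rn n, ‖∏ i, F N i (y i) - ∏ i, f i (y i)‖ₑ) atTop (𝓝 0) := by
  classical
  set d : ℕ → Fin m → Rn n → ℂ := fun N i y => F N i y - f i y with hd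
  have hdm : ∀ N i, AEMeasurable (fun y => ‖d N i y‖ₑ) := fun N i =>
    ((hF N i).sub (hf i)).aestronglyMeasurable.enorm
  have hfm : ∀ i, AEMeasurable (fun y => ‖f i y‖ₑ) := fun i => (hf i).aestronglyMeasurable.enorm
  have hbd : ∀ N, ∫⁻ y : Fin m → Rn n, ‖∏ i, F N i (y i) - ∏ i, f i (y i)‖ₑ ≤
      ∑ J ∈ Finset.univ.erase (∅ : Finset (Fin m)),
        ∏ i, if i ∈ J then ∫⁻ y, ‖d N i y‖ₑ else ∫⁻ y, ‖f i y‖ₑ := by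
    intro N
    have hpm : ∀ (J : Finset (Fin m)) i,
        AEMeasurable (if i ∈ J then fun y => ‖d N i y‖ₑ else fun y => ‖f i y‖ₑ) := by
      intro J i
      split_ifs
      · exact hdm N i
      · exact hfm i
    have hexp : ∀ y : Fin m → Rn n, ‖∏ i, F N i (y i) - ∏ i, f i (y i)‖ₑ ≤
        ∑ J ∈ Finset.univ.erase (∅ : Finset (Fin m)),
          ∏ i, (if i ∈ J then fun y => ‖d N i y‖ₑ else fun y => ‖f i y‖ₑ) (y i) := by
      intro y
      have h1 : ∏ i, F N i (y i) = ∏ i, (d N i (y i) + f i (y i)) := by simp [hd]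
      rw [h1, Fintype.prod_add, ← Finset.add_sum_erase _ _ (Finset.mem_univ ∅)]
      simp only [Finset.prod_empty, Finset.compl_empty, one_mul, add_sub_cancel_left]
      refine (enorm_sum_le _ _).trans (Finset.sum_le_sum fun J _ => ?_)
      have h2 : (∏ i ∈ J, d N i (y i)) * ∏ i ∈ Jᶜ, f i (y i) =
          ∏ i, if i ∈ J then d N i (y i) else f i (y i) := by
        rw [← Finset.prod_mul_prod_compl J (fun i => if i ∈ J then d N i (y i) else f i (y i))]
        congr 1
        · exact Finset.prod_congr rfl fun i hi => by simp [hi]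
        · exact Finset.prod_congr rfl fun i hi => by simp [Finset.mem_compl.1 hi]
      rw [h2, enorm_prod_eq]
      refine le_of_eq (Finset.prod_congr rfl fun i _ => ?_)
      split_ifs <;> rfl
    refine (lintegral_mono hexp).trans ?_
    rw [lintegral_finsetSum']
    · refine Finset.sum_le_sum fun J _ => ?_
      rw [volume_pi, lintegral_pi_prod (fun i => hpm J i)]
      refine le_of_eq (Finset.prod_congr rfl fun i _ => ?_)
      split_ifs <;> rfl
    · intro J _
      exact Finset.aemeasurable_fun_prod _ fun i _ =>
        (hpm J i).comp_quasiMeasurePreserving (Measure.quasiMeasurePreserving_eval _ i)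
  refine tendsto_of_tendsto_of_tendsto_of_le_of_le tendsto_const_nhds ?_ (fun _ => zero_le) hbd
  rw [← Finset.sum_const_zero (s := Finset.univ.erase (∅ : Finset (Fin m)))]
  refine tendsto_finsetSum _ fun J hJ => ?_
  obtain ⟨k, hk⟩ := Finset.nonempty_iff_ne_empty.2 (Finset.ne_of_mem_erase hJ)
  have hlim : Tendsto (fun N => ∏ i, if i ∈ J then ∫⁻ y, ‖d N i y‖ₑ else ∫⁻ y, ‖f i y‖ₑ) atTop
      (𝓝 (∏ i, if i ∈ J then 0 else ∫⁻ y, ‖f i y‖ₑ)) := by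
    refine ENNReal.tendsto_finsetProd_of_ne_top _ (fun i _ => ?_) (fun i _ => ?_)
    · by_cases hi : i ∈ J
      · simpa [hi] using h i
      · simp [hi]
    · by_cases hi : i ∈ J
      · simp [hi]
      · simpa [hi] using (hf i).2.ne
  rwa [Finset.prod_eq_zero (Finset.mem_univ k) (by simp [hk])] at hlim

/-- The kernel integral depends measurably on `x`, where one factor is supported off `x`. -/
theorem IsCZKernel.aestronglyMeasurable_integral {n m : ℕ} {ω : ℝ → ℝ}
    {K : Rn n → (Fin m → Rn n) → ℂ} (hK : IsCZKernel ω K) {h : (Fin m → Rn n) → ℂ}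
    (hh : AEStronglyMeasurable h) {U V : Set (Rn n)} (hV : MeasurableSet V)
    (hUV : Disjoint U V) (k : Fin m) (hk : ∀ y, y k ∉ V → h y = 0) :
    AEStronglyMeasurable (fun x => ∫ y, K x y * h y) (volume.restrict U) := by
  refine AEStronglyMeasurable.integral_prod_right' (f := fun a => K a.1 a.2 * h a.2) ?_
  have hW : MeasurableSet {a : Rn n × (Fin m → Rn n) | a.2 k ∈ V} := by
    have : Measurable fun a : Rn n × (Fin m → Rn n) => a.2 k := by fun_prop
    exact this hV
  have e : (fun a : Rn n × (Fin m → Rn n) => K a.1 a.2 * h a.2) =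
      {a : Rn n × (Fin m → Rn n) | a.2 k ∈ V}.indicator fun a => K a.1 a.2 * h a.2 := by
    ext a
    by_cases ha : a.2 k ∈ V
    · rw [indicator_of_mem (by exact ha)]
    · rw [indicator_of_notMem (by exact ha), hk _ ha, mul_zero]
  rw [e, aestronglyMeasurable_indicator_iff hW]
  refine AEStronglyMeasurable.mul ?_ ?_
  · have h1 := hK.locallyIntegrable.aestronglyMeasurable
    refine h1.mono_measure ?_
    have e2 : ((volume : Measure (Rn n)).restrict U).prod (volume : Measure (Fin m → Rn n)) =
        (volume : Measure (Rn n × (Fin m → Rn n))).restrict (U ×ˢ univ) := by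
      rw [Measure.volume_eq_prod, ← Measure.prod_restrict, Measure.restrict_univ]
    rw [e2, Measure.restrict_restrict hW]
    have hs : {a : Rn n × (Fin m → Rn n) | a.2 k ∈ V} ∩ U ×ˢ univ ⊆ {a | ∃ i, a.1 ≠ a.2 i} :=
      fun a ha => ⟨k, fun hc => disjoint_left.1 hUV ha.2.1 (hc ▸ ha.1)⟩
    exact Measure.restrict_mono hs le_rfl
  · have : AEStronglyMeasurable (fun a : Rn n × (Fin m → Rn n) => h a.2)
        ((volume.restrict U).prod volume) := hh.comp_snd
    exact this.restrict

section Representation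

variable {n m : ℕ} {ω : ℝ → ℝ} {K : Rn n → (Fin m → Rn n) → ℂ}
  {T : MultilinearMap ℂ (fun _ : Fin m => 𝓢(Rn n, ℂ)) 𝓢'(Rn n, ℂ)}
  {q : Fin m → ℝ} {q₀ : ℝ}
  {S : MultilinearMap ℂ
      (fun i : Fin m => Lp ℂ (ENNReal.ofReal (q i)) (volume : Measure (Rn n)))
      (Rn n →ₘ[volume] ℂ)}

theorem le_dist_const_of_mem {x z : Rn n} {δ : ℝ} {y : Fin m → Rn n} {k : Fin m}
    (hx : x ∈ Metric.ball z (δ / 2)) (hy : y k ∉ Metric.ball z δ) :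
    δ / 2 ≤ dist y (fun _ => x) := by
  have h1 := dist_le_pi_dist y (fun _ => x) k
  have h2 := dist_triangle (y k) x z
  rw [Metric.mem_ball] at hx hy
  linarith

/-- If `h` vanishes when `y_k` is near `z`, then the kernel is bounded on its support, uniformly for
`x` near `z`. -/
theorem KernelBounds.enorm_integral_le {A : ℝ} (hK : KernelBounds A ω K) {x z : Rn n} {δ : ℝ}
    (hδ : 0 < δ) (hx : x ∈ Metric.ball z (δ / 2)) {k : Fin m} {h : (Fin m → Rn n) → ℂ}
    (hk : ∀ y, y k ∈ Metric.ball z δ → h y = 0) :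
    ∫⁻ y, ‖K x y * h y‖ₑ ≤ ENNReal.ofReal (A / (δ / 2) ^ (m * n)) * ∫⁻ y, ‖h y‖ₑ := by
  rw [← lintegral_const_mul' _ _ ENNReal.ofReal_ne_top]
  refine lintegral_mono fun y => ?_
  by_cases hy : y k ∈ Metric.ball z δ
  · simp [hk y hy]
  · rw [enorm_mul, ← ofReal_norm (K x y)]
    gcongr
    exact hK.norm_le (by positivity) (le_dist_const_of_mem hx hy)

/-- The kernel representation for test functions, on a ball on which one of them vanishes. Both sides
are locally integrable there and have the same integrals against `C_c^∞` functions. -/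
theorem IsWeakExtension.ae_eq_integral_of_schwartz (hS : IsWeakExtension T q q₀ S)
    (hK : IsCZKernel ω K) (hTK : HasKernel T K) {φ : Fin m → 𝓢(Rn n, ℂ)}
    (hφ : ∀ i, HasCompactSupport (φ i)) {z : Rn n} {δ : ℝ} (hδ : 0 < δ) {k : Fin m}
    (hk : ∀ y ∈ Metric.ball z δ, φ k y = 0) :
    ∀ᵐ x, x ∈ Metric.ball z (δ / 2) →
      S (fun i => classLp (q i) (φ i)) x = ∫ y, K x y * ∏ i, φ i (y i) := by
  obtain ⟨A, hA⟩ := hK.exists_kernelBounds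
  set U := Metric.ball z (δ / 2) with hU
  have hUo : IsOpen U := Metric.isOpen_ball
  have hUsub : U ⊆ Metric.ball z δ := Metric.ball_subset_ball (by linarith)
  have hφi : ∀ i, Integrable (φ i) := fun i => (φ i).integrable
  have hpi : Integrable fun y : Fin m → Rn n => ∏ i, φ i (y i) := Integrable.fintype_prod hφi
  have hpk : ∀ y : Fin m → Rn n, y k ∈ Metric.ball z δ → ∏ i, φ i (y i) = 0 := fun y hy =>
    Finset.prod_eq_zero (Finset.mem_univ k) (hk _ hy)
  set G : Rn n → ℂ := U.indicator fun x => ∫ y, K x y * ∏ i, φ i (y i) with hG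
  have hGm : AEStronglyMeasurable G := by
    rw [hG, aestronglyMeasurable_indicator_iff hUo.measurableSet]
    refine hK.aestronglyMeasurable_integral hpi.aestronglyMeasurable
      (V := (Metric.ball z δ)ᶜ) Metric.isOpen_ball.measurableSet.compl
      (disjoint_compl_right.mono_left hUsub) k fun y hy => hpk y (by simpa using hy)
  obtain ⟨B, hB⟩ : ∃ B : ℝ, ∀ x, ‖G x‖ ≤ B := by
    refine ⟨(ENNReal.ofReal (A / (δ / 2) ^ (m * n)) *
      ∫⁻ y : Fin m → Rn n, ‖∏ i, φ i (y i)‖ₑ).toReal, fun x => ?_⟩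
    by_cases hx : x ∈ U
    · have h1 := hA.enorm_integral_le hδ hx hpk
      rw [hG, indicator_of_mem hx, ← toReal_enorm]
      refine ENNReal.toReal_mono (ENNReal.mul_ne_top ENNReal.ofReal_ne_top hpi.2.ne) ?_
      exact (enorm_integral_le_lintegral_enorm _).trans h1
    · rw [hG, indicator_of_notMem hx, norm_zero]
      positivity
  have hGloc : LocallyIntegrable G := by
    have : MemLp G ∞ volume := memLp_top_of_bound hGm B (Eventually.of_forall hB)
    exact this.locallyIntegrable le_top
  have hSloc := hS.locallyIntegrable (fun i => classLp (q i) (φ i))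
  have hz := hUo.ae_eq_zero_of_integral_contDiff_smul_eq_zero
    (f := fun x => S (fun i => classLp (q i) (φ i)) x - G x) (μ := volume)
    ((hSloc.sub hGloc).locallyIntegrableOn U) ?_
  · filter_upwards [hz] with x hx hxU
    have := sub_eq_zero.1 (hx hxU)
    rw [this, hG, indicator_of_mem hxU]
  · intro g hg hgc hgU
    have hgc' : HasCompactSupport (Complex.ofRealCLM ∘ g) := hgc.comp_left rfl
    have hgs : ContDiff ℝ ((⊤ : ℕ∞) : WithTop ℕ∞) (Complex.ofRealCLM ∘ g) := by fun_prop
    have hsupp : tsupport (Complex.ofRealCLM ∘ g) ⊆ U :=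
      (closure_mono (Function.support_comp_subset (map_zero _) _)).trans hgU
    have h1 := hS.pairing φ (hgc'.toSchwartzMap hgs)
    have h2 := hTK φ hφ (hgc'.toSchwartzMap hgs) hgc' ?_
    · simp only [smul_sub]
      rw [integral_sub (hSloc.integrable_smul_left_of_hasCompactSupport hg.continuous hgc)
        (hGloc.integrable_smul_left_of_hasCompactSupport hg.continuous hgc), sub_eq_zero]
      rw [h1] at h2
      calc ∫ x, g x • S (fun i => classLp (q i) (φ i)) x
          = ∫ x, S (fun i => (φ i).toLp (ENNReal.ofReal (q i)) volume) x *
              (hgc'.toSchwartzMap hgs) x := by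
            simp_rw [classLp_schwartz]
            refine integral_congr_ae (Eventually.of_forall fun x => ?_)
            change g x • _ = _ * (g x : ℂ)
            rw [Complex.real_smul, mul_comm]
        _ = ∫ x, (∫ y, K x y * ∏ i, φ i (y i)) * (hgc'.toSchwartzMap hgs) x := h2
        _ = ∫ x, g x • G x := by
            refine integral_congr_ae (Eventually.of_forall fun x => ?_)
            change _ * (g x : ℂ) = g x • G x
            by_cases hx : x ∈ U
            · rw [hG, indicator_of_mem hx, Complex.real_smul, mul_comm]
            · have : g x = 0 := image_eq_zero_of_notMem_tsupport fun h => hx (hgU h)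
              simp [this]
    · refine Disjoint.mono_left hsupp ?_
      refine Disjoint.mono_right (iInter_subset _ k) ?_
      refine Disjoint.mono_left hUsub ?_
      refine Disjoint.closure_right (disjoint_left.2 fun x hx hxs => hxs (hk x hx))
        Metric.isOpen_ball

/-- The local form of `IsWeakExtension.ae_eq_integral`: approximation by test functions. -/
theorem IsWeakExtension.ae_eq_integral_local (hS : IsWeakExtension T q q₀ S)
    (hK : IsCZKernel ω K) (hω : IsDiniModulus ω) (hn : 1 ≤ n) (hTK : HasKernel T K)
    {f : Fin m → Rn n → ℂ}
    (hf : ∀ i, MemLp (f i) (ENNReal.ofReal (q i)) volume) {R : ℝ} (hR : 0 < R)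
    (hfR : ∀ i y, y ∉ Metric.closedBall 0 R → f i y = 0) {z : Rn n} {δ : ℝ} (hδ : 0 < δ) {k : Fin m}
    (hk : ∀ y ∈ Metric.ball z (2 * δ), f k y = 0) :
    ∀ᵐ x, x ∈ Metric.ball z (δ / 2) →
      S (fun i => classLp (q i) (f i)) x = ∫ y, K x y * ∏ i, f i (y i) := by
  obtain ⟨A, hA⟩ := hK.exists_kernelBounds
  have hm : 1 ≤ m := by have := k.2; omega
  -- The approximations have to vanish outside a fixed ball, and the `k`-th ones near `z`: they are cut
  -- off by `bR`, and the `k`-th ones also by `1 - bz`.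
  let bR : ContDiffBump (0 : Rn n) := ⟨R, 2 * R, hR, by linarith⟩
  let bz : ContDiffBump z := ⟨δ, 2 * δ, hδ, by linarith⟩
  let χ : Fin m → Rn n → ℝ := fun i x => if i = k then bR x * (1 - bz x) else bR x
  have hχ : ∀ i, ContDiff ℝ ((⊤ : ℕ∞) : WithTop ℕ∞) (χ i) := by
    intro i
    by_cases hi : i = k
    · simp only [χ, hi, if_true]; exact bR.contDiff.mul (contDiff_const.sub bz.contDiff)
    · simp only [χ, hi, if_false]; exact bR.contDiff
  have hχ0 : ∀ i x, bR x = 0 → χ i x = 0 := by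
    intro i x hx
    by_cases hi : i = k <;> simp [χ, hi, hx]
  have hχc : ∀ i, HasCompactSupport (χ i) := by
    intro i
    refine bR.hasCompactSupport.mono fun x hx hbx => hx (hχ0 i x hbx)
  have hχ1 : ∀ i x, ‖χ i x‖ ≤ 1 := by
    intro i x
    have h1 := bR.nonneg (x := x); have h2 := bR.le_one (x := x)
    have h3 := bz.nonneg (x := x); have h4 := bz.le_one (x := x)
    have h5 : 0 ≤ χ i x ∧ χ i x ≤ 1 := by
      by_cases hi : i = k
      · simp only [χ, hi, if_true]
        exact ⟨mul_nonneg h1 (by linarith), mul_le_one₀ h2 (by linarith) (by linarith)⟩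
      · simp only [χ, hi, if_false]; exact ⟨h1, h2⟩
    rw [Real.norm_eq_abs, abs_of_nonneg h5.1]; exact h5.2
  have hfχ : ∀ i x, f i x ≠ 0 → χ i x = 1 := by
    intro i x hx
    have h1 : bR x = 1 := bR.one_of_mem_closedBall (by
      by_contra h; exact hx (hfR i x h))
    by_cases hi : i = k
    · subst hi
      have h2 : bz x = 0 := bz.zero_of_le_dist (by
        by_contra h; exact hx (hk x (by simpa using h)))
      simp [χ, h1, h2]
    · simp [χ, hi, h1]
  have happ : ∀ (N : ℕ) i, ∃ φ : 𝓢(Rn n, ℂ), HasCompactSupport φ ∧ (∀ x, χ i x = 0 → φ x = 0) ∧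
      eLpNorm (⇑φ - f i) (ENNReal.ofReal (q i)) volume ≤ ENNReal.ofReal (1 / ((N : ℝ) + 1)) :=
    fun N i => exists_schwartz_approx (hS.one_lt i).le (hf i) (hχ i) (hχc i) (hχ1 i) (hfχ i)
      (by positivity)
  choose φ hφc hφ0 hφe using happ
  have hone : ∀ i, 1 ≤ ENNReal.ofReal (q i) := fun i => by
    simpa using ENNReal.ofReal_le_ofReal (hS.one_lt i).le
  have hconv : ∀ i, Tendsto (fun N => eLpNorm (⇑(φ N i) - f i) (ENNReal.ofReal (q i)) volume) atTop
      (𝓝 0) := by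
    intro i
    have h0 : Tendsto (fun N : ℕ => ENNReal.ofReal (1 / ((N : ℝ) + 1))) atTop (𝓝 0) := by
      simpa using ENNReal.tendsto_ofReal (tendsto_one_div_add_atTop_nhds_zero_nat (𝕜 := ℝ))
    exact tendsto_of_tendsto_of_tendsto_of_le_of_le tendsto_const_nhds h0 (fun _ => zero_le)
      fun N => hφe N i
  -- along a subsequence the left-hand sides converge almost everywhere
  have hmeas : TendstoInMeasure volume
      (fun N => (S (fun i => classLp (q i) (φ N i)) : Rn n → ℂ)) atTop
      (S (fun i => classLp (q i) (f i))) := by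
    refine hS.tendstoInMeasure (u := fun N i => classLp (q i) (φ N i))
      (v := fun i => classLp (q i) (f i)) fun i => ?_
    refine (hconv i).congr fun N => ?_
    rw [← classLp_sub ((φ N i).memLp _ _) (hf i), eLpNorm_classLp (((φ N i).memLp _ _).sub (hf i))]
  obtain ⟨ns, hns, hae⟩ := hmeas.exists_seq_tendsto_ae
  have hvol : volume (Metric.ball (0 : Rn n) (2 * R)) ≠ ∞ := measure_ball_lt_top.ne
  have hzero : ∀ N i x, x ∉ Metric.ball (0 : Rn n) (2 * R) → φ N i x = 0 := fun N i x hx =>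
    hφ0 N i x (hχ0 i x (bR.zero_of_le_dist (by simpa using hx)))
  have hzero' : ∀ i x, x ∉ Metric.ball (0 : Rn n) (2 * R) → f i x = 0 := fun i x hx =>
    hfR i x fun h => hx (Metric.closedBall_subset_ball (by linarith) h)
  have hfi : ∀ i, Integrable (f i) := by
    intro i
    have h1 : IntegrableOn (f i) (Metric.closedBall 0 R) :=
      ((hf i).locallyIntegrable (hone i)).integrableOn_isCompact (isCompact_closedBall _ _)
    exact (integrableOn_iff_integrable_of_support_subset fun x hx => by
      by_contra h; exact hx (hfR i x h)).1 h1
  -- on a bounded set convergence in `L^{q_i}` implies convergence in `L¹`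
  have hL1 : ∀ i, Tendsto (fun N => ∫⁻ y, ‖φ N i y - f i y‖ₑ) atTop (𝓝 0) := by
    intro i
    set c := volume (Metric.ball (0 : Rn n) (2 * R)) ^
      (1 / (1 : ℝ≥0∞).toReal - 1 / (ENNReal.ofReal (q i)).toReal)
    have hc : c ≠ ∞ := by
      refine ENNReal.rpow_ne_top_of_nonneg ?_ hvol
      have := hS.one_lt i
      rw [ENNReal.toReal_one, ENNReal.toReal_ofReal (by linarith), sub_nonneg]
      exact one_div_le_one_div_of_le one_pos this.le
    have hle : ∀ N, ∫⁻ y, ‖φ N i y - f i y‖ₑ ≤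
        eLpNorm (⇑(φ N i) - f i) (ENNReal.ofReal (q i)) volume * c := by
      intro N
      have h1 := eLpNorm_le_eLpNorm_mul_rpow_measure_univ (f := ⇑(φ N i) - f i) (hone i)
        ((φ N i).continuous.aestronglyMeasurable.sub (hf i).aestronglyMeasurable.restrict)
        (μ := volume.restrict (Metric.ball (0 : Rn n) (2 * R)))
      rw [Measure.restrict_apply_univ, eLpNorm_one_eq_lintegral_enorm] at h1
      calc ∫⁻ y, ‖φ N i y - f i y‖ₑ =
            ∫⁻ y in Metric.ball (0 : Rn n) (2 * R), ‖(⇑(φ N i) - f i) y‖ₑ := by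
            rw [← lintegral_indicator Metric.isOpen_ball.measurableSet]
            refine lintegral_congr fun y => ?_
            by_cases hy : y ∈ Metric.ball (0 : Rn n) (2 * R)
            · rw [indicator_of_mem hy]; rfl
            · rw [indicator_of_notMem hy, hzero N i y hy, hzero' i y hy]; simp
        _ ≤ _ := h1
        _ ≤ _ := mul_le_mul_left (eLpNorm_mono_measure _ Measure.restrict_le_self) _
    have h2 : Tendsto (fun N => eLpNorm (⇑(φ N i) - f i) (ENNReal.ofReal (q i)) volume * c) atTop
        (𝓝 0) := by
      simpa using ENNReal.Tendsto.mul_const (hconv i) (Or.inr hc)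
    exact tendsto_of_tendsto_of_tendsto_of_le_of_le tendsto_const_nhds h2 (fun _ => zero_le) hle
  have hprodL1 := tendsto_lintegral_prod_sub (F := fun N i => φ N i)
    (fun N i => (φ N i).integrable) hfi hL1
  have hφk : ∀ N, ∀ y ∈ Metric.ball z δ, φ N k y = 0 := by
    intro N y hy
    refine hφ0 N k y ?_
    have : bz y = 1 := bz.one_of_mem_closedBall (Metric.ball_subset_closedBall hy)
    simp [χ, this]
  have hfk : ∀ y ∈ Metric.ball z δ, f k y = 0 := fun y hy =>
    hk y (Metric.ball_subset_ball (by linarith) hy)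
  have hrep : ∀ᵐ x, ∀ N, x ∈ Metric.ball z (δ / 2) →
      S (fun i => classLp (q i) (φ N i)) x = ∫ y, K x y * ∏ i, φ N i (y i) :=
    ae_all_iff.2 fun N => hS.ae_eq_integral_of_schwartz hK hTK (hφc N) hδ (hφk N)
  filter_upwards [hae, hrep] with x hx1 hx2 hxU
  refine tendsto_nhds_unique hx1 ?_
  have hint : ∀ h : (Fin m → Rn n) → ℂ, Integrable h → (∀ y, y k ∈ Metric.ball z δ → h y = 0) →
      Integrable fun y => K x y * h y := by
    intro h hh hz
    refine ⟨(hK.aestronglyMeasurable hn hm hω x).mul hh.aestronglyMeasurable, ?_⟩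
    exact (hA.enorm_integral_le hδ hxU hz).trans_lt
      (ENNReal.mul_lt_top ENNReal.ofReal_lt_top hh.2)
  have hpf : Integrable fun y : Fin m → Rn n => ∏ i, f i (y i) := Integrable.fintype_prod hfi
  have hpφ : ∀ N, Integrable fun y : Fin m → Rn n => ∏ i, φ N i (y i) := fun N =>
    Integrable.fintype_prod fun i => (φ N i).integrable
  have hpf0 : ∀ y : Fin m → Rn n, y k ∈ Metric.ball z δ → ∏ i, f i (y i) = 0 := fun y hy =>
    Finset.prod_eq_zero (Finset.mem_univ k) (hfk _ hy)
  have hpφ0 : ∀ N, ∀ y : Fin m → Rn n, y k ∈ Metric.ball z δ → ∏ i, φ N i (y i) = 0 :=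
    fun N y hy => Finset.prod_eq_zero (Finset.mem_univ k) (hφk N _ hy)
  have hlim : Tendsto (fun N => ∫ y, K x y * ∏ i, φ N i (y i)) atTop
      (𝓝 (∫ y, K x y * ∏ i, f i (y i))) := by
    refine tendsto_integral_of_L1 _ (hint _ hpf hpf0).aestronglyMeasurable
      (Eventually.of_forall fun N => hint _ (hpφ N) (hpφ0 N)) ?_
    have h3 : Tendsto (fun N => ENNReal.ofReal (A / (δ / 2) ^ (m * n)) *
        ∫⁻ y : Fin m → Rn n, ‖∏ i, φ N i (y i) - ∏ i, f i (y i)‖ₑ) atTop (𝓝 0) := by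
      simpa using ENNReal.Tendsto.const_mul hprodL1 (Or.inr ENNReal.ofReal_ne_top)
    refine tendsto_of_tendsto_of_tendsto_of_le_of_le tendsto_const_nhds h3 (fun _ => zero_le)
      fun N => ?_
    have := hA.enorm_integral_le hδ hxU (k := k)
      (h := fun y => ∏ i, φ N i (y i) - ∏ i, f i (y i))
      (fun y hy => by rw [hpf0 y hy, hpφ0 N y hy, sub_zero])
    simpa only [mul_sub] using this
  exact (hlim.comp hns.tendsto_atTop).congr fun N => (hx2 _ hxU).symm

/-- If one of the functions vanishes on an open set, then on that set the operator is given by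
its kernel. -/
theorem IsWeakExtension.ae_eq_integral (hS : IsWeakExtension T q q₀ S)
    (hK : IsCZKernel ω K) (hω : IsDiniModulus ω) (hn : 1 ≤ n) (hTK : HasKernel T K)
    {f : Fin m → Rn n → ℂ}
    (hf : ∀ i, MemLp (f i) (ENNReal.ofReal (q i)) volume)
    (hfb : ∀ i, ∃ R, ∀ y, y ∉ Metric.closedBall 0 R → f i y = 0)
    {U : Set (Rn n)} (hU : IsOpen U) {k : Fin m} (hk : ∀ y ∈ U, f k y = 0) :
    ∀ᵐ x, x ∈ U → S (fun i => classLp (q i) (f i)) x = ∫ y, K x y * ∏ i, f i (y i) := by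
  choose R hR using hfb
  have : Nonempty (Fin m) := ⟨k⟩
  obtain ⟨i₀, hi₀⟩ := Finite.exists_max R
  have hR' : ∀ i y, y ∉ Metric.closedBall 0 (max (R i₀) 1) → f i y = 0 := fun i y hy =>
    hR i y fun h => hy (Metric.closedBall_subset_closedBall ((hi₀ i).trans (le_max_left _ _)) h)
  change volume {x | ¬ (x ∈ U → S (fun i => classLp (q i) (f i)) x = ∫ y, K x y * ∏ i, f i (y i))}
    = 0
  refine measure_null_of_locally_null _ fun z hz => ?_
  have hzU : z ∈ U := by
    by_contra h; exact hz fun h' => absurd h' h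
  obtain ⟨ε, hε, hsub⟩ := Metric.isOpen_iff.1 hU z hzU
  have hloc := hS.ae_eq_integral_local hK hω hn hTK hf (lt_max_of_lt_right one_pos) hR'
    (z := z) (δ := ε / 2) (by positivity) (k := k)
    (fun y hy => hk y (hsub (by rwa [mul_div_cancel₀ _ (two_ne_zero' ℝ)] at hy)))
  refine ⟨_, inter_mem_nhdsWithin _ (Metric.ball_mem_nhds z (show 0 < ε / 2 / 2 by positivity)), ?_⟩
  refine measure_mono_null (fun x hx => ?_) hloc
  exact fun h => hx.1 fun _ => h hx.2

end Representation


/-! ### Calderón-Zygmund decomposition -/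

/-- Bounded measurable functions with bounded support. -/
structure IsBddFun {n : ℕ} (f : Rn n → ℂ) : Prop where
  measurable : Measurable f
  bdd : ∃ B : ℝ, ∀ x, ‖f x‖ ≤ B
  supp : ∃ R : ℝ, ∀ x, x ∉ Metric.closedBall 0 R → f x = 0

namespace IsBddFun

variable {n : ℕ} {f g : Rn n → ℂ}

theorem add (hf : IsBddFun f) (hg : IsBddFun g) : IsBddFun (f + g) := by
  obtain ⟨hm, ⟨B, hB⟩, R, hR⟩ := hf
  obtain ⟨hm', ⟨B', hB'⟩, R', hR'⟩ := hg
  refine ⟨hm.add hm', ⟨B + B', fun x => (norm_add_le _ _).trans (add_le_add (hB x) (hB' x))⟩,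
    max R R', fun x hx => ?_⟩
  rw [Pi.add_apply, hR x fun h => hx (Metric.closedBall_subset_closedBall (le_max_left _ _) h),
    hR' x fun h => hx (Metric.closedBall_subset_closedBall (le_max_right _ _) h), add_zero]

theorem mul_of_bdd (hf : IsBddFun f) {w : Rn n → ℂ} (hw : Measurable w) (hw1 : ∀ x, ‖w x‖ ≤ 1) :
    IsBddFun (fun x => f x * w x) := by
  obtain ⟨hm, ⟨B, hB⟩, R, hR⟩ := hf
  refine ⟨hm.mul hw, ⟨B, fun x => ?_⟩, R, fun x hx => by simp [hR x hx]⟩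
  rw [norm_mul]
  exact (mul_le_of_le_one_right (norm_nonneg _) (hw1 x)).trans (hB x)

theorem indicator (hf : IsBddFun f) {s : Set (Rn n)} (hs : MeasurableSet s) :
    IsBddFun (s.indicator f) := by
  obtain ⟨hm, ⟨B, hB⟩, R, hR⟩ := hf
  refine ⟨hm.indicator hs, ⟨B, fun x => (norm_indicator_le_norm_self _ _).trans (hB x)⟩,
    R, fun x hx => ?_⟩
  by_cases h : x ∈ s <;> simp [h, hR x hx]

theorem neg (hf : IsBddFun f) : IsBddFun (-f) := by
  obtain ⟨hm, ⟨B, hB⟩, R, hR⟩ := hf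
  exact ⟨hm.neg, ⟨B, fun x => by simpa using hB x⟩, R, fun x hx => by simp [hR x hx]⟩

theorem const_smul (hf : IsBddFun f) (c : ℂ) : IsBddFun (c • f) := by
  obtain ⟨hm, ⟨B, hB⟩, R, hR⟩ := hf
  refine ⟨hm.const_smul c, ⟨‖c‖ * B, fun x => ?_⟩, R, fun x hx => by simp [hR x hx]⟩
  rw [Pi.smul_apply, norm_smul]
  gcongr
  exact hB x

theorem sub (hf : IsBddFun f) (hg : IsBddFun g) : IsBddFun (f - g) := by
  rw [sub_eq_add_neg]; exact hf.add hg.neg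

theorem zero : IsBddFun (0 : Rn n → ℂ) :=
  ⟨measurable_const, ⟨0, by simp⟩, 0, by simp⟩

theorem sum {ι : Type*} (F : Finset ι) {b : ι → Rn n → ℂ} (hb : ∀ i ∈ F, IsBddFun (b i)) :
    IsBddFun (∑ i ∈ F, b i) :=
  Finset.sum_induction _ _ (fun _ _ => add) zero hb

theorem const_indicator_closedBall (κ : ℂ) (c : Rn n) (r : ℝ) :
    IsBddFun ((Metric.closedBall c r).indicator fun _ => κ) := by
  refine ⟨measurable_const.indicator Metric.isClosed_closedBall.measurableSet,
    ⟨‖κ‖, fun x => norm_indicator_le_norm_self _ _⟩, ‖c‖ + r, fun x hx => ?_⟩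
  refine indicator_of_notMem (fun h => hx ?_) _
  rw [mem_closedBall_zero_iff]
  rw [Metric.mem_closedBall, dist_eq_norm] at h
  calc ‖x‖ = ‖c + (x - c)‖ := by simp
    _ ≤ ‖c‖ + ‖x - c‖ := norm_add_le _ _
    _ ≤ _ := by gcongr

theorem memLp (hf : IsBddFun f) (q : ℝ≥0∞) : MemLp f q volume := by
  obtain ⟨hm, ⟨B, hB⟩, R, hR⟩ := hf
  have e : f = (Metric.closedBall 0 R).indicator f := by
    ext x
    by_cases hx : x ∈ Metric.closedBall 0 R
    · rw [indicator_of_mem hx]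
    · rw [indicator_of_notMem hx, hR x hx]
  rw [e, memLp_indicator_iff_restrict Metric.isClosed_closedBall.measurableSet]
  have : IsFiniteMeasure (volume.restrict (Metric.closedBall (0 : Rn n) R)) :=
    ⟨by simpa using measure_closedBall_lt_top⟩
  exact MemLp.of_bound hm.aestronglyMeasurable B (Eventually.of_forall hB)

theorem integrable (hf : IsBddFun f) : Integrable f :=
  memLp_one_iff_integrable.1 (hf.memLp 1)

theorem enorm_aemeasurable (hf : IsBddFun f) : AEMeasurable fun y => ‖f y‖ₑ :=
  hf.measurable.enorm.aemeasurable

end IsBddFun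

/-- The Calderón-Zygmund decomposition at height `a` of a function whose `L¹` norm is at most `a μ`.
Only finitely many bad parts are split off, so that the rest of the bad set has to be absorbed by
the good part, whose `L^s` norm it changes by as little as one likes. Each bad part is cut out by
a member of a partition of unity on the union of the enlarged stopping balls, and its mean is
corrected on the stopping ball itself. -/
theorem exists_calderonZygmund_decomposition {n : ℕ} (hn : 1 ≤ n) {s : ℝ} (hs : 1 < s)
    {f : Rn n → ℂ} (hf : IsBddFun f) {a μ : ℝ} (ha : 0 < a) (hμ : 0 < μ)
    (hfa : ∫⁻ y, ‖f y‖ₑ ≤ ENNReal.ofReal (a * μ)) :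
    ∃ (u : Set (Rn n)) (Ω : Set (Rn n)) (F : Finset u) (t : u → ℝ) (b : u → Rn n → ℂ)
      (g : Rn n → ℂ),
      MeasurableSet Ω ∧ volume Ω ≤ ENNReal.ofReal (20 ^ n * μ) ∧ IsBddFun g ∧ (∀ c ∈ F, IsBddFun (b c)) ∧
      f = ∑ c ∈ F, b c + g ∧
      (∀ c ∈ F, 0 < t c ∧ (∀ y, y ∉ Metric.closedBall (c : Rn n) (t c) → b c y = 0) ∧
        ∫ y, b c y = 0 ∧ Metric.ball (c : Rn n) (4 * t c) ⊆ Ω) ∧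
      ∑ c ∈ F, ∫⁻ y, ‖b c y‖ₑ ≤ ENNReal.ofReal (2 * a * μ) ∧
      ∫⁻ y, ‖g y‖ₑ ^ s ≤ ENNReal.ofReal ((2 + (5 ^ n) ^ s) * a ^ s * μ) ∧
      ∀ x, x ∉ Ω → ∀ R, 0 < R →
        ∫⁻ y in Metric.ball x R, ‖g y‖ₑ ≤ ENNReal.ofReal ((1 + 5 ^ n) * unitVol n * a * R ^ n) ∧
        ∫⁻ y in Metric.ball x R, ‖(∑ c ∈ F, b c) y‖ₑ ≤
          ENNReal.ofReal ((1 + 5 ^ n) * unitVol n * a * R ^ n) := by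
  classical
  have hs0 : 0 < s := by linarith
  have hv := unitVol_pos n
  have hfm : Measurable fun y => ‖f y‖ₑ := hf.measurable.enorm
  have hfin : ∫⁻ y, ‖f y‖ₑ ≠ ∞ := ne_top_of_le_ne_top ENNReal.ofReal_ne_top hfa
  obtain ⟨u, r, hu, hr, hlow, hup, hdisj, hcov⟩ := exists_stopping_balls hn hfin ha
  have hcu := hu.to_subtype
  have hrp : ∀ c : u, 0 < r c := fun c => hr c c.2
  have hsumB : ∑' c : u, volume (Metric.closedBall (c : Rn n) (r c)) ≤ ENNReal.ofReal μ := by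
    have h1 := (tsum_volume_le_of_disjoint hu hlow hdisj).trans hfa
    rw [ENNReal.ofReal_mul ha.le] at h1
    exact (ENNReal.mul_le_mul_iff_right (by simpa using ha) ENNReal.ofReal_ne_top).1 h1
  set A : u → Set (Rn n) := fun c => Metric.closedBall (c : Rn n) (5 * r c) with hA
  set B : u → Set (Rn n) := fun c => Metric.closedBall (c : Rn n) (r c) with hB
  have hAm : ∀ c, MeasurableSet (A c) := fun c => Metric.isClosed_closedBall.measurableSet
  have hBm : ∀ c, MeasurableSet (B c) := fun c => Metric.isClosed_closedBall.measurableSet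
  have hBA : ∀ c, B c ⊆ A c := fun c =>
    Metric.closedBall_subset_closedBall (by linarith [hrp c])
  have hBv : ∀ c, volume (B c) = ENNReal.ofReal (unitVol n * r c ^ n) := fun c =>
    volume_closedBall _ (hrp c).le
  have hAv : ∀ c, volume (A c) = ENNReal.ofReal (5 ^ n) * volume (B c) := fun c => by
    rw [hBv, volume_closedBall _ (by linarith [hrp c]), ← ENNReal.ofReal_mul (by positivity)]
    congr 1; ring
  set Ω : Set (Rn n) := ⋃ c : u, Metric.ball (c : Rn n) (4 * (5 * r c)) with hΩ
  have hAΩ : ∀ c, A c ⊆ Ω := fun c y hy => mem_iUnion.2 ⟨c,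
    Metric.closedBall_subset_ball (by linarith [hrp c]) hy⟩
  have hhigh : highAvg (fun y => ‖f y‖ₑ) a ⊆ ⋃ c : u, A c := by
    rw [biUnion_eq_iUnion] at hcov; exact hcov
  have hΩv : volume Ω ≤ ENNReal.ofReal (20 ^ n * μ) := by
    calc volume Ω ≤ ∑' c : u, volume (Metric.ball (c : Rn n) (4 * (5 * r c))) :=
          measure_iUnion_le _
      _ ≤ ∑' c : u, volume (Metric.closedBall (c : Rn n) (20 * r c)) := by
          refine ENNReal.tsum_le_tsum fun c => measure_mono ?_
          refine Metric.ball_subset_closedBall.trans (Metric.closedBall_subset_closedBall ?_)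
          linarith
      _ = ENNReal.ofReal (20 ^ n) * ∑' c : u, volume (Metric.closedBall (c : Rn n) (r c)) :=
          tsum_volume_enlarged hr (by norm_num)
      _ ≤ ENNReal.ofReal (20 ^ n) * ENNReal.ofReal μ := by gcongr
      _ = _ := (ENNReal.ofReal_mul (by positivity)).symm
  -- the finite set of bad parts leaves out little mass of `‖f‖ ^ s`
  obtain ⟨F, hF⟩ : ∃ F : Finset u,
      ∫⁻ y in (⋃ c : u, A c) \ ⋃ c ∈ F, A c, ‖f y‖ₑ ^ s ≤ ENNReal.ofReal (a ^ s * μ) := by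
    obtain ⟨M, hM⟩ := hf.bdd
    have hM0 : 0 ≤ M := (norm_nonneg _).trans (hM 0)
    have hsum : ∑' c : u, volume (A c) ≠ ∞ := by
      simp_rw [hAv]
      rw [ENNReal.tsum_mul_left]
      exact ENNReal.mul_ne_top ENNReal.ofReal_ne_top (ne_top_of_le_ne_top ENNReal.ofReal_ne_top hsumB)
    have h1 := ENNReal.Tendsto.const_mul (ENNReal.tendsto_tsum_compl_atTop_zero hsum)
      (Or.inr (ENNReal.ofReal_ne_top (r := M ^ s)))
    rw [mul_zero] at h1
    obtain ⟨F, hF⟩ := ((ENNReal.tendsto_nhds_zero.1 h1) (ENNReal.ofReal (a ^ s * μ))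
      (by simpa using by positivity)).exists
    refine ⟨F, le_trans ?_ hF⟩
    calc ∫⁻ y in (⋃ c : u, A c) \ ⋃ c ∈ F, A c, ‖f y‖ₑ ^ s
        ≤ ∫⁻ y in (⋃ c : u, A c) \ ⋃ c ∈ F, A c, ENNReal.ofReal (M ^ s) := by
          refine lintegral_mono fun y => ?_
          rw [← ofReal_norm, ENNReal.ofReal_rpow_of_nonneg (norm_nonneg _) hs0.le]
          exact ENNReal.ofReal_le_ofReal (Real.rpow_le_rpow (norm_nonneg _) (hM y) hs0.le)
      _ = ENNReal.ofReal (M ^ s) * volume ((⋃ c : u, A c) \ ⋃ c ∈ F, A c) := setLIntegral_const _ _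
      _ ≤ _ := by
          gcongr
          refine (measure_mono (t := ⋃ c : {c : u // c ∉ F}, A c) ?_).trans (measure_iUnion_le _)
          rintro y ⟨hy1, hy2⟩
          obtain ⟨c, hc⟩ := mem_iUnion.1 hy1
          exact mem_iUnion.2 ⟨⟨c, fun hcF => hy2 (mem_iUnion₂.2 ⟨c, hcF, hc⟩)⟩, hc⟩
  -- a partition of unity on the union of the enlarged balls
  set N : Rn n → ℝ := fun y => ∑ c ∈ F, (A c).indicator (fun _ => (1 : ℝ)) y with hN
  set w : u → Rn n → ℝ := fun c y => (A c).indicator (fun _ => (1 : ℝ)) y / N y with hw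
  have hind0 : ∀ c y, 0 ≤ (A c).indicator (fun _ => (1 : ℝ)) y := fun c y =>
    indicator_nonneg (fun _ _ => zero_le_one) _
  have hN0 : ∀ y, 0 ≤ N y := fun y => Finset.sum_nonneg fun c _ => hind0 c y
  have hw0 : ∀ c y, 0 ≤ w c y := fun c y => div_nonneg (hind0 c y) (hN0 y)
  have hNm : Measurable N := Finset.measurable_fun_sum _ fun c _ =>
    measurable_const.indicator (hAm c)
  have hwm : ∀ c, Measurable (w c) := fun c => (measurable_const.indicator (hAm c)).div hNm
  have hwA : ∀ c y, y ∉ A c → w c y = 0 := fun c y hy => by simp [hw, hy]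
  have hNpos : ∀ y, y ∈ ⋃ c ∈ F, A c → 0 < N y := by
    intro y hy
    obtain ⟨c, hc, hyc⟩ := mem_iUnion₂.1 hy
    refine Finset.sum_pos' (fun c _ => hind0 c y) ⟨c, hc, ?_⟩
    simp [hyc]
  have hwsum : ∀ y, ∑ c ∈ F, w c y = if y ∈ ⋃ c ∈ F, A c then 1 else 0 := by
    intro y
    split_ifs with hy
    · simp only [hw]
      rw [← Finset.sum_div]
      exact div_self (hNpos y hy).ne'
    · refine Finset.sum_eq_zero fun c hc => hwA c y fun h => hy (mem_iUnion₂.2 ⟨c, hc, h⟩)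
  have hwsum1 : ∀ y, ∑ c ∈ F, w c y ≤ 1 := fun y => by rw [hwsum]; split_ifs <;> norm_num
  have hw1 : ∀ c ∈ F, ∀ y, w c y ≤ 1 := fun c hc y =>
    (Finset.single_le_sum (fun d _ => hw0 d y) hc).trans (hwsum1 y)
  have hwn : ∀ c y, ‖((w c y : ℝ) : ℂ)‖ = w c y := fun c y => by
    rw [Complex.norm_real, Real.norm_of_nonneg (hw0 c y)]
  -- the mean of the part cut out over the enlarged ball is put on the small ball
  set κ : u → ℂ := fun c => (∫ y, f y * w c y) / (volume (B c)).toReal with hκ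
  set b : u → Rn n → ℂ := fun c => (fun y => f y * w c y) - (B c).indicator fun _ => κ c with hb
  have hBr : ∀ c, (volume (B c)).toReal = unitVol n * r c ^ n := fun c => by
    have := hrp c
    rw [hBv, ENNReal.toReal_ofReal (by positivity)]
  have hBpos : ∀ c, 0 < (volume (B c)).toReal := fun c => by
    have := hrp c
    rw [hBr]; positivity
  have hfw : ∀ c ∈ F, IsBddFun fun y => f y * w c y := fun c hc =>
    hf.mul_of_bdd (Complex.measurable_ofReal.comp (hwm c)) fun y => by rw [hwn]; exact hw1 c hc y
  have hbt : ∀ c ∈ F, IsBddFun (b c) := fun c hc =>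
    (hfw c hc).sub (IsBddFun.const_indicator_closedBall _ _ _)
  have hfwA : ∀ c ∈ F, ∫⁻ y, ‖f y * w c y‖ₑ ≤ ENNReal.ofReal (5 ^ n * a) * volume (B c) := by
    intro c hc
    calc ∫⁻ y, ‖f y * w c y‖ₑ ≤ ∫⁻ y in A c, ‖f y‖ₑ := by
          rw [← lintegral_indicator (hAm c)]
          refine lintegral_mono fun y => ?_
          by_cases hy : y ∈ A c
          · rw [indicator_of_mem hy, ← ofReal_norm, ← ofReal_norm, norm_mul, hwn]
            exact ENNReal.ofReal_le_ofReal
              (mul_le_of_le_one_right (norm_nonneg _) (hw1 c hc y))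
          · rw [hwA c y hy]; simp
      _ ≤ ENNReal.ofReal a * volume (A c) := hup c c.2 _ (by linarith [hrp c])
      _ = _ := by
          rw [hAv, ← mul_assoc, ← ENNReal.ofReal_mul ha.le, mul_comm a]
  have hκmul : ∀ c, ‖κ c‖ₑ * volume (B c) ≤ ∫⁻ y, ‖f y * w c y‖ₑ := by
    intro c
    have h1 : ‖κ c‖ₑ * volume (B c) = ‖∫ y, f y * w c y‖ₑ := by
      have hne : volume (B c) ≠ ∞ := by rw [hBv]; exact ENNReal.ofReal_ne_top
      rw [← ENNReal.ofReal_toReal hne, ← ofReal_norm (κ c), ← ofReal_norm (∫ y, f y * w c y),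
        ← ENNReal.ofReal_mul (norm_nonneg _)]
      congr 1
      rw [hκ, norm_div, Complex.norm_real, Real.norm_of_nonneg (hBpos c).le,
        div_mul_cancel₀ _ (hBpos c).ne']
    rw [h1]
    exact enorm_integral_le_lintegral_enorm _
  have hκle : ∀ c ∈ F, ‖κ c‖ ≤ 5 ^ n * a := by
    intro c hc
    have h1 := (hκmul c).trans (hfwA c hc)
    have h0 : volume (B c) ≠ 0 := fun h => by have := hBpos c; simp [h] at this
    have hne : volume (B c) ≠ ∞ := by rw [hBv]; exact ENNReal.ofReal_ne_top
    have h2 := (ENNReal.mul_le_mul_iff_left h0 hne).1 h1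
    rw [← ofReal_norm, ENNReal.ofReal_le_ofReal_iff (by positivity)] at h2
    exact h2
  -- the corrections live on disjoint balls
  have hκsum : ∀ y, ‖∑ c ∈ F, (B c).indicator (fun _ => κ c) y‖ ≤
      (⋃ c ∈ F, B c).indicator (fun _ => 5 ^ n * a) y := by
    intro y
    by_cases hy : y ∈ ⋃ c ∈ F, B c
    · rw [indicator_of_mem hy]
      obtain ⟨c, hc, hyc⟩ := mem_iUnion₂.1 hy
      rw [Finset.sum_eq_single_of_mem c hc, indicator_of_mem hyc]
      · exact hκle c hc
      · intro d hd hdc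
        refine indicator_of_notMem (fun hyd => ?_) _
        exact disjoint_left.1 (hdisj d.2 c.2 fun h => hdc (Subtype.ext h)) hyd hyc
    · rw [indicator_of_notMem hy, Finset.sum_eq_zero, norm_zero]
      intro c hc
      exact indicator_of_notMem (fun h => hy (mem_iUnion₂.2 ⟨c, hc, h⟩)) _
  have hbsum : ∀ y, (∑ c ∈ F, b c) y = f y * (∑ c ∈ F, w c y : ℝ) -
      ∑ c ∈ F, (B c).indicator (fun _ => κ c) y := by
    intro y
    rw [Finset.sum_apply]
    simp only [hb, Pi.sub_apply]
    rw [Finset.sum_sub_distrib, ← Finset.mul_sum, Complex.ofReal_sum]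
  set g : Rn n → ℂ := f - ∑ c ∈ F, b c with hg
  have hgy : ∀ y, g y = f y * (1 - ∑ c ∈ F, w c y : ℝ) +
      ∑ c ∈ F, (B c).indicator (fun _ => κ c) y := by
    intro y
    rw [hg, Pi.sub_apply, hbsum, Complex.ofReal_sub, Complex.ofReal_one]
    ring
  have hκsum' : ∀ y, ‖∑ c ∈ F, (B c).indicator (fun _ => κ c) y‖ ≤ 5 ^ n * a := fun y =>
    (hκsum y).trans (indicator_le_self' (fun _ _ => by positivity) y)
  have hwsum0 : ∀ y, 0 ≤ ∑ c ∈ F, w c y := fun y => Finset.sum_nonneg fun c _ => hw0 c y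
  have hgle : ∀ y, ‖g y‖ ≤ ‖f y‖ + 5 ^ n * a := by
    intro y
    rw [hgy]
    refine (norm_add_le _ _).trans (add_le_add ?_ (hκsum' y))
    rw [norm_mul, Complex.norm_real, Real.norm_of_nonneg (by linarith [hwsum1 y])]
    exact mul_le_of_le_one_right (norm_nonneg _) (by linarith [hwsum0 y])
  have hble : ∀ y, ‖(∑ c ∈ F, b c) y‖ ≤ ‖f y‖ + 5 ^ n * a := by
    intro y
    rw [hbsum]
    refine (norm_sub_le _ _).trans (add_le_add ?_ (hκsum' y))
    rw [norm_mul, Complex.norm_real, Real.norm_of_nonneg (hwsum0 y)]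
    exact mul_le_of_le_one_right (norm_nonneg _) (hwsum1 y)
  have havg : ∀ h : Rn n → ℂ, (∀ y, ‖h y‖ ≤ ‖f y‖ + 5 ^ n * a) → ∀ x, x ∉ Ω → ∀ R, 0 < R →
      ∫⁻ y in Metric.ball x R, ‖h y‖ₑ ≤
        ENNReal.ofReal ((1 + 5 ^ n) * unitVol n * a * R ^ n) := by
    intro h hh x hx R hR
    have hxh : x ∉ highAvg (fun y => ‖f y‖ₑ) a := fun h =>
      hx (by obtain ⟨c, hc⟩ := mem_iUnion.1 (hhigh h); exact hAΩ c hc)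
    calc ∫⁻ y in Metric.ball x R, ‖h y‖ₑ
        ≤ ∫⁻ y in Metric.closedBall x R, (‖f y‖ₑ + ENNReal.ofReal (5 ^ n * a)) := by
          refine (lintegral_mono_set Metric.ball_subset_closedBall).trans
            (lintegral_mono fun y => ?_)
          rw [← ofReal_norm, ← ofReal_norm, ← ENNReal.ofReal_add (norm_nonneg _) (by positivity)]
          exact ENNReal.ofReal_le_ofReal (hh y)
      _ = (∫⁻ y in Metric.closedBall x R, ‖f y‖ₑ) +
            ENNReal.ofReal (5 ^ n * a) * volume (Metric.closedBall x R) := by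
          rw [lintegral_add_right _ measurable_const, setLIntegral_const]
      _ ≤ ENNReal.ofReal a * volume (Metric.closedBall x R) +
            ENNReal.ofReal (5 ^ n * a) * volume (Metric.closedBall x R) := by
          gcongr
          exact setLIntegral_closedBall_le_of_notMem_highAvg hxh hR
      _ = _ := by
          rw [← add_mul, ← ENNReal.ofReal_add ha.le (by positivity), volume_closedBall _ hR.le,
            ← ENNReal.ofReal_mul (by positivity)]
          congr 1; ring
  have hgt : IsBddFun g := hf.sub (IsBddFun.sum F hbt)
  refine ⟨u, Ω, F, fun c => 5 * r c, b, g, MeasurableSet.iUnion fun c => Metric.isOpen_ball.measurableSet,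
    hΩv, hgt, hbt, by rw [hg]; abel, fun c hc => ⟨by linarith [hrp c], fun y hy => ?_, ?_, ?_⟩, ?_, ?_,
    fun x hx R hR => ⟨havg g hgle x hx R hR, havg _ hble x hx R hR⟩⟩
  · simp only [hb, Pi.sub_apply]
    rw [hwA c y hy, indicator_of_notMem fun h => hy (hBA c h)]
    simp
  · simp only [hb, Pi.sub_apply]
    rw [integral_sub (hfw c hc).integrable
      (IsBddFun.const_indicator_closedBall _ _ _).integrable, integral_indicator (hBm c),
      setIntegral_const, sub_eq_zero, Complex.real_smul, hκ, Measure.real,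
      mul_div_cancel₀ _ (by exact_mod_cast (hBpos c).ne')]
  · exact fun y hy => mem_iUnion.2 ⟨c, hy⟩
  · calc ∑ c ∈ F, ∫⁻ y, ‖b c y‖ₑ ≤ ∑ c ∈ F, 2 * ∫⁻ y, ‖f y * w c y‖ₑ := by
          refine Finset.sum_le_sum fun c hc => ?_
          calc ∫⁻ y, ‖b c y‖ₑ
              ≤ ∫⁻ y, (‖f y * w c y‖ₑ + (B c).indicator (fun _ => ‖κ c‖ₑ) y) := by
                refine lintegral_mono fun y => ?_
                refine enorm_sub_le.trans (add_le_add le_rfl (le_of_eq ?_))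
                by_cases hy : y ∈ B c <;> simp [hy]
            _ = (∫⁻ y, ‖f y * w c y‖ₑ) + ‖κ c‖ₑ * volume (B c) := by
                rw [lintegral_add_right _ (measurable_const.indicator (hBm c)),
                  lintegral_indicator (hBm c), setLIntegral_const]
            _ ≤ _ := by rw [two_mul]; gcongr; exact hκmul c
      _ = 2 * ∫⁻ y, ∑ c ∈ F, ‖f y * w c y‖ₑ := by
          rw [← Finset.mul_sum, lintegral_finsetSum' _ fun c hc => (hfw c hc).enorm_aemeasurable]
      _ ≤ 2 * ∫⁻ y, ‖f y‖ₑ := by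
          gcongr with y
          calc ∑ c ∈ F, ‖f y * w c y‖ₑ = ENNReal.ofReal (‖f y‖ * ∑ c ∈ F, w c y) := by
                rw [Finset.mul_sum, ENNReal.ofReal_sum_of_nonneg fun c _ =>
                  mul_nonneg (norm_nonneg _) (hw0 c y)]
                refine Finset.sum_congr rfl fun c _ => ?_
                rw [← ofReal_norm, norm_mul, hwn]
            _ ≤ ENNReal.ofReal ‖f y‖ :=
                ENNReal.ofReal_le_ofReal (mul_le_of_le_one_right (norm_nonneg _) (hwsum1 y))
            _ = _ := ofReal_norm _
      _ ≤ 2 * ENNReal.ofReal (a * μ) := by gcongr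
      _ = _ := by
          rw [mul_assoc, ENNReal.ofReal_mul (by norm_num : (0 : ℝ) ≤ 2)]; simp
  -- On the balls of `F` only the corrections remain of `g`; off them `g = f`. Outside all the balls
  -- `‖f‖ ≤ a`, so that `‖f‖ ^ s ≤ a ^ (s - 1) * ‖f‖`.
  · set AF := ⋃ c ∈ F, A c with hAF
    have hAFm : MeasurableSet AF := MeasurableSet.biUnion F.countable_toSet fun c _ => hAm c
    set BF := ⋃ c ∈ F, B c with hBF
    have hBFm : MeasurableSet BF := MeasurableSet.biUnion F.countable_toSet fun c _ => hBm c
    have hBFA : BF ⊆ AF := iUnion₂_mono fun c _ => hBA c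
    have hUm : MeasurableSet (⋃ c : u, A c) := MeasurableSet.iUnion hAm
    rw [← lintegral_add_compl _ hAFm]
    have h1 : ∫⁻ y in AF, ‖g y‖ₑ ^ s ≤ ENNReal.ofReal ((5 ^ n) ^ s * a ^ s * μ) := by
      calc ∫⁻ y in AF, ‖g y‖ₑ ^ s
          ≤ ∫⁻ y, BF.indicator (fun _ => ENNReal.ofReal ((5 ^ n * a) ^ s)) y := by
            rw [← lintegral_indicator hAFm]
            refine lintegral_mono fun y => ?_
            by_cases hy : y ∈ AF
            · rw [indicator_of_mem hy, hgy, hwsum, if_pos hy, sub_self, Complex.ofReal_zero,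
                mul_zero, zero_add]
              have h2 := hκsum y
              by_cases hyB : y ∈ BF
              · rw [indicator_of_mem hyB] at h2 ⊢
                rw [← ofReal_norm, ENNReal.ofReal_rpow_of_nonneg (norm_nonneg _) hs0.le]
                exact ENNReal.ofReal_le_ofReal (Real.rpow_le_rpow (norm_nonneg _) h2 hs0.le)
              · rw [indicator_of_notMem hyB] at h2 ⊢
                rw [norm_le_zero_iff.1 h2]; simp [hs0]
            · rw [indicator_of_notMem hy]; exact zero_le
        _ = ENNReal.ofReal ((5 ^ n * a) ^ s) * volume BF := by
            rw [lintegral_indicator hBFm, setLIntegral_const]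
        _ ≤ ENNReal.ofReal ((5 ^ n * a) ^ s) * ENNReal.ofReal μ := by
            gcongr
            calc volume BF ≤ ∑ c ∈ F, volume (B c) := measure_biUnion_finset_le _ _
              _ ≤ ∑' c : u, volume (B c) := ENNReal.sum_le_tsum _
              _ ≤ _ := hsumB
        _ = _ := by
            rw [← ENNReal.ofReal_mul (by positivity), Real.mul_rpow (by positivity) ha.le]
    have h2 : ∫⁻ y in AFᶜ, ‖g y‖ₑ ^ s ≤ ENNReal.ofReal (2 * a ^ s * μ) := by
      have e1 : ∫⁻ y in AFᶜ, ‖g y‖ₑ ^ s = ∫⁻ y in AFᶜ, ‖f y‖ₑ ^ s := by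
        refine setLIntegral_congr_fun hAFm.compl fun y hy => ?_
        have hy' : y ∉ AF := hy
        have h3 := hκsum y
        rw [indicator_of_notMem fun h => hy' (hBFA h)] at h3
        simp only [hgy, hwsum, if_neg hy', norm_le_zero_iff.1 h3]
        simp
      have e2 : AFᶜ ⊆ ((⋃ c : u, A c) \ AF) ∪ (⋃ c : u, A c)ᶜ := by
        intro y hy
        by_cases h : y ∈ ⋃ c : u, A c
        · exact Or.inl ⟨h, hy⟩
        · exact Or.inr h
      have e3 : ∫⁻ y in (⋃ c : u, A c)ᶜ, ‖f y‖ₑ ^ s ≤ ENNReal.ofReal (a ^ s * μ) := by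
        calc ∫⁻ y in (⋃ c : u, A c)ᶜ, ‖f y‖ₑ ^ s
            ≤ ∫⁻ y in (⋃ c : u, A c)ᶜ, ENNReal.ofReal (a ^ (s - 1)) * ‖f y‖ₑ := by
              refine lintegral_mono_ae ?_
              filter_upwards [ae_restrict_of_ae (ae_le_of_notMem_highAvg hfm.aemeasurable hfin a),
                ae_restrict_mem hUm.compl] with y hy1 hy2
              have hy3 := hy1 fun h => hy2 (hhigh h)
              rw [← ofReal_norm, ENNReal.ofReal_le_ofReal_iff ha.le] at hy3
              rw [← ofReal_norm, ENNReal.ofReal_rpow_of_nonneg (norm_nonneg _) hs0.le,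
                ← ENNReal.ofReal_mul (by positivity)]
              refine ENNReal.ofReal_le_ofReal ?_
              calc ‖f y‖ ^ s = ‖f y‖ ^ (s - 1) * ‖f y‖ := by
                    rw [← Real.rpow_add_one' (norm_nonneg _) (by linarith), sub_add_cancel]
                _ ≤ _ := by
                    gcongr
          _ ≤ ENNReal.ofReal (a ^ (s - 1)) * ∫⁻ y, ‖f y‖ₑ := by
              rw [lintegral_const_mul' _ _ ENNReal.ofReal_ne_top]
              exact mul_le_mul_right (setLIntegral_le_lintegral _ _) _
          _ ≤ ENNReal.ofReal (a ^ (s - 1)) * ENNReal.ofReal (a * μ) := by gcongr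
          _ = _ := by
              rw [← ENNReal.ofReal_mul (by positivity), ← mul_assoc,
                ← Real.rpow_add_one ha.ne', sub_add_cancel]
      rw [e1]
      calc _ ≤ _ := lintegral_mono_set e2
        _ ≤ _ := lintegral_union_le _ _ _
        _ ≤ ENNReal.ofReal (a ^ s * μ) + ENNReal.ofReal (a ^ s * μ) := add_le_add hF e3
        _ = _ := by
            rw [← ENNReal.ofReal_add (by positivity) (by positivity)]; congr 1; ring
    refine (add_le_add h1 h2).trans (le_of_eq ?_)
    rw [← ENNReal.ofReal_add (by positivity) (by positivity)]
    congr 1; ring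


/-! ### The endpoint estimate -/

/-- A factor of mean zero annihilates everything that does not depend on its variable. -/
theorem integral_update_mul_prod_eq_zero {n m : ℕ} (G : (Fin m → Rn n) → ℂ) (k : Fin m) (c : Rn n)
    (h : Fin m → Rn n → ℂ) (hk : ∫ y, h k y = 0) :
    ∫ y, G (Function.update y k c) * ∏ i, h i (y i) = 0 := by
  obtain ⟨m', rfl⟩ : ∃ m', m = m' + 1 := ⟨m - 1, by have := k.2; omega⟩
  have e := ((measurePreserving_piFinSuccAbove (fun _ : Fin (m' + 1) => (volume : Measure (Rn n))) k
    ).symm).integral_comp' (fun y => G (Function.update y k c) * ∏ i, h i (y i))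
  rw [volume_pi, ← e]
  have e2 : ∀ a : Rn n × (Fin m' → Rn n),
      G (Function.update ((MeasurableEquiv.piFinSuccAbove (fun _ : Fin (m' + 1) => Rn n) k).symm a)
        k c) * ∏ i, h i ((MeasurableEquiv.piFinSuccAbove (fun _ => Rn n) k).symm a i) =
      h k a.1 * (G (k.insertNth c a.2) * ∏ j, h (k.succAbove j) (a.2 j)) := by
    intro a
    rw [MeasurableEquiv.piFinSuccAbove_symm_apply, Fin.insertNthEquiv]
    simp only [Equiv.coe_fn_mk, Fin.update_insertNth, Fin.prod_univ_succAbove _ k,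
      Fin.insertNth_apply_same, Fin.insertNth_apply_succAbove]
    ring
  simp_rw [e2]
  rw [integral_prod_mul (fun y => h k y) fun w : Fin m' → Rn n =>
    G (k.insertNth c w) * ∏ j, h (k.succAbove j) (w j), hk, zero_mul]

section Endpoint

variable {n m : ℕ} {ω : ℝ → ℝ} {K : Rn n → (Fin m → Rn n) → ℂ}
  {T : MultilinearMap ℂ (fun _ : Fin m => 𝓢(Rn n, ℂ)) 𝓢'(Rn n, ℂ)}
  {q : Fin m → ℝ} {q₀ : ℝ}
  {S : MultilinearMap ℂ
      (fun i : Fin m => Lp ℂ (ENNReal.ofReal (q i)) (volume : Measure (Rn n)))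
      (Rn n →ₘ[volume] ℂ)}

theorem IsCZKernel.integrable_mul_of_far (hK : IsCZKernel ω K) (hω : IsDiniModulus ω) (hn : 1 ≤ n)
    {x : Rn n} {δ : ℝ} (hδ : 0 < δ) {k : Fin m} {h : (Fin m → Rn n) → ℂ} (hh : Integrable h)
    (hk : ∀ y, y k ∈ Metric.ball x δ → h y = 0) : Integrable fun y => K x y * h y := by
  obtain ⟨A, hA⟩ := hK.exists_kernelBounds
  have hm : 1 ≤ m := by have := k.2; omega
  refine ⟨(hK.aestronglyMeasurable hn hm hω x).mul hh.aestronglyMeasurable, ?_⟩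
  exact (hA.enorm_integral_le hδ (Metric.mem_ball_self (by positivity)) hk).trans_lt
    (ENNReal.mul_lt_top ENNReal.ofReal_lt_top hh.2)

/-- The kernel integral with a factor `h_k` of mean zero supported in a small ball, at a point far from
that ball: as `h_k` annihilates the kernel with `y_k` frozen at the centre, only the oscillation of the
kernel in `y_k` remains. -/
theorem IsCZKernel.enorm_integral_atom_le (hK : IsCZKernel ω K) (hω : IsDiniModulus ω)
    {A : ℝ} (hA : KernelBounds A ω K) (hn : 1 ≤ n) {x c : Rn n} {t : ℝ} (ht : 0 < t)
    (hx : 4 * t ≤ dist x c) {h : Fin m → Rn n → ℂ} (hh : ∀ i, IsBddFun (h i)) {k : Fin m}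
    (hk : ∀ y, y ∉ Metric.closedBall c t → h k y = 0) (hk0 : ∫ y, h k y = 0)
    {a : Fin m → ℝ} (ha : ∀ i, 0 ≤ a i)
    (hav : ∀ i, i ≠ k → ∀ s, 0 < s →
      ∫⁻ y in Metric.ball x s, ‖h i y‖ₑ ≤ ENNReal.ofReal (a i * s ^ n)) :
    Integrable (fun y => K x y * ∏ i, h i (y i)) ∧
    ‖∫ y, K x y * ∏ i, h i (y i)‖ₑ ≤
      ENNReal.ofReal (A * 2 ^ (m * n) * 2 * (∏ i ∈ Finset.univ.erase k, a i) *
        (ω (2 * t / dist x c) / dist x c ^ n)) * ∫⁻ y, ‖h k y‖ₑ := by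
  have hm : 1 ≤ m := by have := k.2; omega
  have hprod : Integrable fun y : Fin m → Rn n => ∏ i, h i (y i) :=
    Integrable.fintype_prod fun i => (hh i).integrable
  have hi1 : Integrable fun y => K x y * ∏ i, h i (y i) := by
    refine hK.integrable_mul_of_far hω hn (x := x) ht (k := k) hprod fun y hy => ?_
    refine Finset.prod_eq_zero (Finset.mem_univ k) (hk _ fun hyc => ?_)
    have := dist_triangle x (y k) c
    rw [Metric.mem_ball, dist_comm] at hy
    rw [Metric.mem_closedBall] at hyc
    linarith
  have hfar : ∀ y : Fin m → Rn n, 4 * t ≤ dist (Function.update y k c) (fun _ => x) := fun y => by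
    have := dist_le_pi_dist (Function.update y k c) (fun _ => x) k
    rw [Function.update_self, dist_comm] at this
    linarith
  have hi2 : Integrable fun y => K x (Function.update y k c) * ∏ i, h i (y i) := by
    refine hprod.bdd_mul (c := A / (4 * t) ^ (m * n)) ?_ (Eventually.of_forall fun y => ?_)
    · refine Continuous.aestronglyMeasurable ?_
      refine (hK.continuousOn hm hω x).comp_continuous (by fun_prop) fun y => ?_
      intro hc
      have h1 := hfar y
      rw [mem_singleton_iff.1 hc, dist_self] at h1
      linarith
    · exact hA.norm_le (by positivity) (hfar y)
  refine ⟨hi1, ?_⟩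
  have hzero := integral_update_mul_prod_eq_zero (K x) k c h hk0
  rw [← sub_zero (∫ y, K x y * ∏ i, h i (y i)), ← hzero, ← integral_sub hi1 hi2]
  refine (enorm_integral_le_lintegral_enorm _).trans ?_
  refine le_trans (le_of_eq ?_) (hA.lintegral_sub_update_le hω hn hm ht hx
    (h := fun i y => ‖h i y‖ₑ) (fun i => (hh i).enorm_aemeasurable) (k := k)
    (fun y hy => by simp [hk y hy]) ha hav)
  refine lintegral_congr fun y => ?_
  rw [← sub_mul, enorm_mul, enorm_prod_eq]

/-- Away from the bad set, the terms of the Calderón-Zygmund decomposition with a bad factor are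
integrable. The cancellation of a single bad factor is enough: all other factors only enter through
their means over balls centred outside the bad set. -/
theorem IsWeakExtension.lintegral_bad_le (hS : IsWeakExtension T q q₀ S)
    (hK : IsCZKernel ω K) (hω : IsDiniModulus ω) {A : ℝ} (hA : KernelBounds A ω K) (hn : 1 ≤ n)
    (hTK : HasKernel T K) {h : Fin m → Rn n → ℂ} (hh : ∀ i, IsBddFun (h i)) {k : Fin m}
    {ι : Type*} {F : Finset ι} {c : ι → Rn n} {t : ι → ℝ} {b : ι → Rn n → ℂ}
    (hb : ∀ j ∈ F, IsBddFun (b j)) (hkb : h k = ∑ j ∈ F, b j) (ht : ∀ j ∈ F, 0 < t j)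
    (hbs : ∀ j ∈ F, ∀ y, y ∉ Metric.closedBall (c j) (t j) → b j y = 0)
    (hb0 : ∀ j ∈ F, ∫ y, b j y = 0) {Ω : Set (Rn n)} (hΩm : MeasurableSet Ω)
    (hΩ : ∀ j ∈ F, Metric.ball (c j) (4 * t j) ⊆ Ω)
    {a : Fin m → ℝ} (ha : ∀ i, 0 ≤ a i)
    (hav : ∀ x, x ∉ Ω → ∀ i, i ≠ k → ∀ s, 0 < s →
      ∫⁻ y in Metric.ball x s, ‖h i y‖ₑ ≤ ENNReal.ofReal (a i * s ^ n)) :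
    ∫⁻ x in Ωᶜ, ‖S (fun i => classLp (q i) (h i)) x‖ₑ ≤
      ENNReal.ofReal (A * 2 ^ (m * n) * 2 * (∏ i ∈ Finset.univ.erase k, a i)) *
        (ENNReal.ofReal (unitVol n * 2 ^ n) * ∑' k : ℕ, ENNReal.ofReal (ω ((1 / 2) ^ (k + 1)))) *
        ∑ j ∈ F, ∫⁻ y, ‖b j y‖ₑ := by
  classical
  have hApos := hA.pos
  have hP : 0 ≤ ∏ i ∈ Finset.univ.erase k, a i := Finset.prod_nonneg fun i _ => ha i
  have hrep := hS.ae_eq_integral hK hω hn hTK (fun i => (hh i).memLp _) (fun i => (hh i).supp)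
    (U := (⋃ j ∈ F, Metric.closedBall (c j) (t j))ᶜ)
    (isClosed_biUnion_finset fun j _ => Metric.isClosed_closedBall).isOpen_compl (k := k)
    (fun y hy => by
      rw [hkb, Finset.sum_apply]
      exact Finset.sum_eq_zero fun j hj => hbs j hj y fun h => hy (mem_iUnion₂.2 ⟨j, hj, h⟩))
  set Q : ι → Rn n → ℝ≥0∞ := fun j x =>
    ENNReal.ofReal (A * 2 ^ (m * n) * 2 * (∏ i ∈ Finset.univ.erase k, a i)) *
      ENNReal.ofReal (ω (2 * t j / dist x (c j)) / dist x (c j) ^ n) * ∫⁻ y, ‖b j y‖ₑ with hQ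
  have hpt : ∀ᵐ x, x ∈ Ωᶜ → ‖S (fun i => classLp (q i) (h i)) x‖ₑ ≤ ∑ j ∈ F, Q j x := by
    filter_upwards [hrep] with x hx hxΩ
    have hxfar : ∀ j ∈ F, 4 * t j ≤ dist x (c j) := by
      intro j hj
      by_contra! hlt
      exact hxΩ (hΩ j hj hlt)
    rw [hx (fun hmem => by
      obtain ⟨j, hj, hxj⟩ := mem_iUnion₂.1 hmem
      have h1 := hxfar j hj
      have h2 := ht j hj
      rw [Metric.mem_closedBall] at hxj
      linarith)]
    set hj : ι → Fin m → Rn n → ℂ := fun j => Function.update h k (b j) with hhj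
    have hatom : ∀ j ∈ F, _ := fun j hjF => hK.enorm_integral_atom_le hω hA hn (ht j hjF)
      (hxfar j hjF) (h := hj j) (k := k) (a := a)
      (fun i => by
        by_cases hi : i = k
        · subst hi; simpa [hhj] using hb j hjF
        · simpa [hhj, hi] using hh i)
      (by simpa [hhj] using hbs j hjF) (by simpa [hhj] using hb0 j hjF) ha
      (fun i hi s hs => by simpa [hhj, hi] using hav x hxΩ i hi s hs)
    have hsum : ∀ y : Fin m → Rn n, K x y * ∏ i, h i (y i) =
        ∑ j ∈ F, K x y * ∏ i, hj j i (y i) := by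
      intro y
      rw [← Finset.mul_sum]
      congr 1
      rw [← Finset.mul_prod_erase _ _ (Finset.mem_univ k), hkb, Finset.sum_apply, Finset.sum_mul]
      refine Finset.sum_congr rfl fun j _ => ?_
      rw [← Finset.mul_prod_erase _ _ (Finset.mem_univ k)]
      congr 1
      · simp [hhj]
      · refine Finset.prod_congr rfl fun i hi => ?_
        simp [hhj, Finset.ne_of_mem_erase hi]
    simp_rw [hsum]
    rw [integral_finsetSum _ fun j hjF => (hatom j hjF).1]
    refine (enorm_sum_le _ _).trans (Finset.sum_le_sum fun j hjF => ?_)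
    refine (hatom j hjF).2.trans (le_of_eq ?_)
    simp only [hQ, hhj, Function.update_self]
    rw [← ENNReal.ofReal_mul (by positivity)]
  calc ∫⁻ x in Ωᶜ, ‖S (fun i => classLp (q i) (h i)) x‖ₑ
      ≤ ∫⁻ x in Ωᶜ, ∑ j ∈ F, Q j x := by
        refine lintegral_mono_ae ?_
        filter_upwards [ae_restrict_of_ae hpt, ae_restrict_mem hΩm.compl] with x h1 h2
        exact h1 h2
    _ ≤ ∑ j ∈ F, ∫⁻ x in Ωᶜ, Q j x := by
        refine le_of_eq (lintegral_finsetSum' _ fun j hj => ?_)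
        -- `ω` is only known to be monotone on `[0, ∞)`
        have hωm : Measurable fun s : ℝ => ω (max s 0) := by
          refine Monotone.measurable fun s t hst => hω.mono_of_nonneg (le_max_right _ _) ?_
          exact max_le_max hst le_rfl
        have hm1 : Measurable fun x : Rn n => ω (2 * t j / dist x (c j)) / dist x (c j) ^ n := by
          have e : (fun x : Rn n => ω (2 * t j / dist x (c j)) / dist x (c j) ^ n) =
              fun x => ω (max (2 * t j / dist x (c j)) 0) / dist x (c j) ^ n := by
            ext x
            rw [max_eq_left (by have := ht j hj; positivity)]
          rw [e]
          exact (hωm.comp (by fun_prop)).div (by fun_prop)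
        exact (((hm1.ennreal_ofReal).const_mul _).mul_const _).aemeasurable
    _ ≤ ∑ j ∈ F, ENNReal.ofReal (A * 2 ^ (m * n) * 2 * (∏ i ∈ Finset.univ.erase k, a i)) *
          (ENNReal.ofReal (unitVol n * 2 ^ n) * ∑' k : ℕ, ENNReal.ofReal (ω ((1 / 2) ^ (k + 1)))) *
          ∫⁻ y, ‖b j y‖ₑ := by
        refine Finset.sum_le_sum fun j hj => ?_
        have hne : ∫⁻ y, ‖b j y‖ₑ ≠ ∞ := (hb j hj).integrable.2.ne
        simp only [hQ]
        rw [lintegral_mul_const' _ _ hne, lintegral_const_mul' _ _ ENNReal.ofReal_ne_top]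
        gcongr
        refine (lintegral_mono_set (compl_subset_compl.2 (hΩ j hj))).trans ?_
        exact lintegral_modulus_le hω (ht j hj)
    _ = _ := by rw [Finset.mul_sum]

/-- The weak endpoint bound `L¹ × ⋯ × L¹ → L^{1/m,∞}`, with the `L¹` norms split into levels `a_i`
and a common measure `μ`. -/
theorem IsWeakExtension.exists_endpoint (hS : IsWeakExtension T q q₀ S)
    (hK : IsCZKernel ω K) (hω : IsDiniModulus ω) (hn : 1 ≤ n) (hTK : HasKernel T K) :
    ∃ C : ℝ≥0, ∀ f : Fin m → Rn n → ℂ, (∀ i, IsBddFun (f i)) → ∀ (a : Fin m → ℝ) (μ : ℝ),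
      (∀ i, 0 < a i) → 0 < μ → (∀ i, ∫⁻ y, ‖f i y‖ₑ ≤ ENNReal.ofReal (a i * μ)) →
      volume {x | ENNReal.ofReal (∏ i, a i) < ‖S (fun i => classLp (q i) (f i)) x‖ₑ} ≤
        C * ENNReal.ofReal μ := by
  classical
  obtain ⟨A, hA⟩ := hK.exists_kernelBounds
  have hApos := hA.pos
  obtain ⟨CS, hCS⟩ := hS.bound
  have hv := unitVol_pos n
  set D := ∑' k : ℕ, ENNReal.ofReal (ω ((1 / 2) ^ (k + 1))) with hD
  have hDne : D ≠ ∞ := hω.tsum_ne_top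
  have hDr : D = ENNReal.ofReal D.toReal := (ENNReal.ofReal_toReal hDne).symm
  set c' : ℝ := (1 + 5 ^ n) * unitVol n with hc'
  have hc'0 : 0 < c' := by positivity
  have hq0 : ∀ i, 0 < q i := fun i => zero_lt_one.trans (hS.one_lt i)
  have hq₀ := hS.pos
  set CG : ℝ := (CS * (∏ i, (2 + (5 ^ n) ^ q i) ^ (1 / q i)) * 2 ^ m) ^ q₀ with hCG
  have hCG0 : 0 ≤ CG := by positivity
  set CB : ℝ := 2 ^ m * (A * 2 ^ (m * n) * 2 * c' ^ (m - 1)) * (unitVol n * 2 ^ n * D.toReal) * 2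
    with hCB
  have hCB0 : 0 ≤ CB := by positivity
  refine ⟨(m * 20 ^ n + CG + 2 ^ m * CB).toNNReal, fun f hf a μ ha hμ hfa => ?_⟩
  choose u Ω F t b g hΩm hΩv hgt hbt hfeq hatom hbL1 hgLs hout using fun i =>
    exists_calderonZygmund_decomposition hn (hS.one_lt i) (hf i) (ha i) hμ (hfa i)
  set P := ∏ i, a i with hP
  have hP0 : 0 < P := Finset.prod_pos fun i _ => ha i
  -- each of the `2^m` terms of the expansion is tested at an equal share of the level
  set L : ℝ := P / 2 ^ m with hL
  have hL0 : 0 < L := by positivity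
  set β : Fin m → Rn n → ℂ := fun i => ∑ c ∈ F i, b i c with hβ
  have hβt : ∀ i, IsBddFun (β i) := fun i => IsBddFun.sum _ (hbt i)
  set h : Finset (Fin m) → Fin m → Rn n → ℂ := fun J => J.piecewise β g with hh
  have hht : ∀ J i, IsBddFun (h J i) := by
    intro J i
    by_cases hi : i ∈ J
    · simpa [hh, hi] using hβt i
    · simpa [hh, hi] using hgt i
  have hSsum : S (fun i => classLp (q i) (f i)) =
      ∑ J : Finset (Fin m), S (fun i => classLp (q i) (h J i)) := by
    have e1 : (fun i => classLp (q i) (f i)) =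
        (fun i => classLp (q i) (β i)) + fun i => classLp (q i) (g i) := by
      ext1 i
      rw [Pi.add_apply, ← classLp_add ((hβt i).memLp _) ((hgt i).memLp _), ← hfeq i]
    rw [e1, MultilinearMap.map_add_univ]
    refine Finset.sum_congr rfl fun J _ => ?_
    congr 1
    ext1 i
    by_cases hi : i ∈ J <;> simp [hh, hi]
  have hSae : ∀ᵐ x, S (fun i => classLp (q i) (f i)) x =
      ∑ J : Finset (Fin m), S (fun i => classLp (q i) (h J i)) x := by
    rw [hSsum]
    filter_upwards [AEEqFun.coeFn_finsetSum Finset.univ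
      (fun J => S (fun i => classLp (q i) (h J i)))] with x hx
    rw [hx, Finset.sum_apply]
  set Ω' := ⋃ i, Ω i with hΩ'
  have hΩ'm : MeasurableSet Ω' := MeasurableSet.iUnion hΩm
  have hΩ'v : volume Ω' ≤ ENNReal.ofReal (m * 20 ^ n * μ) := by
    calc volume Ω' ≤ ∑ i, volume (Ω i) := by
          simpa using measure_iUnion_fintype_le volume Ω
      _ ≤ ∑ _i : Fin m, ENNReal.ofReal (20 ^ n * μ) := Finset.sum_le_sum fun i _ => hΩv i
      _ = _ := by
          rw [Finset.sum_const, Finset.card_univ, Fintype.card_fin, ← ENNReal.ofReal_nsmul,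
            nsmul_eq_mul, mul_assoc]
  -- the term in which all factors are good
  have hgood : volume {x | ENNReal.ofReal L < ‖S (fun i => classLp (q i) (g i)) x‖ₑ} ≤
      ENNReal.ofReal (CG * μ) := by
    have h1 := volume_lt_enorm_le hq₀ (S (fun i => classLp (q i) (g i))) (l := L.toNNReal)
      (by simpa using hL0)
    refine h1.trans ?_
    have h2 : ∀ i, eLpNorm (classLp (q i) (g i)) (ENNReal.ofReal (q i)) volume ≤
        ENNReal.ofReal ((2 + (5 ^ n) ^ q i) ^ (1 / q i) * a i * μ ^ (1 / q i)) := by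
      intro i
      have hai := ha i
      have hqi := hq0 i
      rw [eLpNorm_classLp ((hgt i).memLp _), eLpNorm_eq_lintegral_rpow_enorm_toReal
        (by simpa using hq0 i) ENNReal.ofReal_ne_top, ENNReal.toReal_ofReal (hq0 i).le]
      refine (ENNReal.rpow_le_rpow (hgLs i) (by positivity)).trans (le_of_eq ?_)
      rw [ENNReal.ofReal_rpow_of_nonneg (by positivity) (by positivity),
        Real.mul_rpow (by positivity) hμ.le, Real.mul_rpow (by positivity) (by positivity),
        ← Real.rpow_mul hai.le, mul_one_div_cancel hqi.ne', Real.rpow_one]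
    have h3 : weakNorm q₀ (S (fun i => classLp (q i) (g i))) ≤
        ENNReal.ofReal (CS * (∏ i, (2 + (5 ^ n) ^ q i) ^ (1 / q i)) * P * μ ^ (1 / q₀)) := by
      refine (hCS _).trans ?_
      calc _ ≤ (CS : ℝ≥0∞) *
            ∏ i, ENNReal.ofReal ((2 + (5 ^ n) ^ q i) ^ (1 / q i) * a i * μ ^ (1 / q i)) := by
            gcongr with i; exact h2 i
        _ = _ := by
            rw [← ENNReal.ofReal_prod_of_nonneg (fun i _ => by have := ha i; positivity),
              ← ENNReal.ofReal_coe_nnreal, ← ENNReal.ofReal_mul (by positivity),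
              Finset.prod_mul_distrib, Finset.prod_mul_distrib,
              ← Real.rpow_sum_of_pos hμ, hS.sum_eq]
            congr 1; ring
    calc (weakNorm q₀ (S (fun i => classLp (q i) (g i))) / L.toNNReal) ^ q₀
        ≤ (ENNReal.ofReal (CS * (∏ i, (2 + (5 ^ n) ^ q i) ^ (1 / q i)) * P * μ ^ (1 / q₀)) /
            ENNReal.ofReal L) ^ q₀ := by
          exact ENNReal.rpow_le_rpow (ENNReal.div_le_div h3 le_rfl) hq₀.le
      _ = _ := by
          rw [← ENNReal.ofReal_div_of_pos hL0, ENNReal.ofReal_rpow_of_nonneg (by positivity) hq₀.le]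
          congr 1
          have e : CS * (∏ i, (2 + (5 ^ n) ^ q i) ^ (1 / q i)) * P * μ ^ (1 / q₀) / L =
              (CS * (∏ i, (2 + (5 ^ n) ^ q i) ^ (1 / q i)) * 2 ^ m) * μ ^ (1 / q₀) := by
            rw [hL]; field_simp
          rw [e, Real.mul_rpow (by positivity) (by positivity), ← Real.rpow_mul hμ.le,
            one_div_mul_cancel hq₀.ne', Real.rpow_one]
  -- the terms with a bad factor
  have hbad : ∀ J : Finset (Fin m), J.Nonempty →
      volume {x | x ∉ Ω' ∧ ENNReal.ofReal L < ‖S (fun i => classLp (q i) (h J i)) x‖ₑ} ≤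
        ENNReal.ofReal (CB * μ) := by
    rintro J ⟨k, hk⟩
    have hint := hS.lintegral_bad_le hK hω hA hn hTK (hht J) (k := k) (F := F k)
      (c := fun c => (c : Rn n)) (t := t k) (b := b k) (hbt k) (by simp [hh, hk, hβ])
      (fun j hj => (hatom k j hj).1) (fun j hj => (hatom k j hj).2.1)
      (fun j hj => (hatom k j hj).2.2.1) hΩ'm
      (fun j hj => ((hatom k j hj).2.2.2).trans (subset_iUnion Ω k)) (a := fun i => c' * a i)
      (fun i => by have := ha i; positivity) (fun x hx i _ s hs => by
        have hxi : x ∉ Ω i := fun h => hx (mem_iUnion.2 ⟨i, h⟩)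
        by_cases hi : i ∈ J
        · simpa [hh, hi, hβ, hc'] using (hout i x hxi s hs).2
        · simpa [hh, hi, hc'] using (hout i x hxi s hs).1)
    rw [← hD, hDr] at hint
    have hak := ha k
    have hE0 : 0 ≤ ∏ i ∈ Finset.univ.erase k, c' * a i :=
      Finset.prod_nonneg fun i _ => by have := ha i; positivity
    have hcheb : ENNReal.ofReal L *
        volume {x | x ∉ Ω' ∧ ENNReal.ofReal L < ‖S (fun i => classLp (q i) (h J i)) x‖ₑ} ≤
        ENNReal.ofReal (L * (CB * μ)) := by
      have h1 := mul_meas_ge_le_lintegral₀ (μ := volume.restrict Ω'ᶜ)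
        (f := fun x => ‖S (fun i => classLp (q i) (h J i)) x‖ₑ)
        (S (fun i => classLp (q i) (h J i))).aestronglyMeasurable.restrict.enorm (ENNReal.ofReal L)
      calc _ ≤ ENNReal.ofReal L * (volume.restrict Ω'ᶜ)
            {x | ENNReal.ofReal L ≤ ‖S (fun i => classLp (q i) (h J i)) x‖ₑ} := by
            refine mul_le_mul_right ?_ _
            rw [Measure.restrict_apply' hΩ'm.compl]
            exact measure_mono fun x hx => ⟨le_of_lt hx.2, hx.1⟩
        _ ≤ _ := h1
        _ ≤ _ := hint
        _ ≤ ENNReal.ofReal (A * 2 ^ (m * n) * 2 * (∏ i ∈ Finset.univ.erase k, c' * a i)) *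
              (ENNReal.ofReal (unitVol n * 2 ^ n) * ENNReal.ofReal D.toReal) *
              ENNReal.ofReal (2 * a k * μ) := by
            gcongr; exact hbL1 k
        _ = _ := by
            have hD0 : 0 ≤ D.toReal := ENNReal.toReal_nonneg
            rw [← ENNReal.ofReal_mul (by positivity), ← ENNReal.ofReal_mul (by positivity),
              ← ENNReal.ofReal_mul (by positivity)]
            congr 1
            have e1 : P = a k * ∏ i ∈ Finset.univ.erase k, a i :=
              (Finset.mul_prod_erase _ _ (Finset.mem_univ k)).symm
            rw [Finset.prod_mul_distrib, Finset.prod_const,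
              Finset.card_erase_of_mem (Finset.mem_univ k), Finset.card_univ, Fintype.card_fin,
              hCB, hL, e1]
            field_simp
    rw [ENNReal.ofReal_mul hL0.le] at hcheb
    exact (ENNReal.mul_le_mul_iff_right (by simpa using hL0) ENNReal.ofReal_ne_top).1 hcheb
  have hcover : volume {x | ENNReal.ofReal P < ‖S (fun i => classLp (q i) (f i)) x‖ₑ} ≤
      volume (Ω' ∪ {x | ENNReal.ofReal L < ‖S (fun i => classLp (q i) (g i)) x‖ₑ} ∪
        ⋃ J ∈ Finset.univ.filter (fun J : Finset (Fin m) => J.Nonempty),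
          {x | x ∉ Ω' ∧ ENNReal.ofReal L < ‖S (fun i => classLp (q i) (h J i)) x‖ₑ}) := by
    refine measure_mono_ae ?_
    filter_upwards [hSae] with x hx hxP
    change ENNReal.ofReal P < ‖S (fun i => classLp (q i) (f i)) x‖ₑ at hxP
    change x ∈ (Ω' ∪ {x | ENNReal.ofReal L < ‖S (fun i => classLp (q i) (g i)) x‖ₑ} ∪
        ⋃ J ∈ Finset.univ.filter (fun J : Finset (Fin m) => J.Nonempty),
          {x | x ∉ Ω' ∧ ENNReal.ofReal L < ‖S (fun i => classLp (q i) (h J i)) x‖ₑ})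
    by_contra hno
    simp only [mem_union, not_or, mem_ofPred_eq, mem_iUnion, not_exists, not_and, not_lt,
      Finset.mem_filter, Finset.mem_univ, true_and] at hno
    obtain ⟨⟨hno1, hno2⟩, hno3⟩ := hno
    refine absurd hxP (not_lt.2 ?_)
    rw [hx]
    calc ‖∑ J : Finset (Fin m), S (fun i => classLp (q i) (h J i)) x‖ₑ
        ≤ ∑ J : Finset (Fin m), ‖S (fun i => classLp (q i) (h J i)) x‖ₑ := enorm_sum_le _ _
      _ ≤ ∑ _J : Finset (Fin m), ENNReal.ofReal L := by
          refine Finset.sum_le_sum fun J _ => ?_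
          rcases J.eq_empty_or_nonempty with rfl | hJ
          · simpa [hh] using hno2
          · exact hno3 J hJ hno1
      _ = ENNReal.ofReal P := by
          rw [Finset.sum_const, Finset.card_univ, Fintype.card_finset, Fintype.card_fin,
            ← ENNReal.ofReal_nsmul, nsmul_eq_mul, hL]
          congr 1
          push_cast
          field_simp
  refine hcover.trans ?_
  calc _ ≤ ENNReal.ofReal (m * 20 ^ n * μ) + ENNReal.ofReal (CG * μ) +
        ∑ J ∈ Finset.univ.filter (fun J : Finset (Fin m) => J.Nonempty),
          ENNReal.ofReal (CB * μ) := by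
        refine (measure_union_le _ _).trans (add_le_add ?_ ?_)
        · exact (measure_union_le _ _).trans (add_le_add hΩ'v hgood)
        · refine (measure_biUnion_finset_le _ _).trans (Finset.sum_le_sum fun J hJ => ?_)
          exact hbad J (Finset.mem_filter.1 hJ).2
    _ ≤ ENNReal.ofReal (m * 20 ^ n * μ) + ENNReal.ofReal (CG * μ) +
        ∑ _J : Finset (Fin m), ENNReal.ofReal (CB * μ) := by
        gcongr
        exact Finset.filter_subset _ _
    _ = _ := by
        rw [Finset.sum_const, Finset.card_univ, Fintype.card_finset, Fintype.card_fin,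
          ← ENNReal.ofReal_nsmul, nsmul_eq_mul, ← ENNReal.ofReal_add (by positivity) (by positivity),
          ← ENNReal.ofReal_add (by positivity) (by positivity), ← ENNReal.ofReal.eq_1,
          ← ENNReal.ofReal_mul (by positivity)]
        congr 1
        push_cast
        ring

end Endpoint


/-! ### Splitting along a ball -/

section Splitting

variable {n m : ℕ} {f : Fin m → Rn n → ℂ} {z : Rn n} {r : ℝ}

theorem piece_eq_zero_of_mem {J : Finset (Fin m)} {k : Fin m} (hk : k ∈ J) {y : Rn n}
    (hy : y ∈ Metric.ball z (2 * r)) : piece f z r J k y = 0 := by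
  rw [piece, if_pos hk, indicator_of_notMem (by simpa using hy)]

theorem enorm_piece_le (J : Finset (Fin m)) (i : Fin m) (y : Rn n) :
    ‖piece f z r J i y‖ₑ ≤ ‖f i y‖ₑ := by
  rw [piece]
  split_ifs <;> exact enorm_indicator_le_enorm_self _ _

theorem enorm_pieceProd_le (J : Finset (Fin m)) (y : Fin m → Rn n) :
    ‖pieceProd f z r J y‖ₑ ≤ ∏ i, ‖f i (y i)‖ₑ := by
  rw [pieceProd, enorm_prod_eq]
  exact Finset.prod_le_prod' fun i _ => enorm_piece_le J i (y i)

theorem pieceProd_eq_zero_of_mem {J : Finset (Fin m)} {k : Fin m} (hk : k ∈ J) {y : Fin m → Rn n}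
    (hy : y k ∈ Metric.ball z (2 * r)) : pieceProd f z r J y = 0 :=
  Finset.prod_eq_zero (Finset.mem_univ k) (piece_eq_zero_of_mem hk hy)

theorem pieceProd_eq_zero_of_mem_ball {J : Finset (Fin m)} (hJ : J.Nonempty) (hr : 0 < r)
    {y : Fin m → Rn n} (hy : y ∈ Metric.ball (fun _ : Fin m => z) (2 * r)) :
    pieceProd f z r J y = 0 := by
  obtain ⟨k, hk⟩ := hJ
  refine pieceProd_eq_zero_of_mem hk ?_
  exact Metric.mem_ball.2 ((dist_pi_lt_iff (by positivity)).1 (Metric.mem_ball.1 hy) k)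

theorem sum_pieceProd (y : Fin m → Rn n) :
    ∑ J : Finset (Fin m), pieceProd f z r J y = ∏ i, f i (y i) := by
  have e : ∀ i, f i (y i) = (Metric.ball z (2 * r))ᶜ.indicator (f i) (y i) +
      (Metric.ball z (2 * r)).indicator (f i) (y i) := fun i =>
    (congrFun (indicator_compl_add_self (Metric.ball z (2 * r)) (f i)) (y i)).symm
  simp_rw [e, Fintype.prod_add, pieceProd, piece]
  refine Finset.sum_congr rfl fun J _ => ?_
  rw [← Finset.prod_mul_prod_compl J]
  congr 1
  · exact Finset.prod_congr rfl fun i hi => by rw [if_pos hi]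
  · exact Finset.prod_congr rfl fun i hi => by rw [if_neg (Finset.mem_compl.1 hi)]

theorem memLp_piece {q : ℝ≥0∞} {i : Fin m} (hf : MemLp (f i) q volume) (J : Finset (Fin m)) :
    MemLp (piece f z r J i) q volume := by
  rw [piece]
  split_ifs
  · exact hf.indicator measurableSet_ball.compl
  · exact hf.indicator measurableSet_ball

theorem aestronglyMeasurable_piece {i : Fin m} (hf : AEStronglyMeasurable (f i) volume)
    (J : Finset (Fin m)) : AEStronglyMeasurable (piece f z r J i) volume := by
  rw [piece]
  split_ifs
  · exact hf.indicator measurableSet_ball.compl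
  · exact hf.indicator measurableSet_ball

theorem aestronglyMeasurable_pieceProd (hf : ∀ i, AEStronglyMeasurable (f i) volume)
    (J : Finset (Fin m)) : AEStronglyMeasurable (pieceProd f z r J) volume := by
  refine Finset.aestronglyMeasurable_fun_prod _ fun i _ => ?_
  exact (aestronglyMeasurable_piece (hf i) J).comp_quasiMeasurePreserving
    (Measure.quasiMeasurePreserving_eval _ i)

/-- Expansion of a multilinear operator along `f_i = f_i χ_{2B} + f_i χ_{(2B)ᶜ}`. -/
theorem ae_eq_sum_map_piece {q : Fin m → ℝ} (S : MultilinearMap ℂ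
      (fun i : Fin m => Lp ℂ (ENNReal.ofReal (q i)) (volume : Measure (Rn n)))
      (Rn n →ₘ[volume] ℂ)) (hf : ∀ i, MemLp (f i) (ENNReal.ofReal (q i)) volume)
    (z : Rn n) (r : ℝ) :
    ∀ᵐ x, S (fun i => classLp (q i) (f i)) x =
      ∑ J : Finset (Fin m), S (fun i => classLp (q i) (piece f z r J i)) x := by
  classical
  have hsum : S (fun i => classLp (q i) (f i)) =
      ∑ J : Finset (Fin m), S (fun i => classLp (q i) (piece f z r J i)) := by
    have e1 : (fun i => classLp (q i) (f i)) =
        (fun i => classLp (q i) ((Metric.ball z (2 * r))ᶜ.indicator (f i))) +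
          fun i => classLp (q i) ((Metric.ball z (2 * r)).indicator (f i)) := by
      ext1 i
      rw [Pi.add_apply, ← classLp_add ((hf i).indicator measurableSet_ball.compl)
        ((hf i).indicator measurableSet_ball), indicator_compl_add_self]
    rw [e1, MultilinearMap.map_add_univ]
    refine Finset.sum_congr rfl fun J _ => ?_
    congr 1
    ext1 i
    by_cases hi : i ∈ J <;> simp [piece, hi]
  rw [hsum]
  filter_upwards [AEEqFun.coeFn_finsetSum Finset.univ
    (fun J => S (fun i => classLp (q i) (piece f z r J i)))] with x hx
  rw [hx, Finset.sum_apply]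

/-- The part of `splitValue` which is given by the kernel. -/
noncomputable def farValue (K : Rn n → (Fin m → Rn n) → ℂ) (f : Fin m → Rn n → ℂ) (z : Rn n)
    (r : ℝ) (x : Rn n) : ℂ :=
  ∑ J : Finset (Fin m) with J.Nonempty, ∫ y : Fin m → Rn n, K x y * pieceProd f z r J y

theorem sum_finset_eq_empty_add (F : Finset (Fin m) → ℂ) :
    ∑ J, F J = F ∅ + ∑ J : Finset (Fin m) with J.Nonempty, F J := by
  classical
  rw [← Finset.add_sum_erase _ _ (Finset.mem_univ (∅ : Finset (Fin m)))]
  congr 2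
  ext J
  simp [Finset.nonempty_iff_ne_empty]

variable {ω : ℝ → ℝ} {K : Rn n → (Fin m → Rn n) → ℂ}
  {T : MultilinearMap ℂ (fun _ : Fin m => 𝓢(Rn n, ℂ)) 𝓢'(Rn n, ℂ)}
  {q : Fin m → ℝ} {q₀ : ℝ}
  {S : MultilinearMap ℂ
      (fun i : Fin m => Lp ℂ (ENNReal.ofReal (q i)) (volume : Measure (Rn n)))
      (Rn n →ₘ[volume] ℂ)}

/-- On functions with bounded support, where the operator is already defined, its value agrees with
the one obtained by splitting. -/
theorem IsWeakExtension.ae_eq_splitValue (hS : IsWeakExtension T q q₀ S)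
    (hK : IsCZKernel ω K) (hω : IsDiniModulus ω) (hn : 1 ≤ n) (hTK : HasKernel T K)
    (hf : ∀ i, MemLp (f i) (ENNReal.ofReal (q i)) volume)
    (hfb : ∀ i, ∃ R, ∀ y, y ∉ Metric.closedBall 0 R → f i y = 0) (z : Rn n) (r : ℝ) :
    ∀ᵐ x, x ∈ Metric.ball z (2 * r) →
      S (fun i => classLp (q i) (f i)) x = splitValue K q S f z r x := by
  have h1 : ∀ᵐ x, ∀ J : Finset (Fin m), J.Nonempty → x ∈ Metric.ball z (2 * r) →
      S (fun i => classLp (q i) (piece f z r J i)) x = ∫ y, K x y * pieceProd f z r J y := by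
    refine ae_all_iff.2 fun J => ?_
    by_cases hJ : J.Nonempty
    · obtain ⟨k, hk⟩ := hJ
      filter_upwards [hS.ae_eq_integral hK hω hn hTK (f := piece f z r J)
        (fun i => memLp_piece (hf i) J) (fun i => by
          obtain ⟨R, hR⟩ := hfb i
          refine ⟨R, fun y hy => ?_⟩
          have := enorm_piece_le (f := f) (z := z) (r := r) J i y
          rw [hR y hy] at this
          simpa using this) (Metric.isOpen_ball (x := z) (ε := 2 * r)) (k := k)
          (fun y hy => piece_eq_zero_of_mem hk hy)] with x hx _ hxz
      exact hx hxz
    · exact Eventually.of_forall fun x h => absurd h hJ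
  filter_upwards [h1, ae_eq_sum_map_piece S hf z r] with x hx hx2 hxz
  rw [hx2, sum_finset_eq_empty_add, splitValue]
  congr 1
  exact Finset.sum_congr rfl fun J hJ => hx J (Finset.mem_filter.1 hJ).2 hxz

/-- The kernel part varies little on the ball along which the functions are split. -/
theorem KernelBounds.enorm_farValue_sub_le {A : ℝ} (hA : KernelBounds A ω K)
    (hω : IsDiniModulus ω) (hm : 1 ≤ m) (hr : 0 < r) {x : Rn n} (hx : x ∈ Metric.ball z r)
    (hf : ∀ i, AEStronglyMeasurable (f i) volume)
    (hint : ∀ J : Finset (Fin m), J.Nonempty → ∀ x ∈ Metric.ball z r,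
      Integrable fun y => K x y * pieceProd f z r J y)
    {a : Fin m → ℝ} (ha : ∀ i, 0 ≤ a i)
    (hav : ∀ i s, 2 * r ≤ s → ∫⁻ y in Metric.ball z s, ‖f i y‖ₑ ≤ ENNReal.ofReal (a i * s ^ n)) :
    ‖farValue K f z r z - farValue K f z r x‖ₑ ≤ 2 ^ m * (ENNReal.ofReal (A * 2 ^ (m * n) * ∏ i, a i) *
      ∑' k : ℕ, ENNReal.ofReal (ω ((1 / 2) ^ (k + 1)))) := by
  have hfar := hA.lintegral_far_sub_le hω hm hr hx (h := fun i y => ‖f i y‖ₑ)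
    (fun i => (hf i).enorm) ha hav
  have hB : MeasurableSet (Metric.ball (fun _ : Fin m => z) (2 * r))ᶜ := measurableSet_ball.compl
  have hJ : ∀ J ∈ (Finset.univ.filter fun J : Finset (Fin m) => J.Nonempty),
      ‖(∫ y, K z y * pieceProd f z r J y) - ∫ y, K x y * pieceProd f z r J y‖ₑ ≤
        ENNReal.ofReal (A * 2 ^ (m * n) * ∏ i, a i) *
          ∑' k : ℕ, ENNReal.ofReal (ω ((1 / 2) ^ (k + 1))) := by
    intro J hJ
    have hJ := (Finset.mem_filter.1 hJ).2
    rw [← integral_sub (hint J hJ z (Metric.mem_ball_self hr)) (hint J hJ x hx)]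
    refine (enorm_integral_le_lintegral_enorm _).trans (le_trans ?_ hfar)
    rw [← lintegral_indicator hB]
    refine lintegral_mono fun y => ?_
    by_cases hy : y ∈ Metric.ball (fun _ : Fin m => z) (2 * r)
    · simp [pieceProd_eq_zero_of_mem_ball hJ hr hy]
    · rw [indicator_of_mem (by simpa using hy), ← sub_mul, enorm_mul]
      exact mul_le_mul_right (enorm_pieceProd_le J y) _
  rw [farValue, farValue, ← Finset.sum_sub_distrib]
  refine (enorm_sum_le _ _).trans ((Finset.sum_le_sum hJ).trans ?_)
  rw [Finset.sum_const, nsmul_eq_mul]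
  refine mul_le_mul_left ?_ _
  have : (Finset.univ.filter fun J : Finset (Fin m) => J.Nonempty).card ≤ 2 ^ m := by
    refine (Finset.card_filter_le _ _).trans ?_
    simp [Fintype.card_finset]
  exact_mod_cast this

end Splitting


/-! ### The good-`λ` inequality -/

section GoodLambda

variable {n m : ℕ} {ω : ℝ → ℝ} {K : Rn n → (Fin m → Rn n) → ℂ}
  {T : MultilinearMap ℂ (fun _ : Fin m => 𝓢(Rn n, ℂ)) 𝓢'(Rn n, ℂ)}
  {q : Fin m → ℝ} {q₀ : ℝ}
  {S : MultilinearMap ℂ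
      (fun i : Fin m => Lp ℂ (ENNReal.ofReal (q i)) (volume : Measure (Rn n)))
      (Rn n →ₘ[volume] ℂ)}

theorem enorm_le_ofReal_iff {z : ℂ} {t : ℝ} (ht : 0 ≤ t) : ‖z‖ₑ ≤ ENNReal.ofReal t ↔ ‖z‖ ≤ t := by
  rw [← ofReal_norm, ENNReal.ofReal_le_ofReal_iff ht]

theorem ofReal_lt_enorm_iff {z : ℂ} {t : ℝ} (ht : 0 ≤ t) : ENNReal.ofReal t < ‖z‖ₑ ↔ t < ‖z‖ := by
  rw [← not_le, enorm_le_ofReal_iff ht, not_le]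

theorem IsBddFun.piece {f : Fin m → Rn n → ℂ} (hf : ∀ i, IsBddFun (f i)) (z : Rn n) (r : ℝ)
    (J : Finset (Fin m)) (i : Fin m) : IsBddFun (piece f z r J i) := by
  rw [_root_.piece]
  split_ifs
  · exact (hf i).indicator measurableSet_ball.compl
  · exact (hf i).indicator measurableSet_ball

/-- The local form of the good-`λ` inequality: on a ball at least half of whose points satisfy
`|T(f)| ≤ t`, and which contains a point where all the maximal functions are small compared with
`t`, the set where `|T(f)| > 2t` is a small part of the ball. -/
theorem IsWeakExtension.exists_good_lambda_local (hS : IsWeakExtension T q q₀ S)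
    (hK : IsCZKernel ω K) (hω : IsDiniModulus ω) (hn : 1 ≤ n) (hm : 1 ≤ m) (hTK : HasKernel T K)
    {δ : ℝ} (hδ : 0 < δ) :
    ∃ Γ : ℝ, 0 < Γ ∧ ∀ f : Fin m → Rn n → ℂ, (∀ i, IsBddFun (f i)) → ∀ (a : Fin m → ℝ) (t : ℝ),
      (∀ i, 0 < a i) → 0 < t → Γ * ∏ i, a i ≤ t → ∀ (c : Rn n) (r : ℝ), 0 < r →
      volume ({x | ENNReal.ofReal t < ‖S (fun i => classLp (q i) (f i)) x‖ₑ} ∩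
          Metric.closedBall c (5 * r)) ≤
        ENNReal.ofReal (1 / 2) * volume (Metric.closedBall c (5 * r)) →
      (∃ x₀ ∈ Metric.closedBall c (5 * r), ∀ i, x₀ ∉ highAvg (fun y => ‖f i y‖ₑ) (a i)) →
      volume ({x | ENNReal.ofReal (2 * t) < ‖S (fun i => classLp (q i) (f i)) x‖ₑ} ∩
        Metric.closedBall c (5 * r)) ≤ ENNReal.ofReal (δ * r ^ n) := by
  obtain ⟨A, hA⟩ := hK.exists_kernelBounds
  have hApos := hA.pos
  obtain ⟨C, hC⟩ := hS.exists_endpoint hK hω hn hTK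
  have hv := unitVol_pos n
  set D := ∑' k : ℕ, ENNReal.ofReal (ω ((1 / 2) ^ (k + 1))) with hD
  have hDr : D = ENNReal.ofReal D.toReal := (ENNReal.ofReal_toReal hω.tsum_ne_top).symm
  have hD0 : 0 ≤ D.toReal := ENNReal.toReal_nonneg
  -- `η` makes the exceptional set of the local part at most `δ r ^ n`, and at most a quarter of the unit
  -- ball times `r ^ n`; `τ a_i` are the levels for which `η r ^ n` is admissible in the endpoint bound.
  set η : ℝ := min δ (unitVol n / 4) / (C + 1) with hη
  have hη0 : 0 < η := by positivity
  have hCη1 : C * η ≤ δ := by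
    have h1 : (C : ℝ) * η ≤ (C + 1) * η := by gcongr; linarith
    have h2 : (C + 1) * η = min δ (unitVol n / 4) := by rw [hη]; field_simp
    exact h1.trans (h2.le.trans (min_le_left _ _))
  have hCη2 : C * η ≤ unitVol n / 4 := by
    have h1 : (C : ℝ) * η ≤ (C + 1) * η := by gcongr; linarith
    have h2 : (C + 1) * η = min δ (unitVol n / 4) := by rw [hη]; field_simp
    exact h1.trans (h2.le.trans (min_le_right _ _))
  set τ : ℝ := unitVol n * 2 ^ n * 12 ^ n / η with hτ
  have hτ0 : 0 < τ := by positivity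
  set Q : ℝ := 2 ^ m * (A * 2 ^ (m * n) * (unitVol n * 2 ^ n) ^ m * D.toReal) with hQ
  have hQ0 : 0 ≤ Q := by positivity
  refine ⟨4 * τ ^ m + 8 * Q, by positivity, ?_⟩
  intro f hf a t ha ht hat c r hr hhalf ⟨x₀, hx₀, hx₀f⟩
  have hP0 : 0 < ∏ i, a i := Finset.prod_pos fun i _ => ha i
  set P := ∏ i, a i with hP
  have hτP : τ ^ m * P ≤ t / 4 := by nlinarith
  have hQP : Q * P ≤ t / 8 := by nlinarith [pow_pos hτ0 m]
  -- the closed ball of radius `5 * r` lies in the open one of radius `R`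
  set R := 6 * r with hR
  have hR0 : 0 < R := by positivity
  -- the averages of `f` over the balls centred at `c` are controlled from `x₀`
  have hav : ∀ i s, 2 * R ≤ s →
      ∫⁻ y in Metric.ball c s, ‖f i y‖ₑ ≤ ENNReal.ofReal (unitVol n * 2 ^ n * a i * s ^ n) := by
    intro i s hs
    have hs0 : 0 < s := by linarith
    have hai := ha i
    have h1 : Metric.ball c s ⊆ Metric.closedBall x₀ (2 * s) := by
      intro y hy
      rw [Metric.mem_ball] at hy
      rw [Metric.mem_closedBall] at hx₀ ⊢
      have := dist_triangle y c x₀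
      rw [dist_comm c x₀] at this
      linarith
    calc _ ≤ ∫⁻ y in Metric.closedBall x₀ (2 * s), ‖f i y‖ₑ := lintegral_mono_set h1
      _ ≤ ENNReal.ofReal (a i) * volume (Metric.closedBall x₀ (2 * s)) :=
          setLIntegral_closedBall_le_of_notMem_highAvg (hx₀f i) (by positivity)
      _ = _ := by
          rw [volume_closedBall _ (by positivity), ← ENNReal.ofReal_mul (by positivity)]
          congr 1
          ring
  have hsub : Metric.closedBall c (5 * r) ⊆ Metric.ball c R := by
    intro y hy
    rw [Metric.mem_closedBall] at hy
    rw [Metric.mem_ball]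
    linarith
  have hint : ∀ J : Finset (Fin m), J.Nonempty → ∀ x ∈ Metric.ball c R,
      Integrable fun y => K x y * pieceProd f c R J y := by
    rintro J ⟨k, hk⟩ x hx
    refine hK.integrable_mul_of_far hω hn hR0 (k := k)
      (Integrable.fintype_prod fun i => (IsBddFun.piece hf c R J i).integrable) fun y hy => ?_
    refine pieceProd_eq_zero_of_mem hk ?_
    rw [Metric.mem_ball] at *
    have := dist_triangle (y k) x c
    linarith
  -- the far part of `T(f)` oscillates by at most `t / 8`
  have hosc : ∀ x ∈ Metric.ball c R, ‖farValue K f c R c - farValue K f c R x‖ ≤ t / 8 := by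
    intro x hx
    rw [← enorm_le_ofReal_iff (by positivity)]
    refine (hA.enorm_farValue_sub_le hω hm hR0 hx (fun i => (hf i).measurable.aestronglyMeasurable)
      hint (a := fun i => unitVol n * 2 ^ n * a i) (fun i => by have := ha i; positivity)
      hav).trans ?_
    rw [← hD, hDr, Finset.prod_mul_distrib, Finset.prod_const, Finset.card_univ, Fintype.card_fin,
      ← ENNReal.ofReal_mul (by positivity)]
    have e : (2 : ℝ≥0∞) ^ m = ENNReal.ofReal (2 ^ m) := by
      rw [ENNReal.ofReal_pow (by norm_num)]; simp
    rw [e, ← ENNReal.ofReal_mul (by positivity)]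
    refine ENNReal.ofReal_le_ofReal (le_trans (le_of_eq ?_) hQP)
    rw [hQ]; ring
  set G₀ := S (fun i => classLp (q i) (piece f c R ∅ i)) with hG₀
  set G := S (fun i => classLp (q i) (f i)) with hG
  have hsmall : volume {x | ENNReal.ofReal (t / 4) < ‖G₀ x‖ₑ} ≤ ENNReal.ofReal (C * η * r ^ n) := by
    have h1 := hC (piece f c R ∅) (IsBddFun.piece hf c R ∅) (fun i => τ * a i) (η * r ^ n)
      (fun i => by have := ha i; positivity) (by positivity) (fun i => by
        have h2 := hav i (2 * R) le_rfl
        simp only [piece, Finset.notMem_empty, if_false]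
        simp_rw [enorm_indicator_eq_indicator_enorm]
        rw [lintegral_indicator measurableSet_ball]
        refine h2.trans (le_of_eq ?_)
        congr 1
        rw [hτ, hR]
        field_simp
        ring)
    rw [Finset.prod_mul_distrib, Finset.prod_const, Finset.card_univ, Fintype.card_fin] at h1
    refine (measure_mono fun x hx => ?_).trans (h1.trans (le_of_eq ?_))
    · exact (ENNReal.ofReal_le_ofReal hτP).trans_lt hx
    · rw [← ENNReal.ofReal_coe_nnreal, ← ENNReal.ofReal_mul (by positivity), mul_assoc]
  have hval := hS.ae_eq_splitValue hK hω hn hTK (f := f) (fun i => (hf i).memLp _)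
    (fun i => (hf i).supp) c R
  have hval' : ∀ᵐ x, x ∈ Metric.closedBall c (5 * r) → G x = G₀ x + farValue K f c R x := by
    filter_upwards [hval] with x hx hxc
    exact hx (Metric.ball_subset_ball (by linarith) (hsub hxc))
  -- a point where both `T(f)` and its local part are small
  obtain ⟨x₁, hx₁c, hx₁, hx₁0, hx₁v⟩ : ∃ x₁ ∈ Metric.closedBall c (5 * r), ‖G x₁‖ ≤ t ∧
      ‖G₀ x₁‖ ≤ t / 4 ∧ G x₁ = G₀ x₁ + farValue K f c R x₁ := by
    by_contra! hno
    have hcov : volume (Metric.closedBall c (5 * r)) ≤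
        volume (({x | ENNReal.ofReal t < ‖G x‖ₑ} ∩ Metric.closedBall c (5 * r)) ∪
          {x | ENNReal.ofReal (t / 4) < ‖G₀ x‖ₑ}) := by
      refine measure_mono_ae ?_
      filter_upwards [hval'] with x hx hxc
      by_contra hxn
      change x ∉ ({x | ENNReal.ofReal t < ‖G x‖ₑ} ∩ Metric.closedBall c (5 * r)) ∪
          {x | ENNReal.ofReal (t / 4) < ‖G₀ x‖ₑ} at hxn
      simp only [mem_union, not_or, mem_inter_iff, not_and, mem_ofPred_eq] at hxn
      rw [ofReal_lt_enorm_iff ht.le, ofReal_lt_enorm_iff (by positivity), not_lt] at hxn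
      have h1 : ‖G x‖ ≤ t := by
        by_contra! h
        exact hxn.1 h hxc
      exact hno x hxc h1 hxn.2 (hx hxc)
    have h2 := hcov.trans ((measure_union_le _ _).trans (add_le_add hhalf hsmall))
    rw [volume_closedBall _ (by positivity), ← ENNReal.ofReal_mul (by positivity),
      ← ENNReal.ofReal_add (by positivity) (by positivity),
      ENNReal.ofReal_le_ofReal_iff (by positivity)] at h2
    have h3 : C * η * r ^ n ≤ unitVol n / 4 * r ^ n := by gcongr
    have h4 : (5 * r) ^ n = 5 ^ n * r ^ n := mul_pow _ _ _
    have h5 : (1 : ℝ) ≤ 5 ^ n := one_le_pow₀ (by norm_num)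
    have h6 : unitVol n * r ^ n ≤ unitVol n * (5 * r) ^ n := by
      rw [h4]
      have : 0 < r ^ n := by positivity
      gcongr
      nlinarith
    have : 0 < unitVol n * r ^ n := by positivity
    linarith
  calc _ ≤ volume {x | ENNReal.ofReal (t / 4) < ‖G₀ x‖ₑ} := by
        refine measure_mono_ae ?_
        filter_upwards [hval'] with x hx hxc
        obtain ⟨hx2, hxc⟩ := hxc
        change ENNReal.ofReal (2 * t) < ‖G x‖ₑ at hx2
        change ENNReal.ofReal (t / 4) < ‖G₀ x‖ₑ
        rw [ofReal_lt_enorm_iff (by positivity)] at hx2 ⊢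
        rw [hx hxc] at hx2
        have h1 := hosc x (hsub hxc)
        have h2 := hosc x₁ (hsub hx₁c)
        -- `|T(f)| > 2 t` at `x` and `|far part| ≤ 3 t / 2` there, hence the local part exceeds `t / 4`
        have h3 : ‖farValue K f c R x₁‖ ≤ t + t / 4 := by
          have : farValue K f c R x₁ = G x₁ - G₀ x₁ := by rw [hx₁v]; ring
          rw [this]
          exact (norm_sub_le _ _).trans (add_le_add hx₁ hx₁0)
        have h4 : ‖farValue K f c R x‖ ≤ ‖farValue K f c R x₁‖ +
            ‖farValue K f c R c - farValue K f c R x₁‖ +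
            ‖farValue K f c R c - farValue K f c R x‖ := by
          have : farValue K f c R x = farValue K f c R x₁ +
            (farValue K f c R c - farValue K f c R x₁) -
            (farValue K f c R c - farValue K f c R x) := by ring
          calc _ = _ := congrArg norm this
            _ ≤ _ := (norm_sub_le _ _).trans (add_le_add (norm_add_le _ _) le_rfl)
        have h5 := norm_add_le (G₀ x) (farValue K f c R x)
        linarith
    _ ≤ _ := hsmall
    _ ≤ _ := ENNReal.ofReal_le_ofReal (by gcongr)

/-- The good-`λ` inequality between `T(f)` and the maximal functions of the `f_i`. -/
theorem IsWeakExtension.exists_good_lambda (hS : IsWeakExtension T q q₀ S)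
    (hK : IsCZKernel ω K) (hω : IsDiniModulus ω) (hn : 1 ≤ n) (hm : 1 ≤ m) (hTK : HasKernel T K)
    {ε : ℝ} (hε : 0 < ε) :
    ∃ Γ : ℝ, 0 < Γ ∧ ∀ f : Fin m → Rn n → ℂ, (∀ i, IsBddFun (f i)) → ∀ (a : Fin m → ℝ) (t : ℝ),
      (∀ i, 0 < a i) → 0 < t → Γ * ∏ i, a i ≤ t →
      volume {x | ENNReal.ofReal t < ‖S (fun i => classLp (q i) (f i)) x‖ₑ} ≠ ∞ →
      volume {x | ENNReal.ofReal (2 * t) < ‖S (fun i => classLp (q i) (f i)) x‖ₑ} ≤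
        ∑ i, volume (highAvg (fun y => ‖f i y‖ₑ) (a i)) +
          ENNReal.ofReal ε * volume {x | ENNReal.ofReal t <
            ‖S (fun i => classLp (q i) (f i)) x‖ₑ} := by
  have hv := unitVol_pos n
  obtain ⟨Γ, hΓ0, hΓ⟩ := hS.exists_good_lambda_local hK hω hn hm hTK
    (δ := ε / 2 * unitVol n) (by positivity)
  refine ⟨Γ, hΓ0, fun f hf a t ha ht hat hfin => ?_⟩
  set G := S (fun i => classLp (q i) (f i)) with hG
  set E := {x | ENNReal.ofReal t < ‖G x‖ₑ} with hE
  set E₂ := {x | ENNReal.ofReal (2 * t) < ‖G x‖ₑ} with hE₂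
  have hEm : MeasurableSet E :=
    measurableSet_lt measurable_const G.stronglyMeasurable.measurable.enorm
  -- Stopping balls for the indicator of `E` at height `1 / 2`: the doubling condition says that `E` fills
  -- at most half of the enlarged balls, as the local inequality requires.
  have hE₂E : E₂ ⊆ E := fun x hx => (ENNReal.ofReal_le_ofReal (by linarith)).trans_lt hx
  have hIE : ∫⁻ x, E.indicator 1 x = volume E := lintegral_indicator_one hEm
  obtain ⟨u, r, hu, hr, hlow, hup, hdisj, hcov⟩ := exists_stopping_balls hn
    (f := E.indicator 1) (hIE ▸ hfin) (a := 1 / 2) (by norm_num)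
  have hball : ∀ c ρ, ∫⁻ y in Metric.closedBall c ρ, E.indicator 1 y =
      volume (E ∩ Metric.closedBall c ρ) := by
    intro c ρ
    rw [lintegral_indicator_one hEm, Measure.restrict_apply hEm]
  set H := ⋃ i, highAvg (fun y => ‖f i y‖ₑ) (a i) with hH
  have hloc : ∀ c ∈ u, volume ((E₂ ∩ Metric.closedBall c (5 * r c)) \ H) ≤
      ENNReal.ofReal (ε / 2) * volume (Metric.closedBall c (r c)) := by
    intro c hc
    have hrc := hr c hc
    rcases eq_empty_or_nonempty ((E₂ ∩ Metric.closedBall c (5 * r c)) \ H) with h0 | ⟨x₀, hx₀, hx₀H⟩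
    · rw [h0]; simp
    · refine (measure_mono sdiff_subset).trans ?_
      have h1 := hΓ f hf a t ha ht hat c (r c) hrc
        (by rw [← hball]; exact hup c hc _ (by linarith))
        ⟨x₀, hx₀.2, fun i hi => hx₀H (mem_iUnion.2 ⟨i, hi⟩)⟩
      refine h1.trans (le_of_eq ?_)
      rw [volume_closedBall _ hrc.le, ← ENNReal.ofReal_mul (by positivity), mul_assoc]
  have hcover : volume E₂ ≤ volume (H ∪ ⋃ c ∈ u, (E₂ ∩ Metric.closedBall c (5 * r c)) \ H) := by
    refine measure_mono_ae ?_
    filter_upwards [ae_le_of_notMem_highAvg (f := E.indicator 1)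
      ((measurable_one.indicator hEm).aemeasurable) (hIE ▸ hfin) (1 / 2)] with x hx hx2
    change x ∈ H ∪ ⋃ c ∈ u, (E₂ ∩ Metric.closedBall c (5 * r c)) \ H
    have hx2 : x ∈ E₂ := hx2
    by_cases hxH : x ∈ H
    · exact Or.inl hxH
    · right
      have hxa : x ∈ highAvg (E.indicator 1) (1 / 2) := by
        by_contra hno
        have := hx hno
        rw [indicator_of_mem (hE₂E hx2)] at this
        have h3 : ENNReal.ofReal (1 / 2) < 1 := by
          rw [← ENNReal.ofReal_one]; exact (ENNReal.ofReal_lt_ofReal_iff one_pos).2 (by norm_num)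
        exact absurd this (not_le.2 h3)
      obtain ⟨c, hc, hxc⟩ := mem_iUnion₂.1 (hcov hxa)
      exact mem_iUnion₂.2 ⟨c, hc, ⟨hx2, hxc⟩, hxH⟩
  refine hcover.trans ((measure_union_le _ _).trans (add_le_add ?_ ?_))
  · simpa using measure_iUnion_fintype_le volume fun i => highAvg (fun y => ‖f i y‖ₑ) (a i)
  · have := hu.to_subtype
    have hcount := tsum_volume_le_of_disjoint hu hlow hdisj
    rw [hIE] at hcount
    calc _ ≤ ∑' c : u, volume ((E₂ ∩ Metric.closedBall (c : Rn n) (5 * r c)) \ H) := by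
          rw [biUnion_eq_iUnion]; exact measure_iUnion_le _
      _ ≤ ∑' c : u, ENNReal.ofReal (ε / 2) * volume (Metric.closedBall (c : Rn n) (r c)) :=
          ENNReal.tsum_le_tsum fun c => hloc c c.2
      _ = ENNReal.ofReal ε * (ENNReal.ofReal (1 / 2) *
            ∑' c : u, volume (Metric.closedBall (c : Rn n) (r c))) := by
          rw [ENNReal.tsum_mul_left, ← mul_assoc, ← ENNReal.ofReal_mul hε.le]
          congr 2; ring
      _ ≤ _ := by gcongr

end GoodLambda


/-! ### The strong-type estimate -/

section StrongType

variable {n m : ℕ} {ω : ℝ → ℝ} {K : Rn n → (Fin m → Rn n) → ℂ}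
  {T : MultilinearMap ℂ (fun _ : Fin m => 𝓢(Rn n, ℂ)) 𝓢'(Rn n, ℂ)}
  {q : Fin m → ℝ} {q₀ : ℝ}
  {S : MultilinearMap ℂ
      (fun i : Fin m => Lp ℂ (ENNReal.ofReal (q i)) (volume : Measure (Rn n)))
      (Rn n →ₘ[volume] ℂ)}

theorem highAvg_antitone (f : Rn n → ℝ≥0∞) : Antitone (highAvg f) := by
  rintro a b hab x ⟨r, hr, hx⟩
  exact ⟨r, hr, (mul_le_mul_left (ENNReal.ofReal_le_ofReal hab) _).trans_lt hx⟩

theorem measurable_volume_highAvg (f : Rn n → ℝ≥0∞) :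
    Measurable fun a => volume (highAvg f a) :=
  Antitone.measurable fun _ _ hab => measure_mono (highAvg_antitone f hab)

/-- For bounded functions with bounded support the distribution function of `T(f)` is
`O(t^{-1/m})`. This makes the truncated integrals in `lintegral_le_of_good_lambda` finite. -/
theorem IsWeakExtension.exists_distribution_le (hS : IsWeakExtension T q q₀ S)
    (hK : IsCZKernel ω K) (hω : IsDiniModulus ω) (hn : 1 ≤ n) (hm : 1 ≤ m) (hTK : HasKernel T K)
    {f : Fin m → Rn n → ℂ} (hf : ∀ i, IsBddFun (f i)) :
    ∃ M : ℝ, 0 ≤ M ∧ ∀ t : ℝ, 0 < t →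
      volume {x | ENNReal.ofReal t < ‖S (fun i => classLp (q i) (f i)) x‖ₑ} ≤
        ENNReal.ofReal (M * t ^ (-(1 / m : ℝ))) := by
  obtain ⟨C, hC⟩ := hS.exists_endpoint hK hω hn hTK
  set M : ℝ := ∑ i, (∫⁻ y, ‖f i y‖ₑ).toReal + 1 with hM
  have hM0 : 0 < M := by positivity
  have hm0 : (m : ℝ) ≠ 0 := by positivity
  refine ⟨C * M, by positivity, fun t ht => ?_⟩
  -- the endpoint bound with all levels equal to `t^{1/m}`
  have h1 := hC f hf (fun _ => t ^ (1 / m : ℝ)) (M * t ^ (-(1 / m : ℝ)))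
    (fun i => by positivity) (by positivity) (fun i => by
      rw [← ENNReal.ofReal_toReal (hf i).integrable.2.ne]
      refine ENNReal.ofReal_le_ofReal ?_
      have e : t ^ (1 / m : ℝ) * (M * t ^ (-(1 / m : ℝ))) = M := by
        rw [Real.rpow_neg ht.le]
        have : t ^ (1 / m : ℝ) ≠ 0 := by positivity
        field_simp
      rw [e, hM]
      have := Finset.single_le_sum (f := fun i => (∫⁻ y, ‖f i y‖ₑ).toReal)
        (fun i _ => ENNReal.toReal_nonneg) (Finset.mem_univ i)
      linarith)
  rw [Finset.prod_const, Finset.card_univ, Fintype.card_fin, ← Real.rpow_natCast,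
    ← Real.rpow_mul ht.le, one_div_mul_cancel hm0, Real.rpow_one] at h1
  refine h1.trans (le_of_eq ?_)
  rw [← ENNReal.ofReal_coe_nnreal, ← ENNReal.ofReal_mul (by positivity), mul_assoc]

/-- The strong bound in a non-homogeneous form: the good-`λ` inequality with the levels
`(t / Γ)^{p / p_i}`, whose product is `t / Γ`, integrated against `t^{p - 1}`. -/
theorem IsWeakExtension.exists_lintegral_rpow_le (hS : IsWeakExtension T q q₀ S)
    (hK : IsCZKernel ω K) (hω : IsDiniModulus ω) (hn : 1 ≤ n) (hm : 1 ≤ m) (hTK : HasKernel T K)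
    {p : ℝ} (hp : 1 < p) {ps : Fin m → ℝ} (hps : ∀ i, 1 < ps i) (hsum : ∑ i, 1 / ps i = 1 / p) :
    ∃ C : ℝ≥0, ∀ f : Fin m → Rn n → ℂ, (∀ i, IsBddFun (f i)) →
      ∫⁻ x, ‖S (fun i => classLp (q i) (f i)) x‖ₑ ^ p ≤ C * ∑ i, ∫⁻ x, ‖f i x‖ₑ ^ ps i := by
  have hp0 : 0 < p := by linarith
  obtain ⟨Γ, hΓ0, hΓ⟩ := hS.exists_good_lambda hK hω hn hm hTK (ε := 2 ^ (-p) / 2) (by positivity)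
  have hγ : 0 < 1 / Γ := by positivity
  choose C hC using fun i => lintegral_volume_highAvg_le hn hp0 (hps i) hγ
  refine ⟨p.toNNReal * ((2 * 2 ^ p : ℝ).toNNReal * ∑ i, C i), fun f hf => ?_⟩
  set G := S (fun i => classLp (q i) (f i)) with hG
  obtain ⟨M, hM0, hM⟩ := hS.exists_distribution_le hK hω hn hm hTK hf
  set D : ℝ → ℝ≥0∞ := fun t => volume {x | ENNReal.ofReal t < ‖G x‖ₑ} with hD
  set H : ℝ → ℝ≥0∞ := fun t =>
    ∑ i, volume (highAvg (fun y => ‖f i y‖ₑ) ((1 / Γ * t) ^ (p / ps i))) with hH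
  have hDanti : Antitone D := fun s t hst => measure_mono fun x hx =>
    (ENNReal.ofReal_le_ofReal hst).trans_lt hx
  have hgl := lintegral_le_of_good_lambda (p := p) (D := D) (H := H) hDanti (fun N hN => by
      have hs : 0 < p - 1 / m := by
        have : (1 : ℝ) / m ≤ 1 := by
          rw [div_le_one (by positivity)]; exact_mod_cast hm
        linarith
      refine ne_top_of_le_ne_top (b := ENNReal.ofReal M *
        ∫⁻ t in Ioo 0 N, ENNReal.ofReal (t ^ (p - 1 / m - 1))) ?_ ?_
      · rw [lintegral_Ioo_rpow hs hN.le]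
        exact ENNReal.mul_ne_top ENNReal.ofReal_ne_top ENNReal.ofReal_ne_top
      · rw [← lintegral_const_mul' _ _ ENNReal.ofReal_ne_top]
        refine setLIntegral_mono' measurableSet_Ioo fun t ht => ?_
        have ht0 : 0 < t := ht.1
        refine (mul_le_mul_right (hM t ht0) _).trans (le_of_eq ?_)
        rw [← ENNReal.ofReal_mul (by positivity), ← ENNReal.ofReal_mul hM0]
        congr 1
        have e : t ^ (p - 1 / m - 1) = t ^ (p - 1) * t ^ (-(1 / m : ℝ)) := by
          rw [← Real.rpow_add ht0]; congr 1; ring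
        rw [e]; ring) (fun t ht => by
      have hγt : 0 < 1 / Γ * t := by positivity
      refine hΓ f hf (fun i => (1 / Γ * t) ^ (p / ps i)) t (fun i => by positivity) ht ?_
        (ne_top_of_le_ne_top ENNReal.ofReal_ne_top (hM t ht))
      rw [← Real.rpow_sum_of_pos hγt]
      have e : ∑ i, p / ps i = 1 := by
        have : ∀ i, p / ps i = p * (1 / ps i) := fun i => by ring
        simp_rw [this]
        rw [← Finset.mul_sum, hsum, mul_one_div_cancel hp0.ne']
      rw [e, Real.rpow_one]
      field_simp
      exact le_rfl)
  have hHle : ∫⁻ t in Ioi (0 : ℝ), ENNReal.ofReal (t ^ (p - 1)) * H t ≤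
      (∑ i, (C i : ℝ≥0∞)) * ∑ i, ∫⁻ x, ‖f i x‖ₑ ^ ps i := by
    simp only [hH, Finset.mul_sum]
    rw [lintegral_finsetSum]
    · refine Finset.sum_le_sum fun i _ => ?_
      refine (hC i _ (hf i).enorm_aemeasurable).trans ?_
      refine mul_le_mul_left ?_ _
      exact Finset.single_le_sum (f := fun i => (C i : ℝ≥0∞)) (fun i _ => zero_le)
        (Finset.mem_univ i)
    · intro i _
      refine Measurable.mul (by fun_prop) ?_
      exact (measurable_volume_highAvg fun y => ‖f i y‖ₑ).comp
        (g := fun a => volume (highAvg (fun y => ‖f i y‖ₑ) a)) (by fun_prop)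
  have hcake : ∫⁻ x, ‖G x‖ₑ ^ p =
      ENNReal.ofReal p * ∫⁻ t in Ioi (0 : ℝ), ENNReal.ofReal (t ^ (p - 1)) * D t := by
    have h1 := lintegral_rpow_eq_lintegral_meas_lt_mul (μ := (volume : Measure (Rn n)))
      (f := fun x => ‖G x‖) (Eventually.of_forall fun x => norm_nonneg _)
      G.aestronglyMeasurable.norm.aemeasurable hp0
    calc _ = ∫⁻ x, ENNReal.ofReal (‖G x‖ ^ p) := by
          refine lintegral_congr fun x => ?_
          rw [← ofReal_norm, ENNReal.ofReal_rpow_of_nonneg (norm_nonneg _) hp0.le]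
      _ = _ := h1
      _ = _ := by
          congr 1
          refine setLIntegral_congr_fun measurableSet_Ioi fun t ht => ?_
          have ht0 : 0 < t := ht
          simp only [hD, ofReal_lt_enorm_iff ht0.le]
          rw [mul_comm]
  rw [hcake]
  calc _ ≤ ENNReal.ofReal p * (ENNReal.ofReal (2 * 2 ^ p) *
        ((∑ i, (C i : ℝ≥0∞)) * ∑ i, ∫⁻ x, ‖f i x‖ₑ ^ ps i)) :=
        mul_le_mul_right (hgl.trans (mul_le_mul_right hHle _)) _
    _ = _ := by
        push_cast
        rw [← ENNReal.ofReal.eq_1, ← ENNReal.ofReal.eq_1]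
        ring

/-- The strong bound `L^{p_1} × ⋯ × L^{p_m} → L^p` on bounded functions with bounded support. -/
theorem IsWeakExtension.exists_eLpNorm_le (hS : IsWeakExtension T q q₀ S)
    (hK : IsCZKernel ω K) (hω : IsDiniModulus ω) (hn : 1 ≤ n) (hm : 1 ≤ m) (hTK : HasKernel T K)
    {p : ℝ} (hp : 1 < p) {ps : Fin m → ℝ} (hps : ∀ i, 1 < ps i) (hsum : ∑ i, 1 / ps i = 1 / p) :
    ∃ C : ℝ≥0, ∀ f : Fin m → Rn n → ℂ, (∀ i, IsBddFun (f i)) →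
      eLpNorm (S fun i => classLp (q i) (f i)) (ENNReal.ofReal p) volume ≤
        C * ∏ i, eLpNorm (f i) (ENNReal.ofReal (ps i)) volume := by
  obtain ⟨C, hC⟩ := hS.exists_lintegral_rpow_le hK hω hn hm hTK hp hps hsum
  have hp0 : 0 < p := by linarith
  have hps0 : ∀ i, 0 < ps i := fun i => by linarith [hps i]
  have heL : ∀ {s : ℝ}, 0 < s → ∀ g : Rn n → ℂ,
      eLpNorm g (ENNReal.ofReal s) volume = (∫⁻ x, ‖g x‖ₑ ^ s) ^ (1 / s) := by
    intro s hs g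
    rw [eLpNorm_eq_lintegral_rpow_enorm_toReal (by simpa using hs) ENNReal.ofReal_ne_top,
      ENNReal.toReal_ofReal hs.le]
  refine ⟨(C * m) ^ (1 / p), fun f hf => ?_⟩
  by_cases hz : ∃ i, eLpNorm (f i) (ENNReal.ofReal (ps i)) volume = 0
  · obtain ⟨i, hi⟩ := hz
    rw [eLpNorm_eq_zero_iff (hf i).measurable.aestronglyMeasurable
      (by simpa using hps0 i)] at hi
    have h0 : classLp (q i) (f i) = 0 := by
      rw [classLp_congr hi, classLp_of_memLp MemLp.zero]
      exact MemLp.toLp_zero _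
    have h1 : S (fun i => classLp (q i) (f i)) = 0 := S.map_coord_zero i h0
    rw [h1, eLpNorm_congr_ae AEEqFun.coeFn_zero]
    simp
  push Not at hz
  -- homogeneity: the functions are scaled to norm one
  set N : Fin m → ℝ≥0∞ := fun i => eLpNorm (f i) (ENNReal.ofReal (ps i)) volume with hN
  have hNtop : ∀ i, N i ≠ ∞ := fun i => ((hf i).memLp _).eLpNorm_ne_top
  set c : Fin m → ℂ := fun i => (((N i).toReal⁻¹ : ℝ) : ℂ) with hc
  have hcN : ∀ i, ‖c i‖ₑ * N i = 1 := by
    intro i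
    have h0 : 0 < (N i).toReal := ENNReal.toReal_pos (hz i) (hNtop i)
    rw [hc, ← ofReal_norm, Complex.norm_real, Real.norm_of_nonneg (by positivity),
      ENNReal.ofReal_inv_of_pos h0, ENNReal.ofReal_toReal (hNtop i)]
    exact ENNReal.inv_mul_cancel (hz i) (hNtop i)
  have hcf : ∀ i, ∫⁻ x, ‖(c i • f i) x‖ₑ ^ ps i = 1 := by
    intro i
    have h1 : eLpNorm (c i • f i) (ENNReal.ofReal (ps i)) volume = 1 := by
      rw [eLpNorm_const_smul]; exact hcN i
    rw [heL (hps0 i)] at h1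
    have h2 := congrArg (fun x : ℝ≥0∞ => x ^ ps i) h1
    simpa [← ENNReal.rpow_mul, (hps0 i).ne'] using h2
  have h1 := hC (fun i => c i • f i) fun i => (hf i).const_smul (c i)
  simp_rw [hcf] at h1
  have h2 : S (fun i => classLp (q i) (c i • f i)) =
      (∏ i, c i) • S (fun i => classLp (q i) (f i)) := by
    rw [← S.map_smul_univ]
    congr 1
    ext1 i
    exact classLp_const_smul _ ((hf i).memLp _)
  have h3 : eLpNorm (S fun i => classLp (q i) (c i • f i)) (ENNReal.ofReal p) volume ≤
      ((C * m) ^ (1 / p) : ℝ≥0) := by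
    rw [heL hp0, ENNReal.coe_rpow_of_nonneg _ (by positivity)]
    refine ENNReal.rpow_le_rpow ?_ (by positivity)
    simpa using h1
  rw [h2, eLpNorm_congr_ae (AEEqFun.coeFn_smul _ _), eLpNorm_const_smul, enorm_prod_eq] at h3
  calc eLpNorm (S fun i => classLp (q i) (f i)) (ENNReal.ofReal p) volume
      = ((∏ i, ‖c i‖ₑ) * eLpNorm (S fun i => classLp (q i) (f i)) (ENNReal.ofReal p) volume) *
          ∏ i, N i := by
        rw [mul_right_comm, ← Finset.prod_mul_distrib]
        simp [hcN]
    _ ≤ _ := mul_le_mul_left h3 _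

/-- Truncations to large balls converge in `L^s`. -/
theorem tendsto_eLpNorm_indicator_sub {s : ℝ} (hs : 0 < s) {f : Rn n → ℂ}
    (hf : MemLp f (ENNReal.ofReal s) volume) :
    Tendsto (fun N : ℕ => eLpNorm ((Metric.closedBall 0 (N : ℝ)).indicator f - f)
      (ENNReal.ofReal s) volume) atTop (𝓝 0) := by
  have hs' : ENNReal.ofReal s ≠ 0 := by simpa using hs
  have hfin : ∫⁻ x, ‖f x‖ₑ ^ s ≠ ∞ := by
    have := lintegral_rpow_enorm_lt_top_of_eLpNorm_lt_top hs' ENNReal.ofReal_ne_top hf.2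
    rw [ENNReal.toReal_ofReal hs.le] at this
    exact this.ne
  have hlim : Tendsto (fun N : ℕ => ∫⁻ x, ‖((Metric.closedBall 0 (N : ℝ)).indicator f - f) x‖ₑ ^ s)
      atTop (𝓝 (∫⁻ _ : Rn n, 0)) := by
    refine tendsto_lintegral_of_dominated_convergence' (fun x => ‖f x‖ₑ ^ s)
      (fun N => ?_) (fun N => Eventually.of_forall fun x => ?_) hfin
      (Eventually.of_forall fun x => ?_)
    · exact (((hf.1.indicator measurableSet_closedBall).sub hf.1).enorm).pow_const _
    · refine ENNReal.rpow_le_rpow ?_ hs.le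
      by_cases hx : x ∈ Metric.closedBall (0 : Rn n) (N : ℝ) <;> simp [hx]
    · refine tendsto_const_nhds.congr' ?_
      obtain ⟨N₀, hN₀⟩ := exists_nat_ge ‖x‖
      filter_upwards [eventually_ge_atTop N₀] with N hN
      have hx : x ∈ Metric.closedBall (0 : Rn n) (N : ℝ) := by
        rw [mem_closedBall_zero_iff]; exact hN₀.trans (by exact_mod_cast hN)
      simp [hx, hs]
  rw [lintegral_zero] at hlim
  have h2 := hlim.ennrpow_const (1 / s)
  rw [ENNReal.zero_rpow_of_pos (by positivity)] at h2
  refine h2.congr fun N => ?_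
  rw [eLpNorm_eq_lintegral_rpow_enorm_toReal hs' ENNReal.ofReal_ne_top,
    ENNReal.toReal_ofReal hs.le]

/-- The strong bound for test functions. -/
theorem IsWeakExtension.exists_eLpNorm_schwartz_le (hS : IsWeakExtension T q q₀ S)
    (hK : IsCZKernel ω K) (hω : IsDiniModulus ω) (hn : 1 ≤ n) (hm : 1 ≤ m) (hTK : HasKernel T K)
    {p : ℝ} (hp : 1 < p) {ps : Fin m → ℝ} (hps : ∀ i, 1 < ps i) (hsum : ∑ i, 1 / ps i = 1 / p) :
    ∃ C : ℝ≥0, ∀ f : Fin m → 𝓢(Rn n, ℂ),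
      eLpNorm (S fun i => (f i).toLp (ENNReal.ofReal (q i)) volume) (ENNReal.ofReal p) volume ≤
        C * ∏ i, eLpNorm (f i) (ENNReal.ofReal (ps i)) volume := by
  obtain ⟨C, hC⟩ := hS.exists_eLpNorm_le hK hω hn hm hTK hp hps hsum
  refine ⟨C, fun f => ?_⟩
  set u : ℕ → Fin m → Rn n → ℂ := fun N i => (Metric.closedBall 0 (N : ℝ)).indicator (f i) with hu
  have hut : ∀ N i, IsBddFun (u N i) := by
    intro N i
    refine ⟨(f i).continuous.measurable.indicator measurableSet_closedBall, ?_, ⟨N, fun x hx => ?_⟩⟩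
    · refine ⟨SchwartzMap.seminorm ℝ 0 0 (f i), fun x => ?_⟩
      exact (norm_indicator_le_norm_self _ _).trans (SchwartzMap.norm_le_seminorm ℝ (f i) x)
    · simp [hu, hx]
  have hq0 : ∀ i, 0 < q i := fun i => zero_lt_one.trans (hS.one_lt i)
  have hmeas := hS.tendstoInMeasure (u := fun N i => classLp (q i) (u N i))
    (v := fun i => classLp (q i) (f i)) (fun i => by
      refine (tendsto_eLpNorm_indicator_sub (hq0 i) ((f i).memLp (ENNReal.ofReal (q i)) volume)).congr
        fun N => ?_
      rw [← classLp_sub ((hut N i).memLp _) ((f i).memLp _ _),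
        eLpNorm_classLp (((hut N i).memLp _).sub ((f i).memLp _ _))])
  obtain ⟨ns, -, hns⟩ := hmeas.exists_seq_tendsto_ae
  simp_rw [classLp_schwartz] at hns
  refine (Lp.eLpNorm_lim_le_liminf_eLpNorm (fun N => AEEqFun.aestronglyMeasurable _) _ hns).trans ?_
  refine liminf_le_of_le (by isBoundedDefault) fun b hb => ?_
  obtain ⟨N, hN⟩ := hb.exists
  refine hN.trans ((hC _ (hut _)).trans (mul_le_mul_right ?_ _))
  exact Finset.prod_le_prod' fun i _ => eLpNorm_indicator_le _

end StrongType


/-! ### Extension by density -/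

/-- A multilinear map on vector spaces which are mapped to dense subspaces of normed spaces, bounded
with respect to the norms of these, extends to a bounded multilinear map. -/
theorem exists_multilinear_extension {ι : Type*} [Fintype ι] {V E : ι → Type*} {F : Type*}
    [∀ i, AddCommGroup (V i)] [∀ i, Module ℂ (V i)] [∀ i, NormedAddCommGroup (E i)]
    [∀ i, NormedSpace ℂ (E i)] [NormedAddCommGroup F] [NormedSpace ℂ F] [CompleteSpace F]
    (e : ∀ i, V i →ₗ[ℂ] E i) (he : ∀ i, DenseRange (e i)) (t : MultilinearMap ℂ V F) {C : ℝ}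
    (hC : 0 ≤ C) (ht : ∀ v, ‖t v‖ ≤ C * ∏ i, ‖e i (v i)‖) :
    ∃ T : MultilinearMap ℂ E F, (∀ x, ‖T x‖ ≤ C * ∏ i, ‖x i‖) ∧ ∀ v, T (fun i => e i (v i)) = t v := by
  set ev : (∀ i, V i) → ∀ i, E i := fun v i => e i (v i) with hev
  set k := Fintype.card ι with hk
  have hsub : ∀ v w, ‖t v - t w‖ ≤ C * k * max ‖ev v‖ ‖ev w‖ ^ (k - 1) * ‖ev v - ev w‖ := by
    intro v w
    -- with the seminorms pulled back along `e`, this is the general bound for multilinear maps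
    let : ∀ i, SeminormedAddCommGroup (V i) := fun i => SeminormedAddCommGroup.induced _ _ (e i)
    let : ∀ i, NormedSpace ℂ (V i) := fun i => NormedSpace.induced ℂ _ _ (e i)
    have h := t.norm_image_sub_le_of_bound hC ht v w
    have hn : ∀ v : ∀ i, V i, ‖v‖ = ‖ev v‖ := fun v => rfl
    have h2 : ‖v - w‖ = ‖ev v - ev w‖ := by
      rw [hn]; congr 1; ext1 i; simp [hev]
    rwa [hn, hn, h2] at h
  have hlim : ∀ {α : Type _} {l : Filter α} {a b : α → ∀ i, V i} {x : ∀ i, E i},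
      Tendsto (fun j => ev (a j)) l (𝓝 x) → Tendsto (fun j => ev (b j)) l (𝓝 x) →
      Tendsto (fun j => t (a j) - t (b j)) l (𝓝 0) := by
    intro α l a b x ha hb
    refine squeeze_zero_norm (fun j => hsub (a j) (b j)) ?_
    have h1 : Tendsto (fun j => C * k * max ‖ev (a j)‖ ‖ev (b j)‖ ^ (k - 1) *
        ‖ev (a j) - ev (b j)‖) l (𝓝 (C * k * max ‖x‖ ‖x‖ ^ (k - 1) * ‖x - x‖)) :=
      (((ha.norm.max hb.norm).pow _).const_mul _).mul (ha.sub hb).norm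
    simpa using h1
  have hseq : ∀ x : ∀ i, E i, ∃ v : ℕ → ∀ i, V i, Tendsto (fun j => ev (v j)) atTop (𝓝 x) := by
    intro x
    have hd : DenseRange ev := DenseRange.piMap he
    obtain ⟨y, hy, hyx⟩ := mem_closure_iff_seq_limit.1 (hd x)
    choose v hv using hy
    exact ⟨v, by simpa [hv] using hyx⟩
  choose v hv using hseq
  have hcauchy : ∀ x, ∃ L, Tendsto (fun j => t (v x j)) atTop (𝓝 L) := by
    intro x
    refine cauchySeq_tendsto_of_complete (cauchySeq_iff_tendsto_dist_atTop_0.2 ?_)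
    simp_rw [dist_eq_norm]
    have h1 := hlim (l := (atTop : Filter (ℕ × ℕ))) (a := fun j => v x j.1) (b := fun j => v x j.2)
      (x := x) ((hv x).comp (by rw [← prod_atTop_atTop_eq]; exact tendsto_fst))
      ((hv x).comp (by rw [← prod_atTop_atTop_eq]; exact tendsto_snd))
    simpa using h1.norm
  choose L hL using hcauchy
  have hTL : ∀ {a : ℕ → ∀ i, V i} {x : ∀ i, E i}, Tendsto (fun j => ev (a j)) atTop (𝓝 x) →
      Tendsto (fun j => t (a j)) atTop (𝓝 (L x)) := by
    intro a x ha
    simpa using (hlim ha (hv x)).add (hL x)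
  have hupd : ∀ [DecidableEq ι] {a : ℕ → ∀ i, V i} {x : ∀ i, E i} {i : ι} {b : ℕ → V i} {y : E i},
      Tendsto (fun j => ev (a j)) atTop (𝓝 x) → Tendsto (fun j => e i (b j)) atTop (𝓝 y) →
      Tendsto (fun j => ev (Function.update (a j) i (b j))) atTop (𝓝 (Function.update x i y)) := by
    intro _ a x i b y ha hb
    refine (ha.update i hb).congr fun j => ?_
    ext1 s
    exact (Function.apply_update (fun i => e i) (a j) i (b j) s).symm
  have hco : ∀ [DecidableEq ι] (x : ∀ i, E i) (i : ι) (y : E i),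
      ∃ b : ℕ → V i, Tendsto (fun j => e i (b j)) atTop (𝓝 y) := by
    intro _ x i y
    refine ⟨fun j => v (Function.update x i y) j i, ?_⟩
    have := (tendsto_pi_nhds.1 (hv (Function.update x i y))) i
    simpa using this
  refine ⟨⟨L, ?_, ?_⟩, fun x => ?_, fun w => ?_⟩
  · intro _ x i y z
    obtain ⟨b, hb⟩ := hco x i y
    obtain ⟨c, hc⟩ := hco x i z
    have hbc : Tendsto (fun j => e i (b j + c j)) atTop (𝓝 (y + z)) := by
      simpa using hb.add hc
    have h1 := hTL (hupd (hv x) hbc)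
    have h2 := (hTL (hupd (hv x) hb)).add (hTL (hupd (hv x) hc))
    simp only [MultilinearMap.map_update_add] at h1
    exact tendsto_nhds_unique h1 h2
  · intro _ x i s y
    obtain ⟨b, hb⟩ := hco x i y
    have hbc : Tendsto (fun j => e i (s • b j)) atTop (𝓝 (s • y)) := by
      simpa using hb.const_smul s
    have h1 := hTL (hupd (hv x) hbc)
    have h2 := (hTL (hupd (hv x) hb)).const_smul s
    simp only [MultilinearMap.map_update_smul] at h1
    exact tendsto_nhds_unique h1 h2
  · have h1 : Tendsto (fun j => C * ∏ i, ‖ev (v x j) i‖) atTop (𝓝 (C * ∏ i, ‖x i‖)) :=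
      (tendsto_finsetProd _ fun i _ => ((tendsto_pi_nhds.1 (hv x)) i).norm).const_mul _
    exact le_of_tendsto_of_tendsto' (hL x).norm h1 fun j => ht _
  · exact tendsto_nhds_unique (hTL (a := fun _ => w) (x := ev w) tendsto_const_nhds) tendsto_const_nhds

section Extension

variable {n m : ℕ} {ω : ℝ → ℝ} {K : Rn n → (Fin m → Rn n) → ℂ}
  {T : MultilinearMap ℂ (fun _ : Fin m => 𝓢(Rn n, ℂ)) 𝓢'(Rn n, ℂ)}
  {q : Fin m → ℝ} {q₀ : ℝ}
  {S : MultilinearMap ℂ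
      (fun i : Fin m => Lp ℂ (ENNReal.ofReal (q i)) (volume : Measure (Rn n)))
      (Rn n →ₘ[volume] ℂ)}

/-- A weakly bounded extension yields bounded ones for all exponents in the open range. -/
theorem IsWeakExtension.exists_isBoundedExtension (hS : IsWeakExtension T q q₀ S)
    (hK : IsCZKernel ω K) (hω : IsDiniModulus ω) (hn : 1 ≤ n) (hm : 1 ≤ m) (hTK : HasKernel T K)
    {p : ℝ} (hp : 1 < p) {ps : Fin m → ℝ} (hps : ∀ i, 1 < ps i) (hsum : ∑ i, 1 / ps i = 1 / p) :
    ∃ S', IsBoundedExtension T ps (fun g => eLpNorm g (ENNReal.ofReal p) volume) S' := by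
  obtain ⟨C, hC⟩ := hS.exists_eLpNorm_schwartz_le hK hω hn hm hTK hp hps hsum
  have hfp : Fact (1 ≤ ENNReal.ofReal p) := ⟨by simpa using ENNReal.ofReal_le_ofReal hp.le⟩
  have hfps : ∀ i, Fact (1 ≤ ENNReal.ofReal (ps i)) := fun i =>
    ⟨by simpa using ENNReal.ofReal_le_ofReal (hps i).le⟩
  have hfq : ∀ i, Fact (1 ≤ ENNReal.ofReal (q i)) := fun i =>
    ⟨by simpa using ENNReal.ofReal_le_ofReal (hS.one_lt i).le⟩
  -- `t` is `S` on Schwartz functions, with its values regarded as elements of `L^p`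
  let t₀ : MultilinearMap ℂ (fun _ : Fin m => 𝓢(Rn n, ℂ)) (Rn n →ₘ[volume] ℂ) :=
    S.compLinearMap fun i =>
      (SchwartzMap.toLpCLM ℂ ℂ (ENNReal.ofReal (q i)) (volume : Measure (Rn n))).toLinearMap
  have ht₀ : ∀ f : Fin m → 𝓢(Rn n, ℂ),
      t₀ f = S fun i => (f i).toLp (ENNReal.ofReal (q i)) volume := fun f => rfl
  have hmem : ∀ f, t₀ f ∈ Lp.LpSubmodule ℂ ℂ (ENNReal.ofReal p) (volume : Measure (Rn n)) := by
    intro f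
    refine (hC f).trans_lt (ENNReal.mul_lt_top ENNReal.coe_lt_top ?_)
    exact (ENNReal.prod_ne_top fun i _ => ((f i).memLp _ volume).eLpNorm_ne_top).lt_top
  let j : Lp.LpSubmodule ℂ ℂ (ENNReal.ofReal p) (volume : Measure (Rn n)) →ₗ[ℂ]
      Lp ℂ (ENNReal.ofReal p) (volume : Measure (Rn n)) :=
    { toFun := fun x => ⟨x.1, x.2⟩, map_add' := fun _ _ => rfl, map_smul' := fun _ _ => rfl }
  let j' : Lp ℂ (ENNReal.ofReal p) (volume : Measure (Rn n)) →ₗ[ℂ] (Rn n →ₘ[volume] ℂ) :=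
    { toFun := fun x => x.1, map_add' := fun _ _ => rfl, map_smul' := fun _ _ => rfl }
  let t := j.compMultilinearMap (t₀.codRestrict _ hmem)
  have ht : ∀ f : Fin m → 𝓢(Rn n, ℂ), j' (t f) = t₀ f := fun f => rfl
  obtain ⟨U, hU1, hU2⟩ := exists_multilinear_extension
    (fun i => (SchwartzMap.toLpCLM ℂ ℂ (ENNReal.ofReal (ps i)) (volume : Measure (Rn n))).toLinearMap)
    (fun i => SchwartzMap.denseRange_toLpCLM (F := ℂ) (E := Rn n) ENNReal.ofReal_ne_top) t C.coe_nonneg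
    (fun f => by
      have h1 := hC f
      have h2 : ‖t f‖ = (eLpNorm (S fun i => (f i).toLp (ENNReal.ofReal (q i)) volume)
        (ENNReal.ofReal p) volume).toReal := rfl
      have h3 : ∀ i, ‖(f i).toLp (ENNReal.ofReal (ps i)) volume‖ =
        (eLpNorm (f i) (ENNReal.ofReal (ps i)) volume).toReal := fun i => Lp.norm_toLp _ _
      have h4 := ENNReal.toReal_mono (ENNReal.mul_ne_top ENNReal.coe_ne_top
        (ENNReal.prod_ne_top fun i _ => ((f i).memLp _ volume).eLpNorm_ne_top)) h1
      rw [ENNReal.toReal_mul, ENNReal.toReal_prod, ENNReal.coe_toReal] at h4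
      rw [h2]
      refine h4.trans (le_of_eq ?_)
      congr 1
      exact Finset.prod_congr rfl fun i _ => (h3 i).symm)
  refine ⟨j'.compMultilinearMap U, ⟨C, fun f => ?_⟩, fun f g => ?_⟩
  · have h1 := hU1 f
    have h2 : ∀ {s : ℝ≥0∞} [Fact (1 ≤ s)] (g : Lp ℂ s (volume : Measure (Rn n))),
        eLpNorm g s volume = ENNReal.ofReal ‖g‖ := fun g => by
      rw [Lp.norm_def, ENNReal.ofReal_toReal (Lp.memLp g).eLpNorm_ne_top]
    calc _ = ENNReal.ofReal ‖U f‖ := h2 (U f)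
      _ ≤ ENNReal.ofReal (C * ∏ i, ‖f i‖) := ENNReal.ofReal_le_ofReal h1
      _ = _ := by
          rw [ENNReal.ofReal_mul C.coe_nonneg, ENNReal.ofReal_prod_of_nonneg fun i _ => norm_nonneg _]
          simp_rw [h2]
          rw [ENNReal.ofReal_coe_nnreal]
  · have h1 : (j'.compMultilinearMap U) (fun i => (f i).toLp (ENNReal.ofReal (ps i)) volume) =
        S fun i => (f i).toLp (ENNReal.ofReal (q i)) volume := by
      have := congrArg j' (hU2 f)
      rw [ht, ht₀] at this
      exact this
    rw [h1]
    exact hS.pairing f g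

/-- A bounded extension is determined by `T`: on Schwartz functions by the pairing with test functions,
and then everywhere by continuity in measure. -/
theorem IsBoundedExtension.unique {p : ℝ} (hp : 1 < p) {ps : Fin m → ℝ} (hps : ∀ i, 1 < ps i)
    (hsum : ∑ i, 1 / ps i = 1 / p) {S₁ S₂ : MultilinearMap ℂ
      (fun i : Fin m => Lp ℂ (ENNReal.ofReal (ps i)) (volume : Measure (Rn n)))
      (Rn n →ₘ[volume] ℂ)}
    (h₁ : IsBoundedExtension T ps (fun g => eLpNorm g (ENNReal.ofReal p) volume) S₁)
    (h₂ : IsBoundedExtension T ps (fun g => eLpNorm g (ENNReal.ofReal p) volume) S₂) :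
    S₁ = S₂ := by
  have hw₁ := h₁.isWeakExtension_of_eLpNorm hps hp.le hsum
  have hw₂ := h₂.isWeakExtension_of_eLpNorm hps hp.le hsum
  have hfps : ∀ i, Fact (1 ≤ ENNReal.ofReal (ps i)) := fun i =>
    ⟨by simpa using ENNReal.ofReal_le_ofReal (hps i).le⟩
  have htest : ∀ f : Fin m → 𝓢(Rn n, ℂ),
      S₁ (fun i => (f i).toLp (ENNReal.ofReal (ps i)) volume) =
        S₂ (fun i => (f i).toLp (ENNReal.ofReal (ps i)) volume) := by
    intro f
    refine AEEqFun.ext ?_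
    refine ae_eq_of_integral_contDiff_smul_eq (hw₁.locallyIntegrable _) (hw₂.locallyIntegrable _)
      fun g hg hgc => ?_
    let gs : 𝓢(Rn n, ℂ) := (hgc.comp_left (g := ((↑) : ℝ → ℂ)) Complex.ofReal_zero).toSchwartzMap
      (Complex.ofRealCLM.contDiff.comp hg)
    have hgs : ∀ x, gs x = (g x : ℂ) := fun x => rfl
    have h1 := hw₁.pairing f gs
    have h2 := hw₂.pairing f gs
    rw [h1] at h2
    simp_rw [hgs] at h2
    simpa [mul_comm] using h2
  ext1 f
  have hseq : ∀ i, ∃ u : ℕ → 𝓢(Rn n, ℂ),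
      Tendsto (fun N => (u N).toLp (ENNReal.ofReal (ps i)) volume) atTop (𝓝 (f i)) := by
    intro i
    have hd := SchwartzMap.denseRange_toLpCLM (F := ℂ) (E := Rn n) (μ := volume)
      (p := ENNReal.ofReal (ps i)) ENNReal.ofReal_ne_top
    obtain ⟨y, hy, hyx⟩ := mem_closure_iff_seq_limit.1 (hd (f i))
    choose u hu using hy
    refine ⟨u, hyx.congr fun N => (hu N).symm⟩
  choose u hu using hseq
  have hu' : ∀ i, Tendsto (fun N => eLpNorm ((u i N).toLp (ENNReal.ofReal (ps i)) volume - f i :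
      Lp ℂ (ENNReal.ofReal (ps i)) volume) (ENNReal.ofReal (ps i)) volume) atTop (𝓝 0) := by
    intro i
    have h1 := (tendsto_iff_norm_sub_tendsto_zero.1 (hu i))
    have h2 := ENNReal.tendsto_ofReal h1
    rw [ENNReal.ofReal_zero] at h2
    refine h2.congr fun N => ?_
    rw [Lp.norm_def, ENNReal.ofReal_toReal (Lp.memLp _).eLpNorm_ne_top]
  have t1 := hw₁.tendstoInMeasure (u := fun N i => (u i N).toLp (ENNReal.ofReal (ps i)) volume) hu'
  have t2 := hw₂.tendstoInMeasure (u := fun N i => (u i N).toLp (ENNReal.ofReal (ps i)) volume) hu'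
  simp_rw [htest] at t1
  exact AEEqFun.ext (tendstoInMeasure_ae_unique t1 t2)

/-- A Calderón-Zygmund operator has exactly one bounded extension to
`L^{p_1} × ⋯ × L^{p_m} → L^p`. -/
theorem IsCZOperator.existsUnique_isBoundedExtension (hT : IsCZOperator ω K T) (hn : 1 ≤ n)
    (hm : 1 ≤ m) {p : ℝ} (hp : 1 < p) {ps : Fin m → ℝ} (hps : ∀ i, 1 < ps i)
    (hsum : ∑ i, 1 / ps i = 1 / p) :
    ∃! S', IsBoundedExtension T ps (fun g => eLpNorm g (ENNReal.ofReal p) volume) S' := by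
  have hex : ∃ S', IsBoundedExtension T ps (fun g => eLpNorm g (ENNReal.ofReal p) volume) S' := by
    obtain ⟨q, hq, ⟨q₀, hq₀, hqs, S, hS⟩ | ⟨hqs, S, hS⟩⟩ := hT.bounded
    · exact (hS.isWeakExtension_of_weakNorm hq hq₀ hqs).exists_isBoundedExtension
        hT.kernel hT.modulus hn hm hT.hasKernel hp hps hsum
    · have hS' : IsBoundedExtension T q (fun g => eLpNorm g (ENNReal.ofReal 1) volume) S := by
        simpa using hS
      exact (hS'.isWeakExtension_of_eLpNorm hq le_rfl (by simpa using hqs)).exists_isBoundedExtension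
        hT.kernel hT.modulus hn hm hT.hasKernel hp hps hsum
  obtain ⟨S', hS'⟩ := hex
  exact ⟨S', hS', fun S'' hS'' => IsBoundedExtension.unique hp hps hsum hS'' hS'⟩

end Extension


/-! ### Growth functions -/

section Growth

theorem le_setLIntegral_Ioc_div {F : ℝ → ℝ} {a c : ℝ} (ha : 0 < a) (hc : 0 ≤ c)
    (h : ∀ t ∈ Ioc a (2 * a), c ≤ F t) :
    ENNReal.ofReal (c / 2) ≤ ∫⁻ t in Ioc a (2 * a), ENNReal.ofReal (F t / t) := by
  calc ENNReal.ofReal (c / 2) = ∫⁻ _ in Ioc a (2 * a), ENNReal.ofReal (c / (2 * a)) := by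
        rw [setLIntegral_const, Real.volume_Ioc, ← ENNReal.ofReal_mul (by positivity)]
        congr 1
        field_simp
        ring
    _ ≤ _ := by
        refine setLIntegral_mono' measurableSet_Ioc fun t ht => ENNReal.ofReal_le_ofReal ?_
        have ht0 : 0 < t := ha.trans ht.1
        exact div_le_div₀ (hc.trans (h t ht)) (h t ht) ht0 ht.2

theorem setLIntegral_Ioc_div_le {F : ℝ → ℝ} {a c : ℝ} (ha : 0 < a) (hc : 0 ≤ c)
    (h : ∀ t ∈ Ioc a (2 * a), F t ≤ c) :
    ∫⁻ t in Ioc a (2 * a), ENNReal.ofReal (F t / t) ≤ ENNReal.ofReal c := by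
  calc _ ≤ ∫⁻ _ in Ioc a (2 * a), ENNReal.ofReal (c / a) := by
        refine setLIntegral_mono' measurableSet_Ioc fun t ht => ENNReal.ofReal_le_ofReal ?_
        exact div_le_div₀ hc (h t ht) ha ht.1.le
    _ = _ := by
        rw [setLIntegral_const, Real.volume_Ioc, ← ENNReal.ofReal_mul (by positivity)]
        congr 1
        field_simp
        ring

variable {n : ℕ} {φ : Rn n → ℝ → ℝ}

theorem GDec.pos (hφ : GDec φ) (x : Rn n) {r : ℝ} (hr : 0 < r) : 0 < φ x r := hφ.1.1 x r hr

/-- Almost monotonicity of a growth function, for radii which may coincide. -/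
theorem GDec.exists_le (hφ : GDec φ) :
    ∃ C : ℝ, 1 ≤ C ∧ ∀ x r s, 0 < r → r ≤ s → φ x s ≤ C * φ x r := by
  obtain ⟨C, _, hC⟩ := hφ.2
  refine ⟨max C 1, le_max_right _ _, fun x r s hr hrs => ?_⟩
  have h0 := hφ.pos x hr
  rcases hrs.eq_or_lt with rfl | h
  · exact le_mul_of_one_le_left h0.le (le_max_right _ _)
  · exact (hC x r s hr h).1.trans (by gcongr; exact le_max_left _ _)

theorem iUnion_Ioc_dyadic {a : ℝ} (ha : 0 < a) :
    ⋃ k : ℕ, Ioc (2 ^ k * a) (2 * (2 ^ k * a)) = Ioi a := by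
  ext t
  simp only [mem_iUnion, mem_Ioc, mem_Ioi]
  constructor
  · rintro ⟨k, h1, -⟩
    have : (1 : ℝ) ≤ 2 ^ k := one_le_pow₀ (by norm_num)
    nlinarith
  · intro ht
    have h1 : ∃ k : ℕ, t ≤ 2 ^ k * a := by
      obtain ⟨k, hk⟩ := pow_unbounded_of_one_lt (t / a) (by norm_num : (1 : ℝ) < 2)
      exact ⟨k, ((div_lt_iff₀ ha).1 hk).le⟩
    classical
    have h2 := Nat.find_spec h1
    have h3 : Nat.find h1 ≠ 0 := by
      intro h0
      rw [h0] at h2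
      simp only [pow_zero, one_mul] at h2
      linarith
    obtain ⟨j, hj⟩ := Nat.exists_eq_succ_of_ne_zero h3
    refine ⟨j, ?_, ?_⟩
    · exact not_le.1 (Nat.find_min h1 (by omega))
    · rw [hj, pow_succ] at h2
      linarith

theorem pairwise_disjoint_Ioc_dyadic {a : ℝ} (ha : 0 < a) :
    Pairwise (Function.onFun Disjoint fun k : ℕ => Ioc (2 ^ k * a) (2 * (2 ^ k * a))) := by
  have hmain : ∀ k l : ℕ, k < l →
      Disjoint (Ioc ((2 : ℝ) ^ k * a) (2 * (2 ^ k * a))) (Ioc (2 ^ l * a) (2 * (2 ^ l * a))) := by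
    intro k l hkl
    refine Set.disjoint_left.2 fun t h1 h2 => ?_
    have h3 : (2 : ℝ) ^ (k + 1) ≤ 2 ^ l := pow_le_pow_right₀ (by norm_num) hkl
    have h4 : (2 : ℝ) ^ (k + 1) * a ≤ 2 ^ l * a := by gcongr
    rw [pow_succ] at h4
    have h5 := h1.2
    have h6 := h2.1
    linarith
  intro k l hkl
  rcases lt_or_gt_of_ne hkl with h | h
  · exact hmain k l h
  · exact (hmain l k h).symm

/-- The integral condition forces power decay along dyadic radii. -/
theorem HasTailBound.exists_decay (htail : HasTailBound φ) (hφ : GDec φ) :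
    ∃ D θ : ℝ, 0 < D ∧ 0 < θ ∧ θ < 1 ∧ ∀ z r, 0 < r → ∀ j : ℕ,
      φ z (2 ^ (j + 1) * r) ≤ D * θ ^ j * φ z r := by
  obtain ⟨C, hC1, hC⟩ := hφ.exists_le
  obtain ⟨C₁, hC₁0, hC₁⟩ := htail
  have hC0 : 0 < C := by linarith
  set κ : ℝ := 1 / (2 * C * C₁) with hκ
  have hκ0 : 0 < κ := by positivity
  refine ⟨2 * C * C₁, 1 / (1 + κ), by positivity, by positivity, ?_, fun z r hr => ?_⟩
  · rw [div_lt_one (by positivity)]; linarith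
  set s : ℕ → ℝ≥0∞ := fun j => ∫⁻ t in Ioi (2 ^ j * r), ENNReal.ofReal (φ z t / t) with hs
  have hsle : ∀ j, s j ≤ ENNReal.ofReal (C₁ * φ z (2 ^ j * r)) := fun j =>
    hC₁ z _ (by positivity)
  have hsfin : ∀ j, s j ≠ ∞ := fun j => ne_top_of_le_ne_top ENNReal.ofReal_ne_top (hsle j)
  have hpos : ∀ j : ℕ, 0 < φ z (2 ^ j * r) := fun j => hφ.pos z (by positivity)
  have hσle : ∀ j, (s j).toReal ≤ C₁ * φ z (2 ^ j * r) := fun j =>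
    ENNReal.toReal_le_of_le_ofReal (by have := hpos j; positivity) (hsle j)
  -- The tails `s j` satisfy `s j ≥ (1 + κ) s (j + 1)`: the integral over one dyadic interval is comparable
  -- to `φ` at its right end, which bounds the next tail.
  have hstep : ∀ j, φ z (2 ^ (j + 1) * r) / C / 2 + (s (j + 1)).toReal ≤ (s j).toReal := by
    intro j
    have hp := hpos (j + 1)
    have e : (2 : ℝ) ^ (j + 1) * r = 2 * (2 ^ j * r) := by ring
    have ha : 0 < 2 ^ j * r := by positivity
    have h1 := le_setLIntegral_Ioc_div (F := φ z) ha (c := φ z (2 ^ (j + 1) * r) / C)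
      (by positivity) (fun t ht => by
        rw [div_le_iff₀ hC0, mul_comm _ C]
        exact hC z t _ (ha.trans ht.1) (e ▸ ht.2))
    have h2 : s j = (∫⁻ t in Ioc (2 ^ j * r) (2 * (2 ^ j * r)), ENNReal.ofReal (φ z t / t)) +
        s (j + 1) := by
      simp only [hs]
      rw [e, ← lintegral_union measurableSet_Ioi, Ioc_union_Ioi_eq_Ioi (by linarith)]
      exact Set.disjoint_left.2 fun t h1 h2 => absurd h1.2 (not_le.2 h2)
    have h3 : ENNReal.ofReal (φ z (2 ^ (j + 1) * r) / C / 2 + (s (j + 1)).toReal) ≤ s j := by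
      rw [ENNReal.ofReal_add (by positivity) ENNReal.toReal_nonneg,
        ENNReal.ofReal_toReal (hsfin _), h2]
      exact add_le_add h1 le_rfl
    exact (ENNReal.ofReal_le_iff_le_toReal (hsfin j)).1 h3
  have hgeom : ∀ j, (s j).toReal ≤ (1 / (1 + κ)) ^ j * (C₁ * φ z r) := by
    intro j
    induction j with
    | zero => simpa using hσle 0
    | succ j ih =>
      have h1 := hstep j
      have h2 := hσle (j + 1)
      have h3 : κ * (s (j + 1)).toReal ≤ φ z (2 ^ (j + 1) * r) / C / 2 := by
        calc _ ≤ κ * (C₁ * φ z (2 ^ (j + 1) * r)) := by gcongr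
          _ = _ := by rw [hκ]; field_simp
      rw [pow_succ, mul_right_comm, mul_one_div, le_div_iff₀ (by positivity)]
      linarith
  intro j
  have h1 := hstep j
  have h2 := hgeom j
  have h3 : φ z (2 ^ (j + 1) * r) / C / 2 ≤ (1 / (1 + κ)) ^ j * (C₁ * φ z r) := by
    have : 0 ≤ (s (j + 1)).toReal := ENNReal.toReal_nonneg
    linarith
  rw [div_div, div_le_iff₀ (by positivity)] at h3
  linarith

/-- The integral condition is inherited by `φ^{1/p}`. -/
theorem HasTailBound.exists_lintegral_rpow_le (htail : HasTailBound φ) (hφ : GDec φ) {p : ℝ}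
    (hp : 0 < p) :
    ∃ C : ℝ≥0, ∀ z r, 0 < r → ∫⁻ t in Ioi (2 * r), ENNReal.ofReal (φ z t ^ (1 / p) / t) ≤
      C * ENNReal.ofReal (φ z r ^ (1 / p)) := by
  obtain ⟨C, hC1, hC⟩ := hφ.exists_le
  obtain ⟨D, θ, hD0, hθ0, hθ1, hD⟩ := htail.exists_decay hφ
  have hC0 : 0 < C := by linarith
  have hρ0 : 0 < θ ^ (1 / p) := by positivity
  have hρ1 : θ ^ (1 / p) < 1 := Real.rpow_lt_one hθ0.le hθ1 (by positivity)
  refine ⟨((C * D) ^ (1 / p)).toNNReal * (1 - (θ ^ (1 / p)).toNNReal)⁻¹, fun z r hr => ?_⟩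
  have h0 := hφ.pos z hr
  rw [← iUnion_Ioc_dyadic (by positivity : 0 < 2 * r)]
  refine (lintegral_iUnion_le _ _).trans ?_
  calc _ ≤ ∑' k : ℕ, ENNReal.ofReal ((C * D) ^ (1 / p) * φ z r ^ (1 / p)) *
        ENNReal.ofReal (θ ^ (1 / p)) ^ k := by
        refine ENNReal.tsum_le_tsum fun k => ?_
        rw [← ENNReal.ofReal_pow hρ0.le, ← ENNReal.ofReal_mul (by positivity)]
        have ha : 0 < 2 ^ k * (2 * r) := by positivity
        refine setLIntegral_Ioc_div_le (F := fun t => φ z t ^ (1 / p)) ha (by positivity)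
          fun t ht => ?_
        have ht0 : 0 < t := ha.trans ht.1
        have hpt := hφ.pos z ht0
        calc φ z t ^ (1 / p) ≤ (C * D * φ z r * θ ^ k) ^ (1 / p) := by
              refine Real.rpow_le_rpow hpt.le ?_ (by positivity)
              have h1 := hC z _ t ha ht.1.le
              have h2 := hD z r hr k
              have e : (2 : ℝ) ^ (k + 1) * r = 2 ^ k * (2 * r) := by ring
              rw [e] at h2
              calc φ z t ≤ C * φ z (2 ^ k * (2 * r)) := h1
                _ ≤ C * (D * θ ^ k * φ z r) := by gcongr
                _ = _ := by ring
          _ = _ := by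
              rw [Real.mul_rpow (by positivity) (by positivity),
                Real.mul_rpow (by positivity) (by positivity), ← Real.rpow_natCast θ k,
                ← Real.rpow_mul hθ0.le, mul_comm (k : ℝ), Real.rpow_mul hθ0.le, Real.rpow_natCast]
    _ = _ := by
        have hlt : (θ ^ (1 / p)).toNNReal < 1 := by simpa using hρ1
        rw [ENNReal.tsum_mul_left, ENNReal.tsum_geometric, ENNReal.ofReal_mul (by positivity)]
        push_cast
        rw [ENNReal.coe_inv (tsub_pos_of_lt hlt).ne', ENNReal.coe_sub]
        simp only [ENNReal.ofReal, ENNReal.coe_one]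
        ring

/-- Dyadic sums of `φ^{1/p}` are dominated by the integral over the tail. -/
theorem GDec.exists_tsum_le (hφ : GDec φ) {p : ℝ} (hp : 0 < p) :
    ∃ C : ℝ≥0, ∀ z r, 0 < r →
      ∑' k : ℕ, ENNReal.ofReal (φ z (2 ^ (k + 1) * (2 * r)) ^ (1 / p)) ≤
        C * ∫⁻ t in Ioi (2 * r), ENNReal.ofReal (φ z t ^ (1 / p) / t) := by
  obtain ⟨C, hC1, hC⟩ := hφ.exists_le
  have hC0 : 0 < C := by linarith
  refine ⟨(2 * C ^ (1 / p)).toNNReal, fun z r hr => ?_⟩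
  rw [← iUnion_Ioc_dyadic (by positivity : 0 < 2 * r),
    lintegral_iUnion (fun k => measurableSet_Ioc) (pairwise_disjoint_Ioc_dyadic (by positivity)),
    ← ENNReal.tsum_mul_left]
  refine ENNReal.tsum_le_tsum fun k => ?_
  have ha : 0 < 2 ^ k * (2 * r) := by positivity
  have e : (2 : ℝ) ^ (k + 1) * (2 * r) = 2 * (2 ^ k * (2 * r)) := by ring
  have hp1 : 0 < φ z (2 ^ (k + 1) * (2 * r)) := hφ.pos z (by positivity)
  have h1 := le_setLIntegral_Ioc_div (F := fun t => φ z t ^ (1 / p)) ha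
    (c := (φ z (2 ^ (k + 1) * (2 * r)) / C) ^ (1 / p)) (by positivity) (fun t ht => by
      refine Real.rpow_le_rpow (by positivity) ?_ (by positivity)
      rw [div_le_iff₀ hC0, mul_comm _ C]
      exact hC z t _ (ha.trans ht.1) (e ▸ ht.2))
  refine le_trans (le_of_eq ?_) (mul_le_mul_right h1 _)
  change _ = ENNReal.ofReal _ * _
  rw [← ENNReal.ofReal_mul (by positivity), Real.div_rpow hp1.le hC0.le]
  congr 1
  field_simp

end Growth

/-! ### The Morrey norm -/

section Morrey

variable {n : ℕ} {p : ℝ} {φ : Rn n → ℝ → ℝ}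

/-- The Morrey norm in terms of the `L^p` norms over balls. -/
theorem morreyNorm_le_iff (hp : 0 < p) (hφ : GDec φ) (f : Rn n → ℂ) (N : ℝ≥0∞) :
    morreyNorm p φ f ≤ N ↔ ∀ z r, 0 < r →
      eLpNorm f (ENNReal.ofReal p) (volume.restrict (Metric.ball z r)) ≤
        N * ENNReal.ofReal ((φ z r * (unitVol n * r ^ n)) ^ (1 / p)) := by
  have hv := unitVol_pos n
  rw [morreyNorm]
  simp only [iSup_le_iff]
  refine forall_congr' fun z => forall_congr' fun r => forall_congr' fun hr => ?_
  have h0 := hφ.pos z hr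
  rw [eLpNorm_eq_lintegral_rpow_enorm_toReal (by simpa using hp) ENNReal.ofReal_ne_top,
    ENNReal.toReal_ofReal hp.le, setLAverage_eq, volume_ball z hr]
  set I := ∫⁻ y in Metric.ball z r, ‖f y‖ₑ ^ p
  have e : (ENNReal.ofReal (φ z r))⁻¹ * (I / ENNReal.ofReal (unitVol n * r ^ n)) =
      I / ENNReal.ofReal (φ z r * (unitVol n * r ^ n)) := by
    rw [ENNReal.ofReal_mul h0.le, div_eq_mul_inv, div_eq_mul_inv, ENNReal.mul_inv
      (Or.inr ENNReal.ofReal_ne_top) (Or.inl ENNReal.ofReal_ne_top)]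
    ring
  have hW : 0 < φ z r * (unitVol n * r ^ n) := by positivity
  rw [e, ENNReal.div_rpow_of_nonneg _ _ (by positivity), ENNReal.ofReal_rpow_of_pos hW]
  exact ENNReal.div_le_iff (by simpa using Real.rpow_pos_of_pos hW _) ENNReal.ofReal_ne_top

theorem eLpNorm_ball_le_morreyNorm (hp : 0 < p) (hφ : GDec φ) (f : Rn n → ℂ) (z : Rn n) {r : ℝ}
    (hr : 0 < r) : eLpNorm f (ENNReal.ofReal p) (volume.restrict (Metric.ball z r)) ≤
      morreyNorm p φ f * ENNReal.ofReal ((φ z r * (unitVol n * r ^ n)) ^ (1 / p)) :=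
  (morreyNorm_le_iff hp hφ f _).1 le_rfl z r hr

/-- Hölder's inequality: the `L¹` norm over a ball in terms of the Morrey norm. -/
theorem setLIntegral_ball_le_morreyNorm (hp : 1 < p) (hφ : GDec φ) {f : Rn n → ℂ}
    (hf : AEStronglyMeasurable f volume) (z : Rn n) {r : ℝ} (hr : 0 < r) :
    ∫⁻ y in Metric.ball z r, ‖f y‖ₑ ≤
      morreyNorm p φ f * ENNReal.ofReal (φ z r ^ (1 / p) * (unitVol n * r ^ n)) := by
  have hv := unitVol_pos n
  have h0 := hφ.pos z hr
  have hp0 : 0 < p := by linarith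
  have h1 := eLpNorm_le_eLpNorm_mul_rpow_measure_univ (μ := volume.restrict (Metric.ball z r))
    (f := f) (p := 1) (q := ENNReal.ofReal p) (by simpa using ENNReal.ofReal_le_ofReal hp.le)
    hf.restrict
  rw [eLpNorm_one_eq_lintegral_enorm, Measure.restrict_apply_univ, volume_ball z hr,
    ENNReal.toReal_ofReal hp0.le, ENNReal.toReal_one] at h1
  refine h1.trans ((mul_le_mul_left (eLpNorm_ball_le_morreyNorm hp0 hφ f z hr) _).trans
    (le_of_eq ?_))
  have hb : 0 < unitVol n * r ^ n := by positivity
  rw [mul_assoc, ENNReal.ofReal_rpow_of_pos hb, ← ENNReal.ofReal_mul (by positivity),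
    Real.mul_rpow h0.le hb.le, mul_assoc, ← Real.rpow_add hb]
  simp

theorem morreyNorm_mono {f g : Rn n → ℂ} (hp : 0 < p) (hφ : GDec φ) (h : ∀ x, ‖f x‖ₑ ≤ ‖g x‖ₑ) :
    morreyNorm p φ f ≤ morreyNorm p φ g := by
  refine (morreyNorm_le_iff hp hφ f _).2 fun z r hr => ?_
  refine le_trans (eLpNorm_mono_enorm h) (eLpNorm_ball_le_morreyNorm hp hφ g z hr)

end Morrey


/-! ### The operator on Morrey spaces -/

section MorreyOperator

variable {n m : ℕ} {ω : ℝ → ℝ} {K : Rn n → (Fin m → Rn n) → ℂ} {p : ℝ} {ps : Fin m → ℝ}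
  {φ : Rn n → ℝ → ℝ} {φs : Fin m → Rn n → ℝ → ℝ}

/-- The kernel integral over the tuples outside `(2B)^m`, at the points of `B`. -/
theorem KernelBounds.exists_lintegral_far_le_morreyNorm {A : ℝ} (hA : KernelBounds A ω K)
    (hp : 1 < p) (hps : ∀ i, 1 < ps i)
    (hφprod : ∀ x r, 0 < r → ∏ i, φs i x r ^ (1 / ps i) = φ x r ^ (1 / p))
    (hφ : GDec φ) (hφs : ∀ i, GDec (φs i)) :
    ∃ C : ℝ≥0, ∀ f : Fin m → Rn n → ℂ, (∀ i, AEStronglyMeasurable (f i) volume) →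
      ∀ z r, 0 < r → ∀ x ∈ Metric.ball z r,
        ∫⁻ y in (Metric.ball (fun _ : Fin m => z) (2 * r))ᶜ, ‖K x y‖ₑ * ∏ i, ‖f i (y i)‖ₑ ≤
          C * (∫⁻ t in Ioi (2 * r), ENNReal.ofReal (φ z t ^ (1 / p) / t)) *
            ∏ i, morreyNorm (ps i) (φs i) (f i) := by
  have hp0 : 0 < p := by linarith
  have hA0 := hA.pos
  have hv := unitVol_pos n
  obtain ⟨C, hC⟩ := hφ.exists_tsum_le hp0
  refine ⟨(A * (4 ^ n * unitVol n) ^ m).toNNReal * C, fun f hf z r hr x hx => ?_⟩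
  set N := ∏ i, morreyNorm (ps i) (φs i) (f i) with hN
  refine (hA.lintegral_far_le hr hx (h := fun i y => ‖f i y‖ₑ) fun i => (hf i).enorm).trans ?_
  calc _ ≤ ∑' k : ℕ, ENNReal.ofReal (A * (4 ^ n * unitVol n) ^ m) * N *
        ENNReal.ofReal (φ z (2 ^ (k + 1) * (2 * r)) ^ (1 / p)) := by
        refine ENNReal.tsum_le_tsum fun k => ?_
        set R : ℝ := 2 ^ (k + 1) * (2 * r) with hR
        have hR0 : 0 < R := by positivity
        have h1 : ∏ i, ∫⁻ y in Metric.ball z R, ‖f i y‖ₑ ≤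
            N * ENNReal.ofReal (φ z R ^ (1 / p) * (unitVol n * R ^ n) ^ m) := by
          refine (Finset.prod_le_prod' fun i _ =>
            setLIntegral_ball_le_morreyNorm (hps i) (hφs i) (hf i) z hR0).trans (le_of_eq ?_)
          have hpos : ∀ i, 0 < φs i z R := fun i => (hφs i).pos z hR0
          rw [Finset.prod_mul_distrib, ← ENNReal.ofReal_prod_of_nonneg (fun i _ => by
            have := hpos i; positivity), Finset.prod_mul_distrib, hφprod z R hR0,
            Finset.prod_const, Finset.card_univ, Fintype.card_fin]
        have h0 := hφ.pos z hR0
        refine (mul_le_mul_right h1 _).trans (le_of_eq ?_)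
        rw [mul_left_comm, ← ENNReal.ofReal_mul (by positivity), mul_comm _ N, mul_assoc N,
          ← ENNReal.ofReal_mul (by positivity)]
        congr 2
        -- `R = 4 * (2 ^ k * r)`, so the kernel bound and the volumes cancel up to a constant
        have e : (unitVol n * R ^ n) ^ m = (4 ^ n * unitVol n) ^ m * (2 ^ k * r) ^ (m * n) := by
          have : R = 4 * (2 ^ k * r) := by rw [hR]; ring
          rw [this, mul_pow 4, mul_comm m n, pow_mul (2 ^ k * r) n m, ← mul_pow]
          ring
        rw [e]
        have : (2 ^ k * r) ^ (m * n) ≠ 0 := by positivity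
        field_simp
    _ = ENNReal.ofReal (A * (4 ^ n * unitVol n) ^ m) * N *
        ∑' k : ℕ, ENNReal.ofReal (φ z (2 ^ (k + 1) * (2 * r)) ^ (1 / p)) := ENNReal.tsum_mul_left
    _ ≤ ENNReal.ofReal (A * (4 ^ n * unitVol n) ^ m) * N *
        (C * ∫⁻ t in Ioi (2 * r), ENNReal.ofReal (φ z t ^ (1 / p) / t)) :=
        mul_le_mul_right (hC z r hr) _
    _ = _ := by
        push_cast
        rw [← ENNReal.ofReal.eq_1]
        ring

/-- A product with at least one far factor vanishes on `(2B)^m`, which is a ball for the sup metric. -/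
theorem lintegral_pieceProd_le {f : Fin m → Rn n → ℂ} {z : Rn n} {r : ℝ} (hr : 0 < r)
    {J : Finset (Fin m)} (hJ : J.Nonempty) (x : Rn n) :
    ∫⁻ y, ‖K x y * pieceProd f z r J y‖ₑ ≤
      ∫⁻ y in (Metric.ball (fun _ : Fin m => z) (2 * r))ᶜ, ‖K x y‖ₑ * ∏ i, ‖f i (y i)‖ₑ := by
  rw [← lintegral_indicator measurableSet_ball.compl]
  refine lintegral_mono fun y => ?_
  by_cases hy : y ∈ Metric.ball (fun _ : Fin m => z) (2 * r)
  · simp [pieceProd_eq_zero_of_mem_ball hJ hr hy]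
  · rw [indicator_of_mem (by simpa using hy), enorm_mul]
    exact mul_le_mul_right (enorm_pieceProd_le J y) _

theorem card_filter_finset_le (P : Finset (Fin m) → Prop) [DecidablePred P] :
    (Finset.univ.filter P).card ≤ 2 ^ m :=
  (Finset.card_filter_le _ _).trans (by simp [Fintype.card_finset])

/-- The local parts lie in `L^{p_i}`. -/
theorem memLp_piece_empty {f : Fin m → Rn n → ℂ} {i : Fin m} (hp : 0 < ps i) (hφ : GDec (φs i))
    (hf : MemMorrey (ps i) (φs i) (f i)) (z : Rn n) {r : ℝ} (hr : 0 < r) :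
    MemLp (piece f z r ∅ i) (ENNReal.ofReal (ps i)) volume := by
  rw [piece, if_neg (Finset.notMem_empty i), memLp_indicator_iff_restrict measurableSet_ball]
  refine ⟨hf.1.restrict, (eLpNorm_ball_le_morreyNorm hp hφ (f i) z (by positivity)).trans_lt ?_⟩
  exact ENNReal.mul_lt_top hf.2 ENNReal.ofReal_lt_top

/-- The local parts have bounded support. -/
theorem piece_empty_eq_zero {f : Fin m → Rn n → ℂ} (z : Rn n) (r : ℝ) (i : Fin m) :
    ∃ R, ∀ y, y ∉ Metric.closedBall 0 R → piece f z r ∅ i y = 0 := by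
  refine ⟨‖z‖ + 2 * r, fun y hy => ?_⟩
  rw [piece, if_neg (Finset.notMem_empty i), indicator_of_notMem]
  intro hyz
  refine hy ?_
  rw [mem_closedBall_zero_iff]
  have := norm_le_norm_add_norm_sub' y z
  rw [Metric.mem_ball, dist_eq_norm] at hyz
  linarith

/-- All the far terms together are the integral against the full tensor product minus its local part. -/
theorem farValue_eq_integral {f : Fin m → Rn n → ℂ} {z : Rn n} {r : ℝ} {x : Rn n}
    (hint : ∀ J : Finset (Fin m), J.Nonempty → Integrable fun y => K x y * pieceProd f z r J y) :
    Integrable (fun y => K x y * (∏ i, f i (y i) - pieceProd f z r ∅ y)) ∧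
    farValue K f z r x = ∫ y, K x y * (∏ i, f i (y i) - pieceProd f z r ∅ y) := by
  have e : (fun y => K x y * (∏ i, f i (y i) - pieceProd f z r ∅ y)) =
      fun y => ∑ J : Finset (Fin m) with J.Nonempty, K x y * pieceProd f z r J y := by
    ext y
    rw [← sum_pieceProd (z := z) (r := r), sum_finset_eq_empty_add, add_sub_cancel_left,
      Finset.mul_sum]
  rw [e]
  have hint' : ∀ J ∈ (Finset.univ.filter fun J : Finset (Fin m) => J.Nonempty),
      Integrable fun y => K x y * pieceProd f z r J y := fun J hJ =>
    hint J (Finset.mem_filter.1 hJ).2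
  exact ⟨integrable_finsetSum _ hint', (integral_finsetSum _ hint').symm⟩

end MorreyOperator


/-! ### Independence of the ball and the Morrey estimate -/

section MorreyOperator

variable {n m : ℕ} {ω : ℝ → ℝ} {K : Rn n → (Fin m → Rn n) → ℂ} {p : ℝ} {ps : Fin m → ℝ}
  {φ : Rn n → ℝ → ℝ} {φs : Fin m → Rn n → ℝ → ℝ}
  {T : MultilinearMap ℂ (fun _ : Fin m => 𝓢(Rn n, ℂ)) 𝓢'(Rn n, ℂ)}
  {S : MultilinearMap ℂ
      (fun i : Fin m => Lp ℂ (ENNReal.ofReal (ps i)) (volume : Measure (Rn n)))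
      (Rn n →ₘ[volume] ℂ)}

/-- Splitting along a ball and along a larger one give the same value on the smaller one: the
functions cut off to the larger ball can be split along the smaller one. -/
theorem IsWeakExtension.splitValue_ae_eq_of_subset (hS : IsWeakExtension T ps p S)
    (hK : IsCZKernel ω K) (hω : IsDiniModulus ω) (hn : 1 ≤ n) (hTK : HasKernel T K)
    {f : Fin m → Rn n → ℂ} (hf : ∀ i, AEStronglyMeasurable (f i) volume)
    (hloc : ∀ z r, 0 < r → ∀ i, MemLp (piece f z r ∅ i) (ENNReal.ofReal (ps i)) volume)
    (hint : ∀ h : Fin m → Rn n → ℂ, (∀ i, AEStronglyMeasurable (h i) volume) →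
      (∀ i x, ‖h i x‖ₑ ≤ ‖f i x‖ₑ) → ∀ z r, 0 < r → ∀ x ∈ Metric.ball z r,
      ∀ J : Finset (Fin m), J.Nonempty → Integrable fun y => K x y * pieceProd h z r J y)
    {z r w s} (hr : 0 < r) (hs : 0 < s) (h1 : Metric.ball z r ⊆ Metric.ball w s)
    (h2 : Metric.ball z (2 * r) ⊆ Metric.ball w (2 * s)) :
    ∀ᵐ x, x ∈ Metric.ball z r → splitValue K ps S f z r x = splitValue K ps S f w s x := by
  -- `h` is `f` cut off to the larger ball; split along the smaller ball it has the local parts of `f`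
  set h := piece f w s ∅ with hh
  have hhm : ∀ i, AEStronglyMeasurable (h i) volume := fun i => aestronglyMeasurable_piece (hf i) ∅
  have hhf : ∀ i x, ‖h i x‖ₑ ≤ ‖f i x‖ₑ := fun i x => enorm_piece_le ∅ i x
  have hpp : piece h z r ∅ = piece f z r ∅ := by
    ext i y
    simp only [hh, piece, Finset.notMem_empty, if_false]
    by_cases hy : y ∈ Metric.ball z (2 * r)
    · rw [indicator_of_mem hy, indicator_of_mem hy, indicator_of_mem (h2 hy)]
    · rw [indicator_of_notMem hy, indicator_of_notMem hy]
  filter_upwards [hS.ae_eq_splitValue hK hω hn hTK (f := h) (hloc w s hs)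
    (fun i => piece_empty_eq_zero w s i) z r] with x hx hxz
  have hx := hx (Metric.ball_subset_ball (by linarith) hxz)
  change _ = S (fun i => classLp (ps i) (piece h z r ∅ i)) x + farValue K h z r x at hx
  change S (fun i => classLp (ps i) (piece f z r ∅ i)) x + farValue K f z r x =
    S (fun i => classLp (ps i) (h i)) x + farValue K f w s x
  obtain ⟨i1, e1⟩ := farValue_eq_integral (hint f hf (fun _ _ => le_rfl) z r hr x hxz)
  obtain ⟨i2, e2⟩ := farValue_eq_integral (hint h hhm hhf z r hr x hxz)
  obtain ⟨i3, e3⟩ := farValue_eq_integral (hint f hf (fun _ _ => le_rfl) w s hs x (h1 hxz))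
  rw [hx, hpp, add_assoc, e1, e2, e3, ← integral_add i2 i3]
  congr 2
  ext y
  have p1 : pieceProd h z r ∅ y = pieceProd f z r ∅ y := by simp only [pieceProd, hpp]
  have p2 : pieceProd f w s ∅ y = ∏ i, h i (y i) := rfl
  rw [p1, p2]
  ring

/-- Independence of the ball: any two balls are compared with a common larger one. -/
theorem IsWeakExtension.splitValue_ae_eq (hS : IsWeakExtension T ps p S)
    (hK : IsCZKernel ω K) (hω : IsDiniModulus ω) (hn : 1 ≤ n) (hTK : HasKernel T K)
    {f : Fin m → Rn n → ℂ} (hf : ∀ i, AEStronglyMeasurable (f i) volume)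
    (hloc : ∀ z r, 0 < r → ∀ i, MemLp (piece f z r ∅ i) (ENNReal.ofReal (ps i)) volume)
    (hint : ∀ h : Fin m → Rn n → ℂ, (∀ i, AEStronglyMeasurable (h i) volume) →
      (∀ i x, ‖h i x‖ₑ ≤ ‖f i x‖ₑ) → ∀ z r, 0 < r → ∀ x ∈ Metric.ball z r,
      ∀ J : Finset (Fin m), J.Nonempty → Integrable fun y => K x y * pieceProd h z r J y)
    (z₁ : Rn n) (r₁ : ℝ) (z₂ : Rn n) (r₂ : ℝ) (hr₁ : 0 < r₁) (hr₂ : 0 < r₂) :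
    ∀ᵐ x, x ∈ Metric.ball z₁ r₁ → x ∈ Metric.ball z₂ r₂ →
      splitValue K ps S f z₁ r₁ x = splitValue K ps S f z₂ r₂ x := by
  set s := max (‖z₁‖ + r₁) (‖z₂‖ + r₂) with hs
  have hs1 : ‖z₁‖ + r₁ ≤ s := le_max_left _ _
  have hs2 : ‖z₂‖ + r₂ ≤ s := le_max_right _ _
  have hs0 : 0 < s := by have := norm_nonneg z₁; linarith
  have hsub : ∀ (z : Rn n) (r t : ℝ), ‖z‖ + r ≤ t → Metric.ball z r ⊆ Metric.ball 0 t := by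
    intro z r t h
    refine Metric.ball_subset_ball' ?_
    rw [dist_zero_right]; linarith
  filter_upwards [hS.splitValue_ae_eq_of_subset hK hω hn hTK hf hloc hint hr₁ hs0
      (hsub z₁ r₁ s hs1) (hsub z₁ _ _ (by have := norm_nonneg z₁; linarith)),
    hS.splitValue_ae_eq_of_subset hK hω hn hTK hf hloc hint hr₂ hs0
      (hsub z₂ r₂ s hs2) (hsub z₂ _ _ (by have := norm_nonneg z₂; linarith))] with x h1 h2 hx1 hx2
  rw [h1 hx1, h2 hx2]

/-- Values which are consistent between balls glue to a function. -/
theorem exists_isValue {f : Fin m → Rn n → ℂ}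
    (h : ∀ z₁ r₁ z₂ r₂, 0 < r₁ → 0 < r₂ → ∀ᵐ x ∂volume,
        x ∈ Metric.ball z₁ r₁ → x ∈ Metric.ball z₂ r₂ →
          splitValue K ps S f z₁ r₁ x = splitValue K ps S f z₂ r₂ x) :
    ∃ g, IsValue K ps S f g := by
  -- at `x`, the value from a ball around the origin of integer radius containing `x`
  refine ⟨fun x => splitValue K ps S f 0 (⌊‖x‖⌋₊ + 1) x, fun z r hr => ?_⟩
  filter_upwards [ae_all_iff.2 fun N : ℕ => h 0 (N + 1) z r (by positivity) hr] with x hx hxz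
  refine hx ⌊‖x‖⌋₊ ?_ hxz
  rw [mem_ball_zero_iff]
  exact Nat.lt_floor_add_one _

theorem IsCZKernel.aestronglyMeasurable_farValue (hK : IsCZKernel ω K) {f : Fin m → Rn n → ℂ}
    (hf : ∀ i, AEStronglyMeasurable (f i) volume) (z : Rn n) {r : ℝ} (hr : 0 < r) :
    AEStronglyMeasurable (farValue K f z r) (volume.restrict (Metric.ball z r)) := by
  refine Finset.aestronglyMeasurable_fun_sum _ fun J hJ => ?_
  obtain ⟨k, hk⟩ := (Finset.mem_filter.1 hJ).2
  refine hK.aestronglyMeasurable_integral (aestronglyMeasurable_pieceProd hf J)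
    (V := (Metric.ball z (2 * r))ᶜ) measurableSet_ball.compl ?_ k fun y hy => ?_
  · exact Set.disjoint_left.2 fun x hx hx2 => hx2 (Metric.ball_subset_ball (by linarith) hx)
  · exact pieceProd_eq_zero_of_mem hk (by simpa using hy)

/-- The `L^p` norm of the value over a ball. -/
theorem IsBoundedExtension.exists_eLpNorm_splitValue_le
    (hS : IsBoundedExtension T ps (fun g => eLpNorm g (ENNReal.ofReal p) volume) S)
    (hK : IsCZKernel ω K) (hp : 1 < p) (hps : ∀ i, 1 < ps i) (hsum : ∑ i, 1 / ps i = 1 / p)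
    (hφprod : ∀ x r, 0 < r → ∏ i, φs i x r ^ (1 / ps i) = φ x r ^ (1 / p))
    (hφ : GDec φ) (hφs : ∀ i, GDec (φs i)) {B : ℝ≥0} :
    ∃ C : ℝ≥0, ∀ f : Fin m → Rn n → ℂ, (∀ i, MemMorrey (ps i) (φs i) (f i)) → ∀ z r, 0 < r →
      (∀ x ∈ Metric.ball z r, ‖farValue K f z r x‖ₑ ≤
        B * ENNReal.ofReal (φ z r ^ (1 / p)) * ∏ i, morreyNorm (ps i) (φs i) (f i)) →
      AEStronglyMeasurable (splitValue K ps S f z r) (volume.restrict (Metric.ball z r)) ∧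
      eLpNorm (splitValue K ps S f z r) (ENNReal.ofReal p) (volume.restrict (Metric.ball z r)) ≤
        C * (∏ i, morreyNorm (ps i) (φs i) (f i)) *
          ENNReal.ofReal ((φ z r * (unitVol n * r ^ n)) ^ (1 / p)) := by
  have hp0 : 0 < p := by linarith
  have hv := unitVol_pos n
  obtain ⟨⟨CS, hCS⟩, -⟩ := hS
  obtain ⟨C, hC1, hC⟩ := hφ.exists_le
  have hC0 : 0 < C := by linarith
  refine ⟨CS * ((C * 2 ^ n) ^ (1 / p)).toNNReal + B, fun f hf z r hr hfar => ?_⟩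
  set N := ∏ i, morreyNorm (ps i) (φs i) (f i) with hN
  set W := ENNReal.ofReal ((φ z r * (unitVol n * r ^ n)) ^ (1 / p)) with hW
  have h0 := hφ.pos z hr
  set G := S (fun i => classLp (ps i) (piece f z r ∅ i)) with hG
  have hGm : AEStronglyMeasurable G (volume.restrict (Metric.ball z r)) :=
    G.aestronglyMeasurable.restrict
  have hFm := hK.aestronglyMeasurable_farValue (fun i => (hf i).1) z hr
  refine ⟨hGm.add hFm, ?_⟩
  have hGle : eLpNorm G (ENNReal.ofReal p) (volume.restrict (Metric.ball z r)) ≤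
      (CS * ((C * 2 ^ n) ^ (1 / p)).toNNReal : ℝ≥0) * N * W := by
    refine (eLpNorm_mono_measure _ Measure.restrict_le_self).trans ((hCS _).trans ?_)
    have h2r : 0 < 2 * r := by positivity
    calc _ ≤ (CS : ℝ≥0∞) * ∏ i, (morreyNorm (ps i) (φs i) (f i) *
          ENNReal.ofReal ((φs i z (2 * r) * (unitVol n * (2 * r) ^ n)) ^ (1 / ps i))) := by
          refine mul_le_mul_right (Finset.prod_le_prod' fun i _ => ?_) _
          have hpi : 0 < ps i := by linarith [hps i]
          rw [eLpNorm_classLp (memLp_piece_empty hpi (hφs i) (hf i) z hr)]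
          simp only [piece, Finset.notMem_empty, if_false]
          rw [eLpNorm_indicator_eq_eLpNorm_restrict measurableSet_ball]
          exact eLpNorm_ball_le_morreyNorm hpi (hφs i) (f i) z h2r
      _ = (CS : ℝ≥0∞) * (N *
          ENNReal.ofReal ((φ z (2 * r) * (unitVol n * (2 * r) ^ n)) ^ (1 / p))) := by
          have hpos : ∀ i, 0 < φs i z (2 * r) := fun i => (hφs i).pos z h2r
          have hb : 0 < unitVol n * (2 * r) ^ n := by positivity
          rw [Finset.prod_mul_distrib, ← ENNReal.ofReal_prod_of_nonneg (fun i _ => by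
            have := hpos i; positivity)]
          simp_rw [fun i => Real.mul_rpow (hpos i).le hb.le (z := 1 / ps i)]
          rw [Finset.prod_mul_distrib, hφprod z _ h2r, ← Real.rpow_sum_of_pos hb, hsum,
            Real.mul_rpow (hφ.pos z h2r).le hb.le]
      _ ≤ (CS : ℝ≥0∞) * (N * (ENNReal.ofReal ((C * 2 ^ n) ^ (1 / p)) * W)) := by
          refine mul_le_mul_right (mul_le_mul_right ?_ _) _
          rw [hW, ← ENNReal.ofReal_mul (by positivity)]
          refine ENNReal.ofReal_le_ofReal ?_
          have h1 := hφ.pos z h2r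
          rw [← Real.mul_rpow (by positivity) (by positivity)]
          refine Real.rpow_le_rpow (by positivity) ?_ (by positivity)
          calc φ z (2 * r) * (unitVol n * (2 * r) ^ n)
              ≤ (C * φ z r) * (unitVol n * (2 * r) ^ n) := by
                gcongr; exact hC z r _ hr (by linarith)
            _ = _ := by rw [mul_pow]; ring
      _ = _ := by
          push_cast
          rw [← ENNReal.ofReal.eq_1]
          ring
  have hFle : eLpNorm (farValue K f z r) (ENNReal.ofReal p) (volume.restrict (Metric.ball z r)) ≤
      B * N * W := by
    have h1 := eLpNorm_le_of_ae_enorm_bound (p := ENNReal.ofReal p)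
      (μ := volume.restrict (Metric.ball z r)) (f := farValue K f z r)
      ((ae_restrict_iff' measurableSet_ball).2 (Eventually.of_forall hfar))
    refine h1.trans (le_of_eq ?_)
    have hb : 0 < unitVol n * r ^ n := by positivity
    rw [Measure.restrict_apply_univ, volume_ball z hr, ENNReal.toReal_ofReal hp0.le,
      ENNReal.ofReal_rpow_of_pos hb, smul_eq_mul, hW, Real.mul_rpow h0.le hb.le,
      ENNReal.ofReal_mul (by positivity), one_div]
    ring
  calc _ ≤ eLpNorm G (ENNReal.ofReal p) (volume.restrict (Metric.ball z r)) +
        eLpNorm (farValue K f z r) (ENNReal.ofReal p) (volume.restrict (Metric.ball z r)) :=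
        eLpNorm_add_le hGm hFm (by simpa using ENNReal.ofReal_le_ofReal hp.le)
    _ ≤ _ := add_le_add hGle hFle
    _ = _ := by push_cast; ring

end MorreyOperator


theorem lemma3p1 {n m : ℕ} (hn : 1 ≤ n) (hm : 1 ≤ m)
    (ω : ℝ → ℝ) (K : Rn n → (Fin m → Rn n) → ℂ)
    (T : MultilinearMap ℂ (fun _ : Fin m => 𝓢(Rn n, ℂ)) 𝓢'(Rn n, ℂ))
    (hT : IsCZOperator ω K T)
    (hω : IntegrableOn (fun t => ω t * Real.log (1 / t) / t) (Ioo 0 1))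
    (p : ℝ) (hp : 1 < p) (ps : Fin m → ℝ) (hps : ∀ i, 1 < ps i) (hsum : ∑ i, 1 / ps i = 1 / p)
    (φ : Rn n → ℝ → ℝ) (φs : Fin m → Rn n → ℝ → ℝ)
    (hφprod : ∀ x r, 0 < r → ∏ i, φs i x r ^ (1 / ps i) = φ x r ^ (1 / p))
    (hφ : GDec φ) (hφs : ∀ i, GDec (φs i))
    (hφlim : HasFullRange φ) (hφslim : ∀ i, HasFullRange (φs i))
    (hφtail : HasTailBound φ) :
    -- `T` has exactly one bounded extension to `L^{p_1} × ⋯ × L^{p_m} → L^p`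
    (∃! S, IsBoundedExtension T ps (fun g => eLpNorm g (ENNReal.ofReal p) volume) S) ∧
    ∀ S, IsBoundedExtension T ps (fun g => eLpNorm g (ENNReal.ofReal p) volume) S →
    ∃ C : ℝ≥0, ∀ f : Fin m → Rn n → ℂ, (∀ i, MemMorrey (ps i) (φs i) (f i)) →
      (∀ z r, 0 < r →
        -- the local parts lie in the domain of the extension
        (∀ i, MemLp (piece f z r ∅ i) (ENNReal.ofReal (ps i)) volume) ∧
        ∫⁻ t in Ioi (2 * r), ENNReal.ofReal (φ z t ^ (1 / p) / t) < ∞ ∧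
        ∀ x ∈ Metric.ball z r,
          -- all terms with at least one far index converge absolutely
          (∀ J : Finset (Fin m), J.Nonempty →
            Integrable (fun y : Fin m → Rn n => K x y * pieceProd f z r J y) volume) ∧
          -- the term in which all indices are far
          ∫⁻ y : Fin m → Rn n, ‖K x y * pieceProd f z r Finset.univ y‖ₑ ≤
            C * (∫⁻ t in Ioi (2 * r), ENNReal.ofReal (φ z t ^ (1 / p) / t)) *
              ∏ i, morreyNorm (ps i) (φs i) (f i) ∧
          -- the sum of the mixed terms
          ∫⁻ y : Fin m → Rn n, ‖K x y * ∑ J : Finset (Fin m) with J.Nonempty ∧ J ≠ Finset.univ,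
              pieceProd f z r J y‖ₑ ≤
            C * (∫⁻ t in Ioi (2 * r), ENNReal.ofReal (φ z t ^ (1 / p) / t)) *
              ∏ i, morreyNorm (ps i) (φs i) (f i)) ∧
      -- independence of the ball
      (∀ z₁ r₁ z₂ r₂, 0 < r₁ → 0 < r₂ → ∀ᵐ x ∂volume,
        x ∈ Metric.ball z₁ r₁ → x ∈ Metric.ball z₂ r₂ →
          splitValue K ps S f z₁ r₁ x = splitValue K ps S f z₂ r₂ x) ∧
      -- so `T(f)` is defined almost everywhere, and it is bounded between the Morrey spaces
      (∃ g, IsValue K ps S f g) ∧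
      ∀ g, IsValue K ps S f g → MemMorrey p φ g ∧
        morreyNorm p φ g ≤ C * ∏ i, morreyNorm (ps i) (φs i) (f i) := by
  have hK := hT.kernel
  have hpos : 0 < p := by linarith
  have hps0 : ∀ i, 0 < ps i := fun i => by linarith [hps i]
  refine ⟨hT.existsUnique_isBoundedExtension hn hm hp hps hsum, fun S hS => ?_⟩
  have hw := hS.isWeakExtension_of_eLpNorm hps hp.le hsum
  obtain ⟨A, hA⟩ := hK.exists_kernelBounds
  obtain ⟨C₁, hC₁⟩ := hA.exists_lintegral_far_le_morreyNorm hp hps hφprod hφ hφs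
  obtain ⟨C₂, hC₂⟩ := hφtail.exists_lintegral_rpow_le hφ hpos
  obtain ⟨C₃, hC₃⟩ := hS.exists_eLpNorm_splitValue_le hK hp hps hsum hφprod hφ hφs
    (B := 2 ^ m * C₁ * C₂)
  refine ⟨2 ^ m * C₁ + C₃, fun f hf => ?_⟩
  have hfm : ∀ i, AEStronglyMeasurable (f i) volume := fun i => (hf i).1
  set N := ∏ i, morreyNorm (ps i) (φs i) (f i) with hN
  have hNtop : N ≠ ∞ := ENNReal.prod_ne_top fun i _ => (hf i).2.ne
  have hItop : ∀ z r, 0 < r → ∫⁻ t in Ioi (2 * r), ENNReal.ofReal (φ z t ^ (1 / p) / t) < ∞ :=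
    fun z r hr => (hC₂ z r hr).trans_lt (ENNReal.mul_lt_top ENNReal.coe_lt_top
      ENNReal.ofReal_lt_top)
  have hfar : ∀ z r, 0 < r → ∀ x ∈ Metric.ball z r, ∀ J : Finset (Fin m), J.Nonempty →
      ∫⁻ y, ‖K x y * pieceProd f z r J y‖ₑ ≤
        C₁ * (∫⁻ t in Ioi (2 * r), ENNReal.ofReal (φ z t ^ (1 / p) / t)) * N :=
    fun z r hr x hx J hJ => (lintegral_pieceProd_le hr hJ x).trans (hC₁ f hfm z r hr x hx)
  -- Independence of the ball also needs integrability for the functions cut off to a larger ball.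
  have hint : ∀ h : Fin m → Rn n → ℂ, (∀ i, AEStronglyMeasurable (h i) volume) →
      (∀ i x, ‖h i x‖ₑ ≤ ‖f i x‖ₑ) → ∀ z r, 0 < r → ∀ x ∈ Metric.ball z r,
      ∀ J : Finset (Fin m), J.Nonempty → Integrable fun y => K x y * pieceProd h z r J y := by
    intro h hh hhf z r hr x hx J hJ
    refine ⟨(hK.aestronglyMeasurable hn hm hT.modulus x).mul
      (aestronglyMeasurable_pieceProd hh J), ?_⟩
    refine ((lintegral_pieceProd_le hr hJ x).trans (hC₁ h hh z r hr x hx)).trans_lt ?_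
    refine ENNReal.mul_lt_top (ENNReal.mul_lt_top ENNReal.coe_lt_top (hItop z r hr)) ?_
    exact (ENNReal.prod_ne_top fun i _ =>
      ((morreyNorm_mono (hps0 i) (hφs i) (hhf i)).trans_lt (hf i).2).ne).lt_top
  have hloc : ∀ z r, 0 < r → ∀ i, MemLp (piece f z r ∅ i) (ENNReal.ofReal (ps i)) volume :=
    fun z r hr i => memLp_piece_empty (hps0 i) (hφs i) (hf i) z hr
  have hcard : ∀ (P : Finset (Fin m) → Prop) [DecidablePred P],
      (((Finset.univ.filter P).card : ℕ) : ℝ≥0∞) ≤ 2 ^ m := fun P _ => by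
    exact_mod_cast card_filter_finset_le P
  have hsum_le : ∀ (P : Finset (Fin m) → Prop) [DecidablePred P], (∀ J, P J → J.Nonempty) →
      ∀ z r, 0 < r → ∀ x ∈ Metric.ball z r,
      ∑ J : Finset (Fin m) with P J, ∫⁻ y, ‖K x y * pieceProd f z r J y‖ₑ ≤
        2 ^ m * C₁ * (∫⁻ t in Ioi (2 * r), ENNReal.ofReal (φ z t ^ (1 / p) / t)) * N := by
    intro P _ hP z r hr x hx
    refine (Finset.sum_le_sum fun J hJ =>
      hfar z r hr x hx J (hP J (Finset.mem_filter.1 hJ).2)).trans ?_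
    rw [Finset.sum_const, nsmul_eq_mul, mul_assoc (2 ^ m : ℝ≥0∞), mul_assoc (2 ^ m : ℝ≥0∞)]
    exact mul_le_mul_left (hcard P) _
  have hC_le : (2 ^ m * C₁ : ℝ≥0∞) ≤ ((2 ^ m * C₁ + C₃ : ℝ≥0) : ℝ≥0∞) := by
    push_cast; exact le_self_add
  have hindep := hw.splitValue_ae_eq hK hT.modulus hn hT.hasKernel hfm hloc hint
  refine ⟨fun z r hr => ⟨hloc z r hr, hItop z r hr, fun x hx =>
    ⟨hint f hfm (fun _ _ => le_rfl) z r hr x hx, ?_, ?_⟩⟩, hindep, exists_isValue hindep,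
    fun g hg => ?_⟩
  · have : Nonempty (Fin m) := ⟨⟨0, hm⟩⟩
    refine (hfar z r hr x hx _ Finset.univ_nonempty).trans ?_
    refine mul_le_mul_left (mul_le_mul_left (le_trans ?_ hC_le) _) _
    exact le_mul_of_one_le_left zero_le (one_le_pow₀ one_le_two)
  · calc _ ≤ ∫⁻ y, ∑ J : Finset (Fin m) with J.Nonempty ∧ J ≠ Finset.univ,
          ‖K x y * pieceProd f z r J y‖ₑ := by
          refine lintegral_mono fun y => ?_
          rw [Finset.mul_sum]
          exact enorm_sum_le _ _
      _ = ∑ J : Finset (Fin m) with J.Nonempty ∧ J ≠ Finset.univ,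
          ∫⁻ y, ‖K x y * pieceProd f z r J y‖ₑ :=
          lintegral_finsetSum' _ fun J hJ => (hint f hfm (fun _ _ => le_rfl) z r hr x hx J
            (Finset.mem_filter.1 hJ).2.1).aestronglyMeasurable.enorm
      _ ≤ 2 ^ m * C₁ * (∫⁻ t in Ioi (2 * r), ENNReal.ofReal (φ z t ^ (1 / p) / t)) * N :=
          hsum_le _ (fun J hJ => hJ.1) z r hr x hx
      _ ≤ _ := mul_le_mul_left (mul_le_mul_left hC_le _) _
  · have hball : ∀ z r, 0 < r →
        AEStronglyMeasurable (splitValue K ps S f z r) (volume.restrict (Metric.ball z r)) ∧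
        eLpNorm (splitValue K ps S f z r) (ENNReal.ofReal p)
            (volume.restrict (Metric.ball z r)) ≤
          C₃ * N * ENNReal.ofReal ((φ z r * (unitVol n * r ^ n)) ^ (1 / p)) := by
      intro z r hr
      refine hC₃ f hf z r hr fun x hx => ?_
      refine (enorm_sum_le _ _).trans ((Finset.sum_le_sum fun J _ =>
        enorm_integral_le_lintegral_enorm _).trans ?_)
      refine (hsum_le _ (fun J hJ => hJ) z r hr x hx).trans ?_
      refine mul_le_mul_left ?_ _
      refine (mul_le_mul_right (hC₂ z r hr) _).trans (le_of_eq ?_)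
      push_cast
      ring
    have hae : ∀ z r, 0 < r →
        g =ᵐ[volume.restrict (Metric.ball z r)] splitValue K ps S f z r := fun z r hr =>
      (ae_restrict_iff' measurableSet_ball).2 (hg z r hr)
    have hgm : AEStronglyMeasurable g volume := by
      rw [← Measure.restrict_univ (μ := (volume : Measure (Rn n))),
        ← Metric.iUnion_ball_nat_succ (0 : Rn n)]
      refine AEStronglyMeasurable.iUnion fun k => ?_
      exact (hball 0 (k + 1) (by positivity)).1.congr (hae 0 (k + 1) (by positivity)).symm
    have hgle : morreyNorm p φ g ≤ (2 ^ m * C₁ + C₃ : ℝ≥0) * N := by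
      refine (morreyNorm_le_iff hpos hφ g _).2 fun z r hr => ?_
      rw [eLpNorm_congr_ae (hae z r hr)]
      refine (hball z r hr).2.trans (mul_le_mul_left (mul_le_mul_left ?_ _) _)
      push_cast
      exact le_add_self
    exact ⟨⟨hgm, hgle.trans_lt (ENNReal.mul_lt_top ENNReal.coe_lt_top hNtop.lt_top)⟩, hgle⟩
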